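/- **Theorem 1 (single-shot QEC).** *Lattice.* Let $\mathcal K$ be a finite octahedral lattice tessellating a closed connected 3-manifold with $H_1(\mathcal K;\mathbb F_2)=0$ (e.g. the 3-sphere), with vertices coloured $R,B,G,Y$ so that the three pairs of opposite vertices of every octahedron are two different $R$ vertices, two different $B$ vertices, and a $G$ and a $Y$ vertex. Let $\mathcal L$ be obtained from $\mathcal K$ by removing one octahedron; cells of the removed octahedron are called boundary cells, all others interior. The 3D subsystem toric code (STC) on $\mathcal L$ has one qubit per remaining octahedron, $X$-type gauge generators $X(\mu)$ for the interior $RG$ and $RY$ edges $\mu$, (measured) $Z$-type gauge generators $Z(\nu)$ for the interior $BG$ and $BY$ edges $\nu$, and $Z$-type stabilizer generators $Z(v)$ for the interior $B$ vertices $v$, each supported on the remaining octahedra containing the cell. A Pauli $X$ operator is identified with its support, a vector over $\mathbb F_2$ indexed by qubits; $|\cdot|$ is Hamming weight. For a Pauli $X$ operator $N$, $\delta_M N$ is the set of measured generators anticommuting with $N$, and $\partial N$ the set of stabilizer generators anticommuting with $N$. For a measurement outcome $\zeta$ (a set of measured generators), $\partial\zeta$ is the set of interior $B$ vertices incident to an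 odd number of $BG$ edges of $\zeta$, and $\delta_R\zeta$ the set of interior $B,G,Y$ vertices incident to an odd number of edges of $\zeta$. A flux is an outcome $\delta_M(N+\gamma)$, with $N$ a Pauli $X$ operator and $\gamma$ a product of $X$-type gauge generators. The qubit graph has the $B$ vertices as vertices and one edge per qubit, joining its two $B$ vertices. Let $\Delta_{\rm qub}$ be the maximum degree of its interior vertices and $\Sigma_{\rm qub}$ the sum of the degrees of its boundary vertices. For an interior $B$, $G$ or $Y$ vertex let its degree be the number of interior $BG$ and $BY$ edges, plus the number of qubits if it is a $B$ vertex, containing it; $\Delta_{\mathcal L}$ is the maximum of these degrees. *Decoder.* Fix maps choosing, for every $\zeta$, a minimum-weight $\hat\mu=\hat\mu(\delta_R\zeta)$ with $\delta_R\hat\mu=\delta_R\zeta$, and, for every achievable syndrome $\sigma$, a minimum-weight Pauli $X$ operator $R_\sigma$ with $\partial R_\sigma=\sigma$ (ties broken arbitrarily). Let $\Pi^{\mathcal S}_\sigma$ and $\Pi^{\mathcal G}_\phi$ be the projections onto the subspaces of $Z$-type stabilizer syndrome $\sigma$ and of measured-generator outcome $\phi$. A distribution $p$ on the subsets of a finite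 set is $\tau$-bounded if $\sum_{B'\supseteq B}p(B')\le\tau^{|B|}$ for all $B$. The single-shot MWPM decoding channel with measurement-error distribution $p$ is the map with Kraus operators $\{\sqrt{p(\mu)}\,R_{\sigma+\partial(\mu+\hat\mu)}\Pi^{\mathcal S}_\sigma\}_{\mu,\sigma}$, where $\hat\mu=\hat\mu(\delta_R\mu)$; its flux version has Kraus operators $\{\sqrt{p(\mu)}\,R_{\partial(\zeta+\hat\mu(\delta_R\zeta))}\Pi^{\mathcal G}_\phi\}_{\mu,\phi}$ with observed outcome $\zeta=\phi+\mu$. Let $\mathbb R_\eta$ and $\mathbb R^{\mathcal G}_\eta$ be the sets of these channels with $p$ $\eta$-bounded, and let $\mathcal D=\{\Pi^{\mathcal G}_\phi\}_\phi$ be the gauge measurement with forgotten outcome. *Noise.* A Pauli $X$ channel $\mathcal N=\{\sqrt{p(N)}N\}_N$ has failure probability $\sum p(N)$ over all $N$ for which $R_{\partial N}N$ is not a product of $X$-type gauge generators. Two Pauli $X$ channels are equivalent if the induced distributions of $R_{\partial N}$ coincide. $\mathbb N_{\tau,\epsilon}$ is the set of Pauli $X$ channels with failure probability at most $\epsilon$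 that are equivalent to a Pauli $X$ channel with $\tau$-bounded distribution. For sets of channels, $\circ$ denotes elementwise composition; $\Pi_0^{\mathcal S}$ also denotes the map $\rho\mapsto\Pi_0^{\mathcal S}\rho\,\Pi_0^{\mathcal S}$. *Constants.* Let $c_{\rm flu}>0$, $t=1+c_{\rm flu}^{-1}$, $r=(2+2c_{\rm flu})^{-1}$, $\tau^*=(2(\Delta_{\rm qub}-1))^{-2}$ and, with $\mathfrak e$ Euler's number, $$f(\tau)=\frac{\Sigma_{\rm qub}\,\tau^*}{\sqrt{\tau^*}-\sqrt{\tau}}\Big(\frac{\tau}{\tau^*}\Big)^{L/2},\quad \tau'=2^{2t-1}(\mathfrak e\,\eta^r)^t(\Delta_{\mathcal L}-1)^{t-1},\quad \epsilon'=\epsilon+f(\tau)+f(\tau+\tau').$$ Call $\eta,\tau\ge0$ *small* (for $\mathcal L$) if $\eta<(\mathfrak e-1)^{1/r}\big(4\mathfrak e^2(\Delta_{\mathcal L}-1)\big)^{-1/r}$ and $\tau+\tau'<\tau^*$. **(a)** Let $L\ge1$ and let $\mathcal L$ have at least one interior $B$ vertex, distance at least $L$ between any two different boundary vertices in the qubit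 graph, and confinement of the flux: for every flux $\phi$ there is a Pauli $X$ operator $M$ with $\partial M=\partial\phi$ and $|M|\le c_{\rm flu}|\phi|$. Then for every choice of decoder, all small $\eta,\tau\ge0$ and all $\epsilon$, $$\mathbb R_\eta\circ\mathbb N_{\tau,\epsilon}\circ\Pi_0^{\mathcal S}\subseteq\mathbb N_{\tau',\epsilon'}\circ\Pi_0^{\mathcal S}\quad\text{and}\quad \mathbb R^{\mathcal G}_\eta\circ\mathbb N_{\tau,\epsilon}\circ\Pi_0^{\mathcal S}\subseteq\mathbb N_{\tau',\epsilon'}\circ\mathcal D\circ\Pi_0^{\mathcal S}.$$ **(b)** Let $(\mathcal L_L)_{L\ge1}$ be a family of such lattices, each with an interior $B$ vertex, with $\Delta_{\mathcal L}$ and $\Delta_{\rm qub}$ bounded by constants and $\Sigma_{\rm qub}$ bounded by a polynomial in $L$. Then there are $\eta_0,\tau_0>0$ such that all $0\le\eta<\eta_0$, $0\le\tau<\tau_0$ are small for every $\mathcal L_L$; $\tau'\to0$ as $\eta\to0$, uniformly in $L$; and $\epsilon'\to\epsilon$ as $L\to\infty$ for all $\eta,\tau\ge0$ that are small for all large $L$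 and all $\epsilon$. -/

import Mathlib

/-- The four colours of the vertices of the lattice. -/
inductive Color where
  | R | B | G | Y
  deriving DecidableEq

instance : Fintype Color := ⟨{.R, .B, .G, .Y}, by intro c; cases c <;> decide⟩

/-- A closed three-dimensional coloured triangulation, encoded by its finite set `T` of tetrahedra.
Every tetrahedron has one vertex of each colour, and `s c t` is the unique other tetrahedron that
is glued to `t` along the triangle of `t` opposite to its vertex of colour `c` (the gluing respects
the colours, so that no further data are needed).

A colourable octahedral lattice is such a triangulation: every octahedron, with two antipodal `R`
vertices, two antipodal `B` vertices and antipodal vertices `G` and `Y`, is split along its `GY`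
axis into the four tetrahedra spanned by the axis and an `RB` edge. -/
structure ColoredTriangulation where
  T : Type
  [fintypeT : Fintype T]
  [nonemptyT : Nonempty T]
  s : Color → T → T
  s_invol : ∀ c t, s c (s c t) = t
  s_ne : ∀ c t, s c t ≠ t

namespace ColoredTriangulation

open scoped Classical

attribute [instance] ColoredTriangulation.fintypeT ColoredTriangulation.nonemptyT

variable (K : ColoredTriangulation)

/-- Two tetrahedra share the cell spanned by their vertices with colours in `C` iff one gets from
one to the other by crossing triangles opposite to vertices with colours outside `C`. -/
def cellSetoid (C : Finset Color) : Setoid K.T :=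
  Relation.EqvGen.setoid fun t t' => ∃ d, d ∉ C ∧ t' = K.s d t

/-- The cells of the triangulation whose vertices have the colours `C`: vertices, edges,
triangles, tetrahedra for `C` of size 1, 2, 3, 4. -/
def Cell (C : Finset Color) : Type := Quotient (K.cellSetoid C)

/-- The cell with colours `C` of the tetrahedron `t`. -/
def cell (C : Finset Color) (t : K.T) : K.Cell C := Quotient.mk (K.cellSetoid C) t

noncomputable instance instFintypeCell (C : Finset Color) : Fintype (K.Cell C) :=
  inferInstanceAs (Fintype (Quotient (K.cellSetoid C)))

/-- Two cells are incident iff they belong to a common tetrahedron. For colour sets `C ⊆ C'` this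
says that the first cell is a face of the second one. -/
def Inc {K : ColoredTriangulation} {C C' : Finset Color} (a : K.Cell C) (b : K.Cell C') : Prop :=
  ∃ t, K.cell C t = a ∧ K.cell C' t = b

/-- The link of the vertex `v` (a closed connected surface) has Euler characteristic 2, so that it
is a 2-sphere. -/
def LinkIsSphere {c : Color} (v : K.Cell {c}) : Prop :=
  (∑ C : Finset Color with C.card = 2 ∧ c ∈ C, Nat.card {e : K.Cell C // Inc v e})
      + Nat.card {t : K.T // K.cell {c} t = v}
    = (∑ C : Finset Color with C.card = 3 ∧ c ∈ C, Nat.card {f : K.Cell C // Inc v f}) + 2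

/-- The first simplicial homology group with coefficients in `ZMod 2` vanishes: every mod 2 cycle
`z` of edges is the mod 2 boundary of a chain `w` of triangles. -/
def H1Vanishes : Prop :=
  ∀ z : (C : Finset Color) → K.Cell C → ZMod 2,
    (∀ (c : Color) (v : K.Cell {c}),
      (∑ C : Finset Color with C.card = 2 ∧ c ∈ C, ∑ e : K.Cell C with Inc v e, z C e) = 0) →
    ∃ w : (C : Finset Color) → K.Cell C → ZMod 2,
      ∀ C : Finset Color, C.card = 2 → ∀ e : K.Cell C,
        z C e = ∑ C' : Finset Color with C'.card = 3 ∧ C ⊆ C', ∑ f : K.Cell C' with Inc e f, w C' f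

end ColoredTriangulation

open Color in
/-- A lattice of the three-dimensional subsystem toric code: a colourable octahedral lattice that
tessellates a closed connected 3-manifold with vanishing first homology mod 2 (such as the
3-sphere), from which one octahedron is removed. The octahedra correspond to their `GY` axes. -/
structure STCLattice extends ColoredTriangulation where
  /-- Going around a `GY` edge one meets exactly four tetrahedra. -/
  s_comm : ∀ t, s R (s B t) = s B (s R t)
  /-- The two `R` vertices of an octahedron are different. -/
  R_ne : ∀ t, toColoredTriangulation.cell {R} (s R t) ≠ toColoredTriangulation.cell {R} t
  /-- The two `B` vertices of an octahedron are different. -/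
  B_ne : ∀ t, toColoredTriangulation.cell {B} (s B t) ≠ toColoredTriangulation.cell {B} t
  connected : ∀ t t', toColoredTriangulation.cell ∅ t = toColoredTriangulation.cell ∅ t'
  manifold : ∀ (c : Color) (v : toColoredTriangulation.Cell {c}),
    toColoredTriangulation.LinkIsSphere v
  homology : toColoredTriangulation.H1Vanishes
  /-- The removed octahedron. Its surface is the boundary of the lattice. -/
  removed : toColoredTriangulation.Cell {G, Y}

/-- The weight of a vector over `ZMod 2`: the size of the corresponding subset of `A`. -/
def weight {A : Type} [Fintype A] (x : A → ZMod 2) : ℕ := hammingNorm x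

/-- `p` is a probability distribution. -/
def IsDist {X : Type} [Fintype X] (p : X → ℝ) : Prop := (∀ x, 0 ≤ p x) ∧ ∑ x, p x = 1

open scoped Classical in
/-- `p`, a distribution over the subsets of `A` (written as vectors over `ZMod 2`), is
`τ`-bounded. -/
def IsBounded {A : Type} [Fintype A] (τ : ℝ) (p : (A → ZMod 2) → ℝ) : Prop :=
  ∀ x, (∑ y : A → ZMod 2 with ∀ a, x a ≠ 0 → y a ≠ 0, p y) ≤ τ ^ weight x

/-- The completely positive map with Kraus operators `κ i`. -/
def krausMap {n ι : Type} [Fintype n] [Fintype ι] (κ : ι → Matrix n n ℂ) :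
    Matrix n n ℂ → Matrix n n ℂ :=
  fun ρ => ∑ i, κ i * ρ * (κ i).conjTranspose

/-- The composition of two collections of channels. -/
def compClass {X : Type} (𝒜 ℬ : Set (X → X)) : Set (X → X) :=
  Set.image2 (fun Φ Ψ => Φ ∘ Ψ) 𝒜 ℬ

namespace STCLattice

open scoped Classical
open ColoredTriangulation Color

variable (Λ : STCLattice)

/-- A cell belongs to the boundary of the lattice. -/
def OnBoundary {Λ : STCLattice} {C : Finset Color} (a : Λ.Cell C) : Prop := Inc a Λ.removed

/-- The cells with colours `C` in the interior of the lattice. -/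
abbrev Interior (C : Finset Color) : Type := {a : Λ.Cell C // ¬ OnBoundary a}

/-- The physical qubits: the octahedra other than the removed one. They are also the edges of the
qubit graph, whose vertices are the `B` vertices. -/
abbrev Qubit : Type := {q : Λ.Cell {G, Y} // q ≠ Λ.removed}

/-- The measured `Z`-type gauge generators: the interior `BG` and `BY` edges. They are also the
edges of the measurement graph. -/
abbrev Meas : Type := Λ.Interior {B, G} ⊕ Λ.Interior {B, Y}

/-- The `X`-type gauge generators: the interior `RG` and `RY` edges. -/
abbrev XGen : Type := Λ.Interior {R, G} ⊕ Λ.Interior {R, Y}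

/-- The `Z`-type stabilizer generators: the interior `B` vertices. -/
abbrev Stab : Type := Λ.Interior {B}

/-- The locations of the Gauss law: the interior vertices of the measurement graph, of colour
`B`, `G` or `Y`. -/
abbrev GaussVertex : Type := Λ.Interior {B} ⊕ Λ.Interior {G} ⊕ Λ.Interior {Y}

/-- The endpoints of the edges of the measurement graph. -/
def MeasInc {Λ : STCLattice} : Λ.Meas → Λ.GaussVertex → Prop
  | .inl e, .inl b => Inc e.1 b.1
  | .inl e, .inr (.inl g) => Inc e.1 g.1
  | .inl _, .inr (.inr _) => False
  | .inr e, .inl b => Inc e.1 b.1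
  | .inr _, .inr (.inl _) => False
  | .inr e, .inr (.inr y) => Inc e.1 y.1

/-- The support of a measured `Z`-type gauge generator. -/
def MeasSupp {Λ : STCLattice} : Λ.Meas → Λ.Qubit → Prop
  | .inl e, q => Inc e.1 q.1
  | .inr e, q => Inc e.1 q.1

/-- The support of an `X`-type gauge generator. -/
def XGenSupp {Λ : STCLattice} : Λ.XGen → Λ.Qubit → Prop
  | .inl e, q => Inc e.1 q.1
  | .inr e, q => Inc e.1 q.1

/-! The vector spaces over `ZMod 2`; vectors are identified with subsets of the basis. -/

abbrev CQ : Type := Λ.Qubit → ZMod 2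
abbrev CM : Type := Λ.Meas → ZMod 2
abbrev CS : Type := Λ.Stab → ZMod 2
abbrev CR : Type := Λ.GaussVertex → ZMod 2
abbrev CG : Type := Λ.XGen → ZMod 2

variable {Λ}

/-- The support of an `X`-type gauge operator. -/
noncomputable def bdQ (γ : Λ.CG) : Λ.CQ := fun q => ∑ x : Λ.XGen with XGenSupp x q, γ x

/-- The measured gauge operators that anticommute with a Pauli `X` error. -/
noncomputable def deltaM (x : Λ.CQ) : Λ.CM := fun m => ∑ q : Λ.Qubit with MeasSupp m q, x q

/-- The stabilizer syndrome of a Pauli `X` error. -/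
noncomputable def bdS (x : Λ.CQ) : Λ.CS := fun v => ∑ q : Λ.Qubit with Inc v.1 q.1, x q

/-- The stabilizer syndrome of a measurement outcome, read off from the `BG` edges. -/
noncomputable def deltaS (ζ : Λ.CM) : Λ.CS :=
  fun v => ∑ e : Λ.Interior {B, G} with Inc v.1 e.1, ζ (.inl e)

/-- The relation syndrome of a measurement outcome (the violations of the Gauss law). -/
noncomputable def deltaR (ζ : Λ.CM) : Λ.CR := fun v => ∑ m : Λ.Meas with MeasInc m v, ζ m

/-- A `Z`-type gauge flux: a measurement outcome in the absence of measurement errors. -/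
def IsFlux (φ : Λ.CM) : Prop := ∃ (x : Λ.CQ) (γ : Λ.CG), φ = deltaM x + deltaM (bdQ γ)

/-- A Pauli `X` operator belongs to the gauge group. -/
def InGauge (x : Λ.CQ) : Prop := ∃ γ : Λ.CG, x = bdQ γ

variable (Λ)

/-- Confinement of the flux with constant `c`. -/
def FluxConfinement (c : ℝ) : Prop :=
  ∀ φ : Λ.CM, IsFlux φ → ∃ x : Λ.CQ, bdS x = deltaS φ ∧ (weight x : ℝ) ≤ c * weight φ

/-! ### Degrees and distances -/

/-- The degree of a vertex in the hypergraph obtained from the union of the measurement graph and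
the qubit graph by removing the boundary vertices. -/
noncomputable def degL : Λ.GaussVertex → ℕ
  | .inl b => Nat.card {m : Λ.Meas // MeasInc m (.inl b)} + Nat.card {q : Λ.Qubit // Inc b.1 q.1}
  | .inr w => Nat.card {m : Λ.Meas // MeasInc m (.inr w)}

/-- The degree of a `B` vertex in the qubit graph. -/
noncomputable def degQub (b : Λ.Cell {B}) : ℕ := Nat.card {q : Λ.Qubit // Inc b q.1}

/-- The maximum vertex degree of the hypergraph. -/
noncomputable def maxDegL : ℕ := Finset.univ.sup Λ.degL

/-- The maximum degree of the interior vertices of the qubit graph. -/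
noncomputable def maxDegQub : ℕ := Finset.univ.sup fun b : Λ.Stab => Λ.degQub b.1

/-- The sum of the degrees of the boundary vertices of the qubit graph. -/
noncomputable def bdDegSum : ℕ := ∑ b : Λ.Cell {B} with OnBoundary b, Λ.degQub b

/-- Adjacency in the qubit graph. -/
def qubGraph : SimpleGraph (Λ.Cell {B}) where
  Adj b b' := b ≠ b' ∧ ∃ q : Λ.Qubit, Inc b q.1 ∧ Inc b' q.1
  symm := ⟨fun _ _ h => ⟨h.1.symm, h.2.imp fun _ hq => ⟨hq.2, hq.1⟩⟩⟩
  loopless := ⟨fun _ h => h.1 rfl⟩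

/-- Different boundary vertices of the qubit graph have distance at least `L`. -/
def BoundaryDistGE (L : ℕ) : Prop :=
  ∀ b b' : Λ.Cell {B}, OnBoundary b → OnBoundary b' → b ≠ b' → (L : ℕ∞) ≤ Λ.qubGraph.edist b b'

/-! ### Decoders -/

/-- The two minimum-weight perfect matching subroutines of the single-shot decoder; ties are
broken arbitrarily. `est` estimates the measurement error from its relation syndrome, and `recov`
finds a recovery operator for a stabilizer syndrome. Inputs without any solution are irrelevant. -/
structure Decoder where
  est : Λ.CR → Λ.CM
  recov : Λ.CS → Λ.CQ
  est_syndrome : ∀ ζ, deltaR (est (deltaR ζ)) = deltaR ζ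
  est_min : ∀ ζ, weight (est (deltaR ζ)) ≤ weight ζ
  recov_syndrome : ∀ x, bdS (recov (bdS x)) = bdS x
  recov_min : ∀ x, weight (recov (bdS x)) ≤ weight x

/-! ### Operators and channels -/

/-- Operators on the Hilbert space of the qubits, as matrices in the computational basis. -/
abbrev Op : Type := Matrix Λ.CQ Λ.CQ ℂ

variable {Λ}

/-- The Pauli `X` operator with support `x`. -/
noncomputable def pauliX (x : Λ.CQ) : Λ.Op := Matrix.of fun a b => if a = b + x then 1 else 0

/-- The projection onto the subspace with stabilizer syndrome `σ`: on it, the product of the Pauli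
`Z` operators around every interior `B` vertex `v` is `(-1) ^ σ v`. -/
noncomputable def projS (σ : Λ.CS) : Λ.Op := Matrix.diagonal fun a => if bdS a = σ then 1 else 0

/-- The projection onto the subspace with flux `φ`: on it, every measured gauge operator `m` is
`(-1) ^ φ m`. -/
noncomputable def projG (φ : Λ.CM) : Λ.Op := Matrix.diagonal fun a => if deltaM a = φ then 1 else 0

/-- The Pauli `X` channel with error distribution `p`. -/
noncomputable def pauliChannel (p : Λ.CQ → ℝ) : Λ.Op → Λ.Op :=
  krausMap fun x => (Real.sqrt (p x) : ℂ) • pauliX x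

variable (Λ)

/-- The projection onto the code subspace, as a map on operators. -/
noncomputable def codeProj : Λ.Op → Λ.Op := krausMap fun _ : Unit => projS (0 : Λ.CS)

/-- The ideal measurement of all measured gauge operators, the outcome being forgotten. -/
noncomputable def gaugeDephasing : Λ.Op → Λ.Op := krausMap fun φ : Λ.CM => projG φ

variable {Λ}

namespace Decoder

variable (D : Λ.Decoder)

/-- The single-shot decoding channel for the measurement error distribution `p`, with the state
projected onto the subspaces of definite stabilizer syndrome. -/
noncomputable def channel (p : Λ.CM → ℝ) : Λ.Op → Λ.Op :=
  krausMap fun y : Λ.CM × Λ.CS =>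
    (Real.sqrt (p y.1) : ℂ) •
      (pauliX (D.recov (y.2 + deltaS (y.1 + D.est (deltaR y.1)))) * projS y.2)

/-- The single-shot decoding channel for the measurement error distribution `p`, with the state
projected onto the subspaces of definite flux `φ`: the observed outcome is `φ + μ`. -/
noncomputable def gaugeChannel (p : Λ.CM → ℝ) : Λ.Op → Λ.Op :=
  krausMap fun y : Λ.CM × Λ.CM =>
    (Real.sqrt (p y.1) : ℂ) •
      (pauliX (D.recov (deltaS (y.2 + y.1 + D.est (deltaR (y.2 + y.1))))) * projG y.2)

/-- The decoding channels with `η`-bounded measurement errors. -/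
def channels (η : ℝ) : Set (Λ.Op → Λ.Op) := {Φ | ∃ p, IsDist p ∧ IsBounded η p ∧ Φ = D.channel p}

/-- The decoding channels with `η`-bounded measurement errors, flux version. -/
def gaugeChannels (η : ℝ) : Set (Λ.Op → Λ.Op) :=
  {Φ | ∃ p, IsDist p ∧ IsBounded η p ∧ Φ = D.gaugeChannel p}

/-- The failure probability of the ideal decoder. -/
noncomputable def fail (p : Λ.CQ → ℝ) : ℝ :=
  ∑ x : Λ.CQ with ¬ InGauge (D.recov (bdS x) + x), p x

/-- The distribution of the recovery operators of the ideal decoder. -/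
noncomputable def bar (p : Λ.CQ → ℝ) : Λ.CQ → ℝ :=
  fun x' => ∑ x : Λ.CQ with D.recov (bdS x) = x', p x

/-- The class of Pauli `X` channels with failure probability at most `ε` that are equivalent, with
respect to the ideal decoder, to a `τ`-bounded Pauli `X` channel. -/
def noise (τ ε : ℝ) : Set (Λ.Op → Λ.Op) :=
  {Φ | ∃ p, IsDist p ∧ Φ = pauliChannel p ∧ D.fail p ≤ ε ∧
    ∃ q, IsDist q ∧ IsBounded τ q ∧ D.bar q = D.bar p}

end Decoder

/-! ### The constants -/

variable (Λ)

/-- The threshold `(2 (Δ_qub - 1))⁻²`. -/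
noncomputable def tauStar : ℝ := ((2 * ((Λ.maxDegQub : ℝ) - 1)) ^ 2)⁻¹

/-- The bound `f` on the failure probability of the ideal decoder. -/
noncomputable def failBound (L : ℕ) (τ : ℝ) : ℝ :=
  Λ.bdDegSum * Λ.tauStar / (Real.sqrt Λ.tauStar - Real.sqrt τ) * (τ / Λ.tauStar) ^ ((L : ℝ) / 2)

/-- The parameter `τ'` of the residual noise, where `t = 1 + 1 / c` and `r = 1 / (2 + 2 c)`. -/
noncomputable def tauRes (c η : ℝ) : ℝ :=
  let t := 1 + c⁻¹
  let r := (2 + 2 * c)⁻¹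
  2 ^ (2 * t - 1) * (Real.exp 1 * η ^ r) ^ t * ((Λ.maxDegL : ℝ) - 1) ^ (t - 1)

/-- The parameter `ε'` of the residual noise. -/
noncomputable def epsRes (L : ℕ) (c η τ ε : ℝ) : ℝ :=
  ε + Λ.failBound L τ + Λ.failBound L (τ + Λ.tauRes c η)

/-- The explicit smallness conditions on `η` and `τ`. -/
def SmallEnough (c η τ : ℝ) : Prop :=
  let r := (2 + 2 * c)⁻¹
  η < (Real.exp 1 - 1) ^ (1 / r) * (4 * Real.exp 1 ^ 2 * ((Λ.maxDegL : ℝ) - 1)) ^ (-(1 / r)) ∧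
    τ + Λ.tauRes c η < Λ.tauStar

end STCLattice

/-! Let `φ = μ + est (deltaR μ)` be a measurement error plus its estimate. It satisfies the Gauss
law, hence is the measured syndrome of some Pauli error (`exists_deltaM_of_gauss`). One round of
decoding is therefore ideal decoding of the incoming error with its syndrome shifted by `deltaS φ`.
On code states the channels reduce to classical distributions (`channel_comp`, `gaugeChannel_comp`),
and the syndrome after the round is that of the residual error `M = recov (deltaS φ)`, whatever the
incoming error was (`bdS_total`). So the new noise is equivalent to the law of `M`, and two
estimates remain.

Boundedness of `M`. If `M` contains a set `S`, let `U` be the union of those connected components of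
the supports of `φ` and `M` that meet `S`. The restrictions of `φ` and `M` to `U` still obey the
Gauss law and have equal stabilizer syndromes. Confinement and the minimality of `recov` give `|M_U|
≤ c |φ_U|`; the minimality of `est` puts at least half of `φ_U` into `μ`. Hence `U` has at least `t
|S|` elements, a fraction at least `r` of which are actual measurement errors (`exists_cluster`). A
union bound over such clusters, controlled by `sum_rootedAt_le`, yields `τ'`
(`isBounded_law_residual`).

Failure. A syndrome-free error outside the gauge group has odd degree at both boundary vertices of
the qubit graph; this is homology again (`inGauge_of_even`). So ideal decoding of a bounded error
fails only if errors fill half of a path of length at least `L`, and counting non-backtracking walks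
gives `f` (`fail_le_failBound`). The failure probability after the round is at most that of the
incoming noise, plus that of its bounded equivalent, plus that of the sum of this equivalent and `M`
(`fail_law_total_le`): these are the three terms of `ε'`.

Both homological facts come from the vanishing of `H₁` of the closed lattice and of the vertex
links; the latter follows from the Euler characteristic by counting ranks (`exists_of_link_cycle`).
-/

/-! ### Generating functions of rooted clusters in a graph of bounded degree -/

section ClusterSums

open Finset
open scoped Classical

/-- Every nonempty part of `U` has a neighbour in the rest of `S ∪ U`; equivalently, every
connected component of `S ∪ U` meets `S`. -/
def RootedAt {V : Type} (adj : V → V → Prop) (S U : Finset V) : Prop :=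
  ∀ W ⊆ U, W.Nonempty → ∃ w ∈ W, ∃ v, (v ∈ S ∨ v ∈ U) ∧ v ∉ W ∧ adj v w

/-- Once all neighbours of `s` in `U` are promoted to roots, `s` can no longer be the outer
neighbour of any part of what is left, so it may be discarded. -/
theorem RootedAt.explore {V : Type} [DecidableEq V] {adj : V → V → Prop} {S U N : Finset V} {s : V}
    (h : RootedAt adj S U) (hN : ∀ w ∈ U, adj s w → w ∈ N) :
    RootedAt adj (S.erase s ∪ (U ∩ N)) (U \ N) := by
  intro W hW hne
  obtain ⟨w, hw, v, hv, hvW, hadj⟩ := h W (hW.trans sdiff_subset) hne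
  refine ⟨w, hw, v, ?_, hvW, hadj⟩
  have hwU := hW hw
  rw [mem_sdiff] at hwU
  have hvs : v ≠ s := by
    rintro rfl
    exact hwU.2 (hN w hwU.1 hadj)
  simp only [mem_union, mem_erase, mem_inter, mem_sdiff] at hv ⊢
  tauto

/-- In a graph of maximal degree `z`, the generating function of the sets all of whose components
meet `S` is at most `e ^ |S|` up to the activity `1 / (e z)`. -/
theorem sum_rootedAt_le {V : Type} [DecidableEq V] (adj : V → V → Prop) {z y : ℝ} (hy : 0 ≤ y)
    (hyz : y * Real.exp 1 * z ≤ 1)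
    (hdeg : ∀ s : V, ∀ A : Finset V, s ∉ A → ((A.filter fun w => adj s w).card : ℝ) ≤ z)
    (S A : Finset V) (hSA : Disjoint S A) :
    ∑ U ∈ A.powerset with RootedAt adj S U, y ^ U.card ≤ Real.exp 1 ^ S.card := by
  induction h : A.card + S.card using Nat.strong_induction_on generalizing S A with
  | _ n ih =>
  subst h
  rcases S.eq_empty_or_nonempty with rfl | ⟨s, hs⟩
  · have : (A.powerset.filter fun U => RootedAt adj ∅ U) ⊆ {∅} := by
      intro U hU
      rw [mem_filter] at hU
      rw [mem_singleton]
      by_contra hne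
      obtain ⟨w, -, v, hv, hvU, -⟩ := hU.2 U Subset.rfl (nonempty_iff_ne_empty.mpr hne)
      simp at hv
      exact hvU hv
    calc _ ≤ ∑ U ∈ ({∅} : Finset (Finset V)), y ^ U.card :=
          sum_le_sum_of_subset_of_nonneg this fun _ _ _ => by positivity
      _ = _ := by simp
  -- The root `s` is explored, and the sum is split by the set `N'` of its neighbours that occur in
  -- `U`. The induction measure drops: `|A|` loses `|N|`, while `|S|` loses one and gains `|N'| ≤
  -- |N|`.
  · set N := A.filter fun w => adj s w with hNdef
    have hNA : N ⊆ A := filter_subset _ _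
    have hsA : s ∉ A := disjoint_left.mp hSA hs
    have hN : (N.card : ℝ) ≤ z := hdeg s A hsA
    have key : ∀ N' ∈ N.powerset,
        ∑ U ∈ (A.powerset.filter fun U => RootedAt adj S U) with U ∩ N = N', y ^ U.card
          ≤ (y * Real.exp 1) ^ N'.card * Real.exp 1 ^ (S.card - 1) := by
      intro N' hN'
      rw [mem_powerset] at hN'
      have hd1 : Disjoint (S.erase s) N' :=
        (hSA.mono_left (erase_subset _ _)).mono_right (hN'.trans hNA)
      have hcard : (S.erase s ∪ N').card = S.card - 1 + N'.card := by
        rw [card_union_of_disjoint hd1, card_erase_of_mem hs]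
      have hSpos : 0 < S.card := card_pos.mpr ⟨s, hs⟩
      have hIH := ih ((A \ N).card + (S.erase s ∪ N').card) (by
        rw [hcard, card_sdiff_of_subset hNA]
        have := card_le_card hN'
        have := card_le_card hNA
        omega) (S.erase s ∪ N') (A \ N) (by
          rw [disjoint_union_left]
          refine ⟨(hSA.mono_left (erase_subset _ _)).mono_right sdiff_subset, ?_⟩
          exact disjoint_sdiff.mono_left hN') rfl
      calc _ = ∑ U ∈ (A.powerset.filter fun U => RootedAt adj S U) with U ∩ N = N',
              y ^ N'.card * y ^ (U \ N).card := by
            refine sum_congr rfl fun U hU => ?_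
            rw [mem_filter] at hU
            rw [← hU.2, ← pow_add]
            congr 1
            rw [add_comm, card_sdiff_add_card_inter]
        _ ≤ ∑ U ∈ (A \ N).powerset with RootedAt adj (S.erase s ∪ N') U,
              y ^ N'.card * y ^ U.card := by
            rw [← sum_image (f := fun U : Finset V => y ^ N'.card * y ^ U.card)
              (g := fun U => U \ N)]
            · refine sum_le_sum_of_subset_of_nonneg ?_ fun _ _ _ => by positivity
              intro U' hU'
              rw [mem_image] at hU'
              obtain ⟨U, hU, rfl⟩ := hU'
              simp only [mem_filter, mem_powerset] at hU ⊢
              refine ⟨sdiff_subset_sdiff hU.1.1 Subset.rfl, ?_⟩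
              rw [← hU.2]
              refine hU.1.2.explore fun w hw hsw => ?_
              rw [hNdef, mem_filter]
              exact ⟨hU.1.1 hw, hsw⟩
            · intro U hU U' hU' hEq
              simp only [coe_filter, Set.mem_ofPred_eq] at hU hU'
              have := congrArg (fun X => X ∪ N') hEq
              simp only at this
              rw [← sdiff_union_inter U N, ← sdiff_union_inter U' N, hU.2, hU'.2]
              exact this
        _ = y ^ N'.card * ∑ U ∈ (A \ N).powerset with RootedAt adj (S.erase s ∪ N') U,
              y ^ U.card := by rw [mul_sum]
        _ ≤ y ^ N'.card * Real.exp 1 ^ (S.erase s ∪ N').card := by gcongr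
        _ = _ := by rw [hcard, mul_pow, pow_add]; ring
    calc _ = ∑ N' ∈ N.powerset,
          ∑ U ∈ (A.powerset.filter fun U => RootedAt adj S U) with U ∩ N = N', y ^ U.card := by
          rw [sum_fiberwise_of_maps_to]
          intro U _
          rw [mem_powerset]
          exact inter_subset_right
      _ ≤ ∑ N' ∈ N.powerset, (y * Real.exp 1) ^ N'.card * Real.exp 1 ^ (S.card - 1) :=
          sum_le_sum key
      _ = (1 + y * Real.exp 1) ^ N.card * Real.exp 1 ^ (S.card - 1) := by
          rw [← sum_mul]
          congr 1
          rw [add_comm, add_pow]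
          rw [sum_powerset_apply_card (fun m => (y * Real.exp 1) ^ m)]
          refine sum_congr rfl fun m _ => ?_
          simp [mul_comm]
      -- Since `1 + u ≤ exp u` and `|N| y e ≤ 1`, exploring `s` costs at most the factor `e`
      -- allotted to this root.
      _ ≤ Real.exp 1 * Real.exp 1 ^ (S.card - 1) := by
          gcongr
          calc (1 + y * Real.exp 1) ^ N.card ≤ (Real.exp (y * Real.exp 1)) ^ N.card := by
                gcongr
                rw [add_comm]
                exact Real.add_one_le_exp _
            _ = Real.exp (N.card * (y * Real.exp 1)) := by rw [← Real.exp_nat_mul]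
            _ ≤ Real.exp 1 := by
                apply Real.exp_le_exp.mpr
                calc (N.card : ℝ) * (y * Real.exp 1) ≤ z * (y * Real.exp 1) := by gcongr
                  _ ≤ 1 := by linarith
      _ = Real.exp 1 ^ S.card := by
          rw [← pow_succ']
          congr 1
          have : 0 < S.card := card_pos.mpr ⟨s, hs⟩
          omega

/-- Inside a finite set `X`, the union of the components that meet `S`. -/
theorem exists_rootedAt {V : Type} [DecidableEq V] (adj : V → V → Prop) (X S : Finset V) (hS : S ⊆ X) :
    ∃ U ⊆ X, S ⊆ U ∧ RootedAt adj S (U \ S) ∧ ∀ u ∈ U, ∀ w ∈ X, w ∉ U → ¬ adj u w := by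
  -- `P W` says that no edge leads into `W` from the rest of `X`. The complement of a largest such
  -- `W` avoiding `S` is the required set: a part of it violating rootedness could be added to `W`.
  let P : Finset V → Prop := fun W => ∀ u ∈ X, u ∉ W → ∀ w ∈ W, ¬ adj u w
  obtain ⟨W, hW, hmax⟩ := exists_max_image ((X \ S).powerset.filter P) card
    ⟨∅, by simp [P]⟩
  simp only [mem_filter, mem_powerset] at hW hmax
  refine ⟨X \ W, sdiff_subset, ?_, ?_, ?_⟩
  · intro s hs
    rw [mem_sdiff]
    exact ⟨hS hs, fun h => (mem_sdiff.mp (hW.1 h)).2 hs⟩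
  · intro W' hW' hne
    by_contra hcon
    push Not at hcon
    have hdisj : Disjoint W W' := by
      rw [disjoint_left]
      intro a ha ha'
      have := hW' ha'
      simp only [mem_sdiff] at this
      exact this.1.2 ha
    have := hmax (W ∪ W') ⟨?_, ?_⟩
    · rw [card_union_of_disjoint hdisj] at this
      have := card_pos.mpr hne
      omega
    · refine union_subset hW.1 fun a ha => ?_
      have := hW' ha
      simp only [mem_sdiff] at this ⊢
      exact ⟨this.1.1, this.2⟩
    · intro u hu huW w hw
      simp only [mem_union, not_or] at huW hw
      rcases hw with hw | hw
      · exact hW.2 u hu huW.1 w hw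
      · refine hcon w hw u ?_ huW.2
        simp only [mem_sdiff]
        tauto
  · intro u hu w hw hwU
    simp only [mem_sdiff, not_and, not_not] at hu hwU
    exact hW.2 u hu.1 hu.2 w (hwU hw)

end ClusterSums

/-! ### Bounded distributions, union bounds and laws of random variables -/

section Distributions

open Finset
open scoped Classical

/-- The set `y` contains `S`. -/
def Covers {A : Type} (S : Finset A) (y : A → ZMod 2) : Prop := ∀ a ∈ S, y a ≠ 0

/-- Finite sets are more convenient than vectors for union bounds. The `Fintype` instance on vectors
is left free, so that the statement applies whichever one elaboration finds. -/
theorem isBounded_iff {A : Type} [Fintype A] [Fintype (A → ZMod 2)] {τ : ℝ}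
    {p : (A → ZMod 2) → ℝ} :
    IsBounded τ p ↔
      ∀ S : Finset A, ∑ y : A → ZMod 2 with Covers S y, p y ≤ τ ^ S.card := by
  have key : ∀ (x : A → ZMod 2) (S : Finset A), (∀ a, a ∈ S ↔ x a ≠ 0) →
      (weight x = S.card ∧ ∑ y : A → ZMod 2 with Covers S y, p y
        = ∑ y ∈ @Finset.univ _ Pi.instFintype with ∀ a, x a ≠ 0 → y a ≠ 0, p y) := by
    intro x S h
    constructor
    · unfold weight hammingNorm
      congr 1
      ext a
      simp [h]
    · refine sum_congr ?_ fun _ _ => rfl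
      ext y
      simp [h, Covers]
  constructor
  · intro h S
    obtain ⟨h1, h2⟩ := key (fun a => if a ∈ S then 1 else 0) S (by simp)
    rw [h2, ← h1]
    exact h _
  · intro h x
    obtain ⟨h1, h2⟩ := key x (univ.filter fun a => x a ≠ 0) (by simp)
    rw [h1]
    exact h2 ▸ h _

/-- The union bound. -/
theorem sum_filter_le_sum_sum {X I : Type} [Fintype X] {p : X → ℝ} (hp : ∀ x, 0 ≤ p x)
    (J : Finset I) {E : X → Prop}
    [DecidablePred E] {F : I → X → Prop} [∀ i, DecidablePred (F i)] (h : ∀ x, E x → ∃ i ∈ J, F i x) :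
    ∑ x with E x, p x ≤ ∑ i ∈ J, ∑ x with F i x, p x := by
  calc ∑ x with E x, p x ≤ ∑ x with E x, ∑ i ∈ J, if F i x then p x else 0 := by
        refine sum_le_sum fun x hx => ?_
        obtain ⟨i, hi, hF⟩ := h x (mem_filter.mp hx).2
        calc p x = if F i x then p x else 0 := by rw [if_pos hF]
          _ ≤ _ := single_le_sum (f := fun i => if F i x then p x else 0)
            (fun j _ => by split_ifs <;> simp [hp x]) hi
    _ ≤ ∑ x, ∑ i ∈ J, if F i x then p x else 0 := by
        refine sum_le_sum_of_subset_of_nonneg (filter_subset _ _) fun x _ _ =>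
          sum_nonneg fun i _ => ?_
        split_ifs <;> simp [hp x]
    _ = _ := by
        rw [sum_comm]
        simp only [sum_filter]

theorem IsBounded.sum_filter_le {A I : Type} [Fintype A] [Fintype (A → ZMod 2)] {τ : ℝ}
    {p : (A → ZMod 2) → ℝ} (hp : IsDist p) (h : IsBounded τ p) {E : (A → ZMod 2) → Prop}
    [DecidablePred E] (J : Finset I) (F : I → Finset A)
    (hE : ∀ y, E y → ∃ i ∈ J, ∀ a ∈ F i, y a ≠ 0) :
    ∑ y with E y, p y ≤ ∑ i ∈ J, τ ^ (F i).card :=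
  (sum_filter_le_sum_sum hp.1 J (F := fun i y => Covers (F i) y) hE).trans
    (sum_le_sum fun i _ => isBounded_iff.mp h (F i))

/-- The distribution of `f` under `p`. -/
noncomputable def law {X Y : Type} [Fintype X] (p : X → ℝ) (f : X → Y) : Y → ℝ :=
  fun y => ∑ x with f x = y, p x

theorem sum_law {X Y : Type} [Fintype X] [Fintype Y] (p : X → ℝ) (f : X → Y) (E : Y → Prop)
    [DecidablePred E] [DecidablePred fun x => E (f x)] :
    ∑ y with E y, law p f y = ∑ x with E (f x), p x := by
  unfold law
  rw [← sum_fiberwise_of_maps_to (s := univ.filter fun x => E (f x)) (t := univ.filter E) (g := f)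
    (by intro x; simp)]
  refine sum_congr rfl fun y hy => sum_congr ?_ fun _ _ => rfl
  ext x
  simp only [mem_filter, mem_univ, true_and] at hy ⊢
  constructor
  · rintro rfl; exact ⟨hy, rfl⟩
  · exact fun h => h.2

theorem sum_law_mul {X Y : Type} {R : Type} [AddCommMonoid R] [Module ℝ R] [Fintype X] [Fintype Y]
    (p : X → ℝ) (f : X → Y) (g : Y → R) :
    ∑ y, law p f y • g y = ∑ x, p x • g (f x) := by
  unfold law
  rw [← sum_fiberwise_of_maps_to (s := univ) (t := univ) (g := f) (by simp)]
  refine sum_congr rfl fun y _ => ?_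
  rw [sum_smul]
  refine sum_congr rfl fun x hx => ?_
  rw [(mem_filter.mp hx).2]

theorem IsDist.law {X Y : Type} [Fintype X] [Fintype Y] {p : X → ℝ} (h : IsDist p) (f : X → Y) :
    IsDist (law p f) := by
  refine ⟨fun y => sum_nonneg fun x _ => h.1 x, ?_⟩
  have := sum_law p f fun _ => True
  simp only [filter_true] at this
  rw [this, h.2]

theorem law_law {X Y Z : Type} [Fintype X] [Fintype Y] (p : X → ℝ) (f : X → Y) (g : Y → Z) :
    law (law p f) g = law p (g ∘ f) := by
  ext z
  exact sum_law p f fun y => g y = z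

theorem IsDist.prod {X Y : Type} [Fintype X] [Fintype Y] {p : X → ℝ} {q : Y → ℝ}
    (hp : IsDist p) (hq : IsDist q) : IsDist fun x : X × Y => p x.1 * q x.2 := by
  refine ⟨fun x => mul_nonneg (hp.1 _) (hq.1 _), ?_⟩
  rw [Fintype.sum_prod_type]
  simp only [← mul_sum, hq.2, mul_one, hp.2]

/-- The marginal of a product distribution. -/
theorem IsDist.sum_prod_fst {X Y : Type} [Fintype X] [Fintype Y] (p : X → ℝ) {q : Y → ℝ}
    (hq : IsDist q) (E : X → Prop) [DecidablePred E] :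
    ∑ x : X × Y with E x.1, p x.1 * q x.2 = ∑ x with E x, p x := by
  simp only [sum_filter, Fintype.sum_prod_type]
  refine sum_congr rfl fun x _ => ?_
  split_ifs
  · rw [← mul_sum, hq.2, mul_one]
  · simp

theorem IsDist.sum_prod_snd {X Y : Type} [Fintype X] [Fintype Y] {p : X → ℝ} (q : Y → ℝ)
    (hp : IsDist p) (E : Y → Prop) [DecidablePred E] :
    ∑ x : X × Y with E x.2, p x.1 * q x.2 = ∑ y with E y, q y := by
  simp only [sum_filter, Fintype.sum_prod_type]
  rw [sum_comm]
  refine sum_congr rfl fun x _ => ?_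
  split_ifs
  · rw [← sum_mul, hp.2, one_mul]
  · simp

/-- The sum of independent bounded errors is bounded. -/
theorem IsBounded.add {A : Type} [Fintype A] [Fintype (A → ZMod 2)] {τ τ' : ℝ}
    {p q : (A → ZMod 2) → ℝ} (hp : IsDist p) (hq : IsDist q) (h : IsBounded τ p)
    (h' : IsBounded τ' q) (hτ : 0 ≤ τ) :
    IsBounded (τ + τ')
      (law (fun x : (A → ZMod 2) × (A → ZMod 2) => p x.1 * q x.2) fun x => x.1 + x.2) := by
  rw [isBounded_iff] at h h' ⊢
  intro S
  rw [sum_law]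
  calc _ ≤ ∑ T ∈ S.powerset, ∑ y : (A → ZMod 2) × (A → ZMod 2) with
          (Covers T y.1 ∧ Covers (S \ T) y.2), p y.1 * q y.2 := by
        refine sum_filter_le_sum_sum (fun y => mul_nonneg (hp.1 _) (hq.1 _)) _ fun y hy => ?_
        -- `T` is the part of `S` covered by the first error; on the rest of `S` that error
        -- vanishes, so the second one cannot.
        refine ⟨S.filter fun a => y.1 a ≠ 0, by simp, by simp [Covers], fun a ha => ?_⟩
        simp only [mem_sdiff, mem_filter, not_and, not_not] at ha
        have := hy a ha.1
        rw [Pi.add_apply, ha.2 ha.1, zero_add] at this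
        exact this
    _ ≤ ∑ T ∈ S.powerset, τ ^ T.card * τ' ^ (S.card - T.card) := by
        refine sum_le_sum fun T hT => ?_
        rw [mem_powerset] at hT
        calc _ = (∑ y : A → ZMod 2 with Covers T y, p y) *
              ∑ y : A → ZMod 2 with Covers (S \ T) y, q y := by
              rw [sum_mul_sum, ← sum_product']
              refine sum_congr ?_ fun _ _ => rfl
              ext y
              simp
          _ ≤ _ := by
              rw [← card_sdiff_of_subset hT]
              exact mul_le_mul (h T) (h' (S \ T))
                (sum_nonneg fun y _ => hq.1 y) (by positivity)
    _ = (τ + τ') ^ S.card := by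
        rw [add_pow, sum_powerset_apply_card (fun m => τ ^ m * τ' ^ (S.card - m))]
        refine sum_congr rfl fun m _ => ?_
        rw [nsmul_eq_mul]; ring

end Distributions

/-! ### Cells, incidence and double counting in coloured triangulations -/

namespace ColoredTriangulation

open Finset
open scoped Classical

variable {K : ColoredTriangulation} {C C' C'' : Finset Color}

/-- A function of the tetrahedra that is invariant under the crossing of all triangles that contain
the cell with colours `C` depends on this cell only. -/
theorem eq_of_cell_eq {α : Sort*} {f : K.T → α} (hf : ∀ d, d ∉ C → ∀ t, f (K.s d t) = f t)
    {t t' : K.T} (h : K.cell C t = K.cell C t') : f t = f t' := by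
  have h' : Relation.EqvGen (fun t t' => ∃ d, d ∉ C ∧ t' = K.s d t) t t' := Quotient.exact h
  clear h
  induction h' with
  | rel x y h =>
    obtain ⟨d, hd, rfl⟩ := h
    exact (hf d hd x).symm
  | refl => rfl
  | symm _ _ _ ih => exact ih.symm
  | trans _ _ _ _ _ ih ih' => exact ih.trans ih'

theorem cell_s {d : Color} (hd : d ∉ C) (t : K.T) : K.cell C (K.s d t) = K.cell C t :=
  Quotient.sound (Relation.EqvGen.symm _ _ (Relation.EqvGen.rel _ _ ⟨d, hd, rfl⟩))

theorem cell_mono (h : C ⊆ C') {t t' : K.T} (ht : K.cell C' t = K.cell C' t') :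
    K.cell C t = K.cell C t' :=
  eq_of_cell_eq (fun _ hd t => cell_s (fun hC => hd (h hC)) t) ht

theorem cell_surjective (a : K.Cell C) : ∃ t, K.cell C t = a := Quotient.exists_rep a

theorem inc_comm {a : K.Cell C} {b : K.Cell C'} : Inc a b ↔ Inc b a :=
  exists_congr fun _ => and_comm

theorem inc_cell_self (t : K.T) : Inc (K.cell C t) (K.cell C' t) := ⟨t, rfl, rfl⟩

/-- The faces of a cell. -/
theorem inc_cell_iff (h : C ⊆ C') {a : K.Cell C} {t : K.T} :
    Inc a (K.cell C' t) ↔ K.cell C t = a := by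
  constructor
  · rintro ⟨t', rfl, ht'⟩
    exact (cell_mono h ht').symm
  · rintro rfl
    exact inc_cell_self t

/-- A triangle belongs to exactly two tetrahedra. -/
theorem cell_compl_eq_iff {d : Color} {t t' : K.T} :
    K.cell {d}ᶜ t' = K.cell {d}ᶜ t ↔ t' = t ∨ t' = K.s d t := by
  constructor
  · intro h
    -- Only crossings of colour `d` preserve the triangle, and they merely swap the two elements of
    -- this pair, which is therefore a function of the triangle.
    have := eq_of_cell_eq (f := fun t => ({t, K.s d t} : Finset K.T)) (fun e he t => by
      have : e = d := by simpa using he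
      subst this
      rw [K.s_invol, pair_comm]) h
    have h' : t' ∈ ({t', K.s d t'} : Finset K.T) := by simp
    rw [this] at h'
    simpa using h'
  · rintro (rfl | rfl)
    · rfl
    · exact cell_s (by simp) t

theorem sum_triangle (T : K.T → ZMod 2) (d : Color) (t : K.T) :
    ∑ t' with K.cell {d}ᶜ t' = K.cell {d}ᶜ t, T t' = T t + T (K.s d t) := by
  rw [← sum_pair (K.s_ne d t).symm]
  refine sum_congr ?_ fun _ _ => rfl
  ext t'
  simp [cell_compl_eq_iff]

/-- Each tetrahedron has exactly one cell with colours `C'`, and that cell contains `a` iff the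
tetrahedron does. -/
theorem sum_inc_sum_tetrahedra (h : C ⊆ C') (a : K.Cell C) (T : K.T → ZMod 2) :
    ∑ b : K.Cell C' with Inc a b, ∑ t with K.cell C' t = b, T t
      = ∑ t with K.cell C t = a, T t := by
  rw [← sum_fiberwise_of_maps_to (s := univ.filter fun t => K.cell C t = a)
    (t := univ.filter fun b : K.Cell C' => Inc a b) (g := K.cell C')]
  · refine sum_congr rfl fun b hb => sum_congr ?_ fun _ _ => rfl
    ext t
    simp only [mem_filter, mem_univ, true_and] at hb ⊢
    constructor
    · rintro rfl
      exact ⟨(inc_cell_iff h).mp hb, rfl⟩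
    · exact fun h => h.2
  · intro t ht
    simp only [mem_filter, mem_univ, true_and] at ht ⊢
    rw [← ht]
    exact inc_cell_self t

/-- Colours make faces unique: a cell `c` at `a` is reached through its single face with colours
`C'`, hence is counted once. -/
theorem sum_inc_inc (h : C ⊆ C') (h' : C' ⊆ C'') (a : K.Cell C) (g : K.Cell C'' → ZMod 2) :
    ∑ b : K.Cell C' with Inc a b, ∑ c : K.Cell C'' with Inc b c, g c
      = ∑ c : K.Cell C'' with Inc a c, g c := by
  simp only [sum_filter]
  simp only [← sum_filter (fun b : K.Cell C' => Inc a b)]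
  rw [sum_comm]
  refine sum_congr rfl fun c _ => ?_
  obtain ⟨t, rfl⟩ := cell_surjective c
  rw [sum_ite, sum_const_zero, add_zero]
  simp only [inc_cell_iff h', inc_cell_iff (h.trans h')]
  by_cases ha : K.cell C t = a
  · rw [if_pos ha]
    rw [show ((univ.filter fun b : K.Cell C' => Inc a b).filter fun b => K.cell C' t = b)
      = {K.cell C' t} from ?_, sum_singleton]
    ext b
    simp only [mem_filter, mem_univ, true_and, mem_singleton]
    constructor
    · exact fun h => h.2.symm
    · rintro rfl
      exact ⟨ha ▸ inc_cell_self t, rfl⟩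
  · rw [if_neg ha]
    apply sum_eq_zero
    intro b hb
    simp only [mem_filter, mem_univ, true_and] at hb
    obtain ⟨hb, rfl⟩ := hb
    exact absurd ((inc_cell_iff h).mp hb) ha

/-- Summation over the cells of a lattice by their unique faces of colours `C`. -/
theorem sum_sum_inc (h : C ⊆ C') (g : K.Cell C' → ZMod 2) :
    ∑ a : K.Cell C, ∑ b : K.Cell C' with Inc a b, g b = ∑ b, g b := by
  simp only [sum_filter]
  rw [sum_comm]
  refine sum_congr rfl fun b _ => ?_
  obtain ⟨t, rfl⟩ := cell_surjective b
  simp [inc_cell_iff h]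

end ColoredTriangulation

theorem zmod2_add_self (a : ZMod 2) : a + a = 0 := CharTwo.add_self_eq_zero a

theorem zmod2_eq_of_add_eq_zero {a b : ZMod 2} (h : a + b = 0) : a = b :=
  CharTwo.add_eq_zero.mp h

theorem zmod2_cases (a : ZMod 2) : a = 0 ∨ a = 1 := by
  revert a; decide

open scoped Classical in
theorem sum_subtype_filter {α : Type} [Fintype α] {P Q : α → Prop} [Fintype {a // P a}]
    (h : ∀ a, Q a → P a)
    {M : Type} [AddCommMonoid M] (f : {a // P a} → M) (g : α → M) (hfg : ∀ a, f a = g a.1) :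
    ∑ a : {a // P a} with Q a.1, f a = ∑ a with Q a, g a := by
  refine Finset.sum_bij (fun a _ => a.1) ?_ ?_ ?_ ?_
  · intro a ha; simpa using ha
  · intro a _ b _ hab; exact Subtype.ext hab
  · intro b hb
    simp only [Finset.mem_filter, Finset.mem_univ, true_and] at hb
    exact ⟨⟨b, h b hb⟩, by simpa using hb, rfl⟩
  · intro a _; exact hfg a

/-! ### Octahedra and their faces -/

namespace STCLattice

open Finset
open scoped Classical
open ColoredTriangulation Color

variable {Λ : STCLattice} {C C' : Finset Color}

/-- The colours `R` and `B`, in some order. -/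
def IsRB (a a' : Color) : Prop := a = R ∧ a' = B ∨ a = B ∧ a' = R

theorem isRB_R : IsRB R B := Or.inl ⟨rfl, rfl⟩
theorem isRB_B : IsRB B R := Or.inr ⟨rfl, rfl⟩

theorem IsRB.compl {a a' : Color} (h : IsRB a a') : ({a'}ᶜ : Finset Color) = {a, G, Y} := by
  rcases h with ⟨rfl, rfl⟩ | ⟨rfl, rfl⟩ <;> decide

theorem IsRB.notMem {a a' : Color} (h : IsRB a a') : a ∉ ({G, Y} : Finset Color) := by
  rcases h with ⟨rfl, rfl⟩ | ⟨rfl, rfl⟩ <;> decide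

theorem IsRB.symm {a a' : Color} (h : IsRB a a') : IsRB a' a := by
  rcases h with ⟨rfl, rfl⟩ | ⟨rfl, rfl⟩
  exacts [isRB_B, isRB_R]

theorem IsRB.comm {a a' : Color} (h : IsRB a a') (t : Λ.T) :
    Λ.s a (Λ.s a' t) = Λ.s a' (Λ.s a t) := by
  rcases h with ⟨rfl, rfl⟩ | ⟨rfl, rfl⟩
  exacts [Λ.s_comm t, (Λ.s_comm t).symm]

theorem IsRB.cell_ne {a a' : Color} (h : IsRB a a') (hC : a ∈ C) (t : Λ.T) :
    Λ.cell C (Λ.s a t) ≠ Λ.cell C t := by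
  intro hEq
  have := cell_mono (C := {a}) (by simpa using hC) hEq
  rcases h with ⟨rfl, rfl⟩ | ⟨rfl, rfl⟩
  exacts [Λ.R_ne t this, Λ.B_ne t this]

/-- The tetrahedra of an octahedron. -/
theorem cell_GY_eq_iff {a a' : Color} (h : IsRB a a') {t t' : Λ.T} :
    Λ.cell {G, Y} t' = Λ.cell {G, Y} t ↔
      t' = t ∨ t' = Λ.s a' t ∨ t' = Λ.s a t ∨ t' = Λ.s a' (Λ.s a t) := by
  constructor
  · intro hEq
    have := eq_of_cell_eq (f := fun t => ({t, Λ.s a' t, Λ.s a t, Λ.s a' (Λ.s a t)} : Finset Λ.T))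
      (fun e he t => by
        have : e = a ∨ e = a' := by
          rcases h with ⟨rfl, rfl⟩ | ⟨rfl, rfl⟩ <;> revert e <;> decide
        ext u
        rcases this with rfl | rfl
        · simp only [Λ.s_invol, mem_insert, mem_singleton]; tauto
        · simp only [h.comm, Λ.s_invol, mem_insert, mem_singleton]; tauto) hEq
    have h' : t' ∈ ({t', Λ.s a' t', Λ.s a t', Λ.s a' (Λ.s a t')} : Finset Λ.T) := by simp
    rw [this] at h'
    simpa using h'
  · have ha := h.notMem
    have ha' := h.symm.notMem
    rintro (rfl | rfl | rfl | rfl) <;> simp only [cell_s ha, cell_s ha']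

/-- An octahedron contains two faces with colours `C`, for `C` inside `{a, G, Y}` and
containing `a`. -/
theorem inc_octahedron_iff {a a' : Color} (h : IsRB a a') (hC : C ⊆ {a'}ᶜ) {t : Λ.T}
    {e : Λ.Cell C} :
    Inc e (Λ.cell {G, Y} t) ↔ e = Λ.cell C t ∨ e = Λ.cell C (Λ.s a t) := by
  have ha' : a' ∉ C := fun h => by simpa using hC h
  constructor
  · rintro ⟨t', rfl, ht'⟩
    rcases (cell_GY_eq_iff h).mp ht' with rfl | rfl | rfl | rfl <;> simp [cell_s ha']
  · rintro (rfl | rfl)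
    · exact inc_cell_self t
    · exact ⟨_, rfl, cell_s h.notMem t⟩

/-- The two faces are distinct because they contain opposite `a` vertices, which are distinct by
assumption on the lattice. -/
theorem sum_inc_octahedron {a a' : Color} (h : IsRB a a') (hC : C ⊆ {a'}ᶜ) (ha : a ∈ C)
    (f : Λ.Cell C → ZMod 2) (t : Λ.T) :
    ∑ e : Λ.Cell C with Inc e (Λ.cell {G, Y} t), f e
      = f (Λ.cell C t) + f (Λ.cell C (Λ.s a t)) := by
  rw [← sum_pair (h.cell_ne ha t).symm]
  refine sum_congr ?_ fun _ _ => rfl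
  ext e
  simp [inc_octahedron_iff h hC]

/-- The octahedron that contains a triangle of colours `{a, G, Y}`. -/
noncomputable def octahedronOf {a' : Color} (f : Λ.Cell {a'}ᶜ) : Λ.Cell {G, Y} :=
  Λ.cell {G, Y} (Quotient.out f)

theorem octahedronOf_cell {a a' : Color} (h : IsRB a a') (t : Λ.T) :
    octahedronOf (Λ.cell {a'}ᶜ t) = Λ.cell {G, Y} t := by
  refine cell_mono (C' := {a'}ᶜ) ?_ (Quotient.out_eq (Λ.cell {a'}ᶜ t))
  rw [h.compl]
  exact subset_insert _ _

/-- The octahedra at a cell with colours `C` correspond to its triangles of colours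
`{a, G, Y}`, for `C` inside `{a, G, Y}` and containing `a`. -/
theorem sum_octahedra {a a' : Color} (h : IsRB a a') (hC : C ⊆ {a'}ᶜ) (ha : a ∈ C)
    (e : Λ.Cell C) (x : Λ.Cell {G, Y} → ZMod 2) :
    ∑ q : Λ.Cell {G, Y} with Inc e q, x q
      = ∑ f : Λ.Cell {a'}ᶜ with Inc e f, x (octahedronOf f) := by
  symm
  refine sum_bij (fun f _ => octahedronOf f) ?_ ?_ ?_ ?_
  · intro f hf
    simp only [mem_filter, mem_univ, true_and] at hf ⊢
    obtain ⟨t, rfl⟩ := cell_surjective f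
    rw [octahedronOf_cell h]
    rw [inc_cell_iff hC] at hf
    exact hf ▸ inc_cell_self t
  · intro f hf f' hf' hEq
    obtain ⟨t, rfl⟩ := cell_surjective f
    obtain ⟨t', rfl⟩ := cell_surjective f'
    simp only [mem_filter, mem_univ, true_and, inc_cell_iff hC] at hf hf'
    rw [octahedronOf_cell h, octahedronOf_cell h] at hEq
    subst hf'
    have ha' : a' ∉ ({a'}ᶜ : Finset Color) := by simp
    have ha'C : a' ∉ C := fun h => by simpa using hC h
    -- Of the four tetrahedra of the octahedron, two lie at the same triangle; the other two have
    -- the opposite `a` vertex and so are not at `e`.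
    rcases (cell_GY_eq_iff h).mp hEq with rfl | rfl | rfl | rfl
    · rfl
    · exact cell_s ha' _
    · exact absurd hf (h.cell_ne ha _)
    · rw [cell_s ha'C] at hf
      exact absurd hf (h.cell_ne ha _)
  · intro q hq
    simp only [mem_filter, mem_univ, true_and] at hq
    obtain ⟨t, rfl, rfl⟩ := hq
    exact ⟨Λ.cell {a'}ᶜ t, by simpa using inc_cell_self t, octahedronOf_cell h t⟩
  · intro f _
    rfl

/-- Summation over the octahedra at `e` by their faces at `e`. -/
theorem sum_inc_sum_octahedra {a a' : Color} (h : IsRB a a') (hCC : C ⊆ C') (hC' : C' ⊆ {a'}ᶜ)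
    (ha : a ∈ C) (e : Λ.Cell C) (x : Λ.Cell {G, Y} → ZMod 2) :
    ∑ e' : Λ.Cell C' with Inc e e', ∑ q : Λ.Cell {G, Y} with Inc e' q, x q
      = ∑ q : Λ.Cell {G, Y} with Inc e q, x q := by
  simp only [sum_octahedra h hC' (hCC ha)]
  rw [sum_octahedra h (hCC.trans hC') ha, sum_inc_inc hCC hC']

/-- Around a cell with colours in `{G, Y}` every octahedron has two faces of each type. -/
theorem sum_inc_sum_octahedra_eq_zero {a a' : Color} (h : IsRB a a') (hCC : C ⊆ C')
    (hC : C ⊆ {G, Y}) (hC' : C' ⊆ {a'}ᶜ) (ha : a ∈ C') (e : Λ.Cell C)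
    (x : Λ.Cell {G, Y} → ZMod 2) :
    ∑ e' : Λ.Cell C' with Inc e e', ∑ q : Λ.Cell {G, Y} with Inc e' q, x q = 0 := by
  have hGY : ({G, Y} : Finset Color) ⊆ {a'}ᶜ := by rw [h.compl]; exact subset_insert _ _
  simp only [sum_octahedra h hC' ha]
  -- The triangles at `e` are regrouped by their octahedra; each octahedron contributes its value
  -- twice.
  rw [sum_inc_inc hCC hC', ← sum_inc_inc hC hGY]
  refine sum_eq_zero fun q _ => ?_
  obtain ⟨t, rfl⟩ := cell_surjective q
  simp only [inc_comm (a := Λ.cell {G, Y} t)]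
  rw [sum_inc_octahedron h Subset.rfl (hC' ha) (fun f => x (octahedronOf f)),
    octahedronOf_cell h, octahedronOf_cell h, cell_s h.notMem, zmod2_add_self]

end STCLattice

/-! ### Vanishing homology of the vertex links -/

namespace ColoredTriangulation

open Finset
open scoped Classical

variable {K : ColoredTriangulation}

theorem filter_card_two (c : Color) :
    (univ.filter fun C : Finset Color => C.card = 2 ∧ c ∈ C)
      = (univ.filter fun e => e ≠ c).image fun e => {c, e} := by
  cases c <;> decide

theorem filter_card_three (c : Color) :
    (univ.filter fun C : Finset Color => C.card = 3 ∧ c ∈ C)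
      = (univ.filter fun e => e ≠ c).image fun e => {e}ᶜ := by
  cases c <;> decide

theorem pair_injOn (c : Color) :
    Set.InjOn (fun e : Color => ({c, e} : Finset Color))
      (univ.filter fun e : Color => e ≠ c : Finset Color) := by
  intro e he e' he' h
  revert e e' c; decide

theorem compl_injOn (s : Set Color) : Set.InjOn (fun e : Color => ({e}ᶜ : Finset Color)) s := by
  intro e _ e' _ h
  simpa using h

variable (K)

/-- The edges at the vertices of colour `c`, which are the vertices of their links. -/
abbrev LinkVertex (c : Color) : Type := Σ e : {e : Color // e ≠ c}, K.Cell {c, e.1}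

/-- The triangles at the vertices of colour `c`, which are the edges of their links. -/
abbrev LinkEdge (c : Color) : Type := Σ d : {d : Color // d ≠ c}, K.Cell {d.1}ᶜ

variable {K}

/-- Every cell with colours `C` has exactly one vertex of colour `c`. -/
theorem card_cells_at {c : Color} {C : Finset Color} (h : c ∈ C) :
    ∑ v : K.Cell {c}, Nat.card {e : K.Cell C // Inc v e} = Fintype.card (K.Cell C) := by
  have : ∀ v : K.Cell {c}, Nat.card {e : K.Cell C // Inc v e} =
      ∑ e : K.Cell C, if Inc v e then 1 else 0 := by
    intro v
    rw [Nat.card_eq_fintype_card, Fintype.card_subtype, card_filter]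
  simp only [this]
  rw [sum_comm]
  have h1 : ∀ e : K.Cell C, (∑ v : K.Cell {c}, if Inc v e then 1 else 0) = 1 := by
    intro e
    obtain ⟨t, rfl⟩ := cell_surjective e
    have h2 : ({c} : Finset Color) ⊆ C := by simpa using h
    simp [inc_cell_iff h2]
  simp [h1]

/-- The sum over the links of the Euler formula. -/
theorem euler_links {c : Color} (h : ∀ v : K.Cell {c}, K.LinkIsSphere v) :
    Fintype.card (K.LinkVertex c) + Fintype.card K.T
      = Fintype.card (K.LinkEdge c) + 2 * Fintype.card (K.Cell {c}) := by
  have h1 := sum_congr rfl fun (v : K.Cell {c}) (_ : v ∈ univ) => h v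
  simp only [filter_card_two, filter_card_three] at h1
  simp only [sum_image (pair_injOn c), sum_image (compl_injOn _)] at h1
  simp only [sum_add_distrib, sum_const, card_univ, smul_eq_mul] at h1
  rw [sum_comm (s := univ (α := K.Cell {c})), sum_comm (s := univ (α := K.Cell {c}))] at h1
  have h2 : ∀ e ∈ univ.filter (fun e : Color => e ≠ c),
      ∑ v : K.Cell {c}, Nat.card {f : K.Cell {e}ᶜ // Inc v f} = Fintype.card (K.Cell {e}ᶜ) := by
    intro e he
    refine card_cells_at ?_
    simpa using (mem_filter.mp he).2.symm
  have h4 : ∀ e ∈ univ.filter (fun e : Color => e ≠ c),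
      ∑ v : K.Cell {c}, Nat.card {f : K.Cell {c, e} // Inc v f}
        = Fintype.card (K.Cell {c, e}) := by
    intro e he
    exact card_cells_at (by simp)
  rw [sum_congr rfl h2, sum_congr rfl h4] at h1
  have h3 : ∑ v : K.Cell {c}, Nat.card {t : K.T // K.cell {c} t = v} = Fintype.card K.T := by
    rw [← Fintype.card_congr (Equiv.sigmaFiberEquiv (K.cell {c})), Fintype.card_sigma]
    simp [Nat.card_eq_fintype_card]
  rw [h3] at h1
  rw [Fintype.card_sigma, Fintype.card_sigma]
  rw [← sum_subtype_eq_sum_filter, ← sum_subtype_eq_sum_filter] at h1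
  simp only [mul_comm 2]
  convert h1 using 3
  all_goals
    ext x
    simp

/-- The boundary operator from the edges to the vertices of the links. -/
noncomputable def linkMatrix (K : ColoredTriangulation) (c : Color) :
    Matrix (K.LinkVertex c) (K.LinkEdge c) (ZMod 2) :=
  Matrix.of fun a f => if a.1.1 ≠ f.1.1 ∧ Inc a.2 f.2 then 1 else 0

/-- The boundary operator from the triangles to the edges of the links. -/
noncomputable def linkBoundary (K : ColoredTriangulation) (c : Color) :
    (K.T → ZMod 2) →ₗ[ZMod 2] (K.LinkEdge c → ZMod 2) where
  toFun T f := ∑ t with K.cell {f.1.1}ᶜ t = f.2, T t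
  map_add' T T' := by ext f; simp [sum_add_distrib]
  map_smul' r T := by ext f; simp [mul_sum]

theorem linkBoundary_apply {c d : Color} (hd : d ≠ c) (T : K.T → ZMod 2) (t : K.T) :
    linkBoundary K c T ⟨⟨d, hd⟩, K.cell {d}ᶜ t⟩ = T t + T (K.s d t) :=
  sum_triangle T d t

theorem linkMatrix_mulVec {c e : Color} (he : e ≠ c) (a : K.Cell {c, e})
    (y : K.LinkEdge c → ZMod 2) :
    (linkMatrix K c).mulVec y ⟨⟨e, he⟩, a⟩
      = ∑ d : {d : Color // d ≠ c}, if d.1 ≠ e then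
          ∑ f : K.Cell {d.1}ᶜ with Inc a f, y ⟨d, f⟩ else 0 := by
  rw [Matrix.mulVec, dotProduct, Fintype.sum_sigma]
  refine sum_congr rfl fun d _ => ?_
  split_ifs with h
  · rw [sum_filter]
    refine sum_congr rfl fun f _ => ?_
    simp [linkMatrix, h.symm]
  · refine sum_eq_zero fun f _ => ?_
    push Not at h
    simp [linkMatrix, h]

/-- The boundary of a boundary vanishes: a tetrahedron at an edge with colours `c, e` has two
triangles containing that edge, one for each of the remaining colours `d`. -/
theorem range_linkBoundary_le (c : Color) :
    LinearMap.range (linkBoundary K c) ≤ LinearMap.ker (linkMatrix K c).mulVecLin := by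
  rintro _ ⟨T, rfl⟩
  rw [LinearMap.mem_ker, Matrix.mulVecLin_apply]
  ext ⟨⟨e, he⟩, a⟩
  rw [linkMatrix_mulVec]
  have h1 : ∀ d : {d : Color // d ≠ c}, (if d.1 ≠ e then
      ∑ f : K.Cell {d.1}ᶜ with Inc a f, linkBoundary K c T ⟨d, f⟩ else 0)
      = if d.1 ≠ e then ∑ t with K.cell {c, e} t = a, T t else 0 := by
    intro d
    split_ifs with h
    · refine sum_inc_sum_tetrahedra ?_ a T
      intro x hx
      simp only [mem_insert, mem_singleton] at hx
      simp only [mem_compl, mem_singleton]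
      rcases hx with rfl | rfl
      exacts [d.2.symm, h.symm]
    · rfl
  simp only [h1]
  rw [← sum_filter, sum_const]
  have h2 : ∀ c e : Color, e ≠ c →
      (univ.filter fun d : {d : Color // d ≠ c} => d.1 ≠ e).card = 2 := by decide
  rw [h2 c e he, two_nsmul, zmod2_add_self]
  rfl

theorem eq_of_forall_s_eq {c : Color} {α : Type*} {f : K.T → α}
    (hf : ∀ d, d ≠ c → ∀ t, f (K.s d t) = f t) (t : K.T) :
    f (Quotient.out (K.cell {c} t)) = f t :=
  eq_of_cell_eq (C := {c}) (fun d hd => hf d (by simpa using hd))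
    (Quotient.out_eq (K.cell {c} t))

/-- A 2-cycle of a link takes equal values on neighbouring tetrahedra. Links are connected by the
very definition of `Cell {c}`, so one value per vertex of colour `c` determines it. -/
theorem finrank_ker_linkBoundary_le (c : Color) :
    Module.finrank (ZMod 2) (LinearMap.ker (linkBoundary K c)) ≤ Fintype.card (K.Cell {c}) := by
  let F : LinearMap.ker (linkBoundary K c) →ₗ[ZMod 2] (K.Cell {c} → ZMod 2) :=
    { toFun := fun T v => T.1 (Quotient.out v)
      map_add' := fun _ _ => rfl
      map_smul' := fun _ _ => rfl }
  rw [← Module.finrank_pi (ZMod 2) (ι := K.Cell {c})]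
  refine LinearMap.finrank_le_finrank_of_injective (f := F) ?_
  rw [injective_iff_map_eq_zero]
  rintro ⟨T, hT⟩ h0
  ext t
  have hinv : ∀ d, d ≠ c → ∀ t, T (K.s d t) = T t := by
    intro d hd t
    have := congrFun (LinearMap.mem_ker.mp hT) ⟨⟨d, hd⟩, K.cell {d}ᶜ t⟩
    rw [linkBoundary_apply] at this
    exact (zmod2_eq_of_add_eq_zero this).symm
  have := congrFun h0 (K.cell {c} t)
  simp only [← eq_of_forall_s_eq hinv t]
  exact this

theorem linkMatrix_transpose_mulVec {c d : Color} (hd : d ≠ c) (t : K.T)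
    (g : K.LinkVertex c → ZMod 2) :
    (linkMatrix K c).transpose.mulVec g ⟨⟨d, hd⟩, K.cell {d}ᶜ t⟩
      = ∑ e : {e : Color // e ≠ c}, if e.1 ≠ d then g ⟨e, K.cell {c, e.1} t⟩ else 0 := by
  rw [Matrix.mulVec, dotProduct, Fintype.sum_sigma]
  refine sum_congr rfl fun e _ => ?_
  split_ifs with h
  · have hsub : ({c, e.1} : Finset Color) ⊆ {d}ᶜ := by
      intro x hx
      simp only [mem_insert, mem_singleton] at hx
      simp only [mem_compl, mem_singleton]
      rcases hx with rfl | rfl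
      exacts [hd.symm, h]
    simp [linkMatrix, h, inc_cell_iff hsub]
  · refine sum_eq_zero fun f _ => ?_
    push Not at h
    simp [linkMatrix, h]

/-- This is the bound on `H⁰` of the links: a function with equal values at the two ends of every
link edge is constant on each link. -/
theorem finrank_ker_linkMatrix_transpose_le (c : Color) :
    Module.finrank (ZMod 2) (LinearMap.ker (linkMatrix K c).transpose.mulVecLin)
      ≤ Fintype.card (K.Cell {c}) := by
  obtain ⟨e₀, he₀⟩ : ∃ e, e ≠ c := by revert c; decide
  let F : LinearMap.ker (linkMatrix K c).transpose.mulVecLin →ₗ[ZMod 2] (K.Cell {c} → ZMod 2) :=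
    { toFun := fun g v => g.1 ⟨⟨e₀, he₀⟩, K.cell {c, e₀} (Quotient.out v)⟩
      map_add' := fun _ _ => rfl
      map_smul' := fun _ _ => rfl }
  rw [← Module.finrank_pi (ZMod 2) (ι := K.Cell {c})]
  refine LinearMap.finrank_le_finrank_of_injective (f := F) ?_
  rw [injective_iff_map_eq_zero]
  rintro ⟨g, hg⟩ h0
  have hpair : ∀ (e e' : Color) (he : e ≠ c) (he' : e' ≠ c) (t : K.T),
      g ⟨⟨e, he⟩, K.cell {c, e} t⟩ = g ⟨⟨e', he'⟩, K.cell {c, e'} t⟩ := by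
    intro e e' he he' t
    by_cases hee : e = e'
    · subst hee; rfl
    have hex : ∀ (c e e' : Color) (he : e ≠ c) (he' : e' ≠ c), e ≠ e' → ∃ d, d ≠ c ∧
        (univ.filter fun x : {x : Color // x ≠ c} => x.1 ≠ d) = {⟨e, he⟩, ⟨e', he'⟩} := by
      decide
    obtain ⟨d, hd, hfil⟩ := hex c e e' he he' hee
    have := congrFun (LinearMap.mem_ker.mp hg) ⟨⟨d, hd⟩, K.cell {d}ᶜ t⟩
    rw [Matrix.mulVecLin_apply, linkMatrix_transpose_mulVec, ← sum_filter, hfil,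
      sum_pair (by simpa using hee)] at this
    exact zmod2_eq_of_add_eq_zero this
  have hinv : ∀ d, d ≠ c → ∀ t, g ⟨⟨e₀, he₀⟩, K.cell {c, e₀} (K.s d t)⟩
      = g ⟨⟨e₀, he₀⟩, K.cell {c, e₀} t⟩ := by
    intro d hd t
    -- The value is read off at an edge with colours `c, e` that contains no vertex of colour `d`,
    -- hence is unaffected by the crossing.
    have hex : ∀ c d : Color, ∃ e, e ≠ c ∧ e ≠ d := by decide
    obtain ⟨e, he, hed⟩ := hex c d
    rw [hpair e₀ e he₀ he, hpair e₀ e he₀ he, cell_s]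
    simp [hd, hed.symm]
  have hzero : ∀ t, g ⟨⟨e₀, he₀⟩, K.cell {c, e₀} t⟩ = 0 := by
    intro t
    rw [← eq_of_forall_s_eq (f := fun t => g ⟨⟨e₀, he₀⟩, K.cell {c, e₀} t⟩) hinv t]
    exact congrFun h0 (K.cell {c} t)
  ext ⟨⟨e, he⟩, a⟩
  obtain ⟨t, rfl⟩ := cell_surjective a
  exact (hpair e e₀ he he₀ t).trans (hzero t)

/-- The first homology of the links of the vertices of colour `c` vanishes. -/
theorem exists_of_link_cycle {c : Color} (h : ∀ v : K.Cell {c}, K.LinkIsSphere v)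
    (y : ∀ d : Color, K.Cell {d}ᶜ → ZMod 2)
    (hy : ∀ e, e ≠ c → ∀ a : K.Cell {c, e},
      ∑ d : Color with d ≠ c ∧ d ≠ e, ∑ f : K.Cell {d}ᶜ with Inc a f, y d f = 0) :
    ∃ T : K.T → ZMod 2, ∀ d, d ≠ c → ∀ t, y d (K.cell {d}ᶜ t) = T t + T (K.s d t) := by
  -- Let the links have `V` vertices, `E` edges and `F` triangles in total, and let there be `n`
  -- links. The range has dimension at least `F - n` and the kernel at most `E - V + n`; Euler's
  -- formula `V + F = E + 2n` makes these equal.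
  have hrange : LinearMap.range (linkBoundary K c) = LinearMap.ker (linkMatrix K c).mulVecLin := by
    refine Submodule.eq_of_le_of_finrank_le (range_linkBoundary_le c) ?_
    have h1 := LinearMap.finrank_range_add_finrank_ker (linkBoundary K c)
    have h2 := LinearMap.finrank_range_add_finrank_ker (linkMatrix K c).mulVecLin
    have h3 := LinearMap.finrank_range_add_finrank_ker (linkMatrix K c).transpose.mulVecLin
    have h4 : Module.finrank (ZMod 2) (LinearMap.range (linkMatrix K c).transpose.mulVecLin)
        = Module.finrank (ZMod 2) (LinearMap.range (linkMatrix K c).mulVecLin) :=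
      Matrix.rank_transpose _
    rw [Module.finrank_pi] at h1 h2 h3
    have h5 := finrank_ker_linkBoundary_le (K := K) c
    have h6 := finrank_ker_linkMatrix_transpose_le (K := K) c
    have h7 := euler_links h
    omega
  have hker : (fun f : K.LinkEdge c => y f.1.1 f.2)
      ∈ LinearMap.ker (linkMatrix K c).mulVecLin := by
    rw [LinearMap.mem_ker, Matrix.mulVecLin_apply]
    ext ⟨⟨e, he⟩, a⟩
    rw [linkMatrix_mulVec]
    refine Eq.trans ?_ (hy e he a)
    rw [← filter_filter, sum_filter (fun d => d ≠ e),
      Finset.sum_subtype (univ.filter fun d => d ≠ c) (p := fun d => d ≠ c) (by simp)]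
  rw [← hrange] at hker
  obtain ⟨T, hT⟩ := hker
  refine ⟨T, fun d hd t => ?_⟩
  rw [← linkBoundary_apply hd, hT]

end ColoredTriangulation

/-! ### Exactness on the closed lattice; the Gauss law -/

namespace STCLattice

open Finset
open scoped Classical
open ColoredTriangulation Color

variable {Λ : STCLattice} {C C' : Finset Color}

/-! ### Exactness on the closed lattice -/

/-- A triangulated `1`-cycle without edges at the vertices of colour `R` is a boundary of triangles
without vertices of colour `R`. -/
theorem exists_triangles_of_cycle (z : (C : Finset Color) → Λ.Cell C → ZMod 2)
    (hz : ∀ (c : Color) (v : Λ.Cell {c}),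
      (∑ C : Finset Color with C.card = 2 ∧ c ∈ C, ∑ e : Λ.Cell C with Inc v e, z C e) = 0)
    (hR : ∀ e, e ≠ R → ∀ a : Λ.Cell {R, e}, z {R, e} a = 0) :
    ∃ w : Λ.Cell {R}ᶜ → ZMod 2, ∀ C : Finset Color, C.card = 2 → R ∉ C → ∀ e : Λ.Cell C,
      z C e = ∑ f : Λ.Cell {R}ᶜ with Inc e f, w f := by
  obtain ⟨w, hw⟩ := Λ.homology z hz
  -- As `z` has no edges at `R` vertices, the triangles of `w` at these vertices form cycles in
  -- their links, hence bound there.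
  obtain ⟨T, hT⟩ := exists_of_link_cycle (Λ.manifold R) (fun d f => w {d}ᶜ f) (by
    intro e he a
    have h := hw {R, e} (card_pair he.symm) a
    rw [hR e he a] at h
    have hfil : ∀ e : Color, e ≠ R →
        (univ.filter fun C' : Finset Color => C'.card = 3 ∧ {R, e} ⊆ C')
          = (univ.filter fun d => d ≠ R ∧ d ≠ e).image fun d => {d}ᶜ := by decide
    rw [hfil e he, sum_image (compl_injOn _)] at h
    exact h.symm)
  -- Adding to `w` the full boundary of `T` does not change the boundary of `w`, cancels all its
  -- triangles with an `R` vertex and leaves this chain.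
  refine ⟨fun f => w {R}ᶜ f + ∑ t with Λ.cell {R}ᶜ t = f, T t, fun C hC hRC e => ?_⟩
  obtain ⟨d, hd, hdC, hfil⟩ : ∃ d, d ≠ R ∧ d ∉ C ∧
      (univ.filter fun C' : Finset Color => C'.card = 3 ∧ C ⊆ C') = {{R}ᶜ, {d}ᶜ} := by
    clear hR hw hT e
    revert C; decide
  have hCd : C ⊆ {d}ᶜ := by
    intro a ha
    simp only [mem_compl, mem_singleton]
    rintro rfl
    exact hdC ha
  have hCR : C ⊆ {R}ᶜ := by
    intro a ha
    simp only [mem_compl, mem_singleton]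
    rintro rfl
    exact hRC ha
  rw [hw C hC e, hfil, sum_pair (by simpa using hd.symm), sum_add_distrib,
    sum_inc_sum_tetrahedra hCR, ← sum_inc_sum_tetrahedra hCd]
  congr 1
  refine sum_congr rfl fun f _ => ?_
  obtain ⟨t, rfl⟩ := cell_surjective f
  rw [sum_triangle, hT d hd]

/-- A cycle of `BG` and `BY` edges is the boundary of a set of octahedra. -/
theorem exists_octahedra_of_cycle (zG : Λ.Cell {B, G} → ZMod 2) (zY : Λ.Cell {B, Y} → ZMod 2)
    (hB : ∀ v : Λ.Cell {B}, ∑ e : Λ.Cell {B, G} with Inc v e, zG e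
      + ∑ e : Λ.Cell {B, Y} with Inc v e, zY e = 0)
    (hG : ∀ v : Λ.Cell {G}, ∑ e : Λ.Cell {B, G} with Inc v e, zG e = 0)
    (hY : ∀ v : Λ.Cell {Y}, ∑ e : Λ.Cell {B, Y} with Inc v e, zY e = 0) :
    ∃ x : Λ.Cell {G, Y} → ZMod 2,
      (∀ e, zG e = ∑ q : Λ.Cell {G, Y} with Inc e q, x q) ∧
      ∀ e, zY e = ∑ q : Λ.Cell {G, Y} with Inc e q, x q := by
  -- Passing through a representative tetrahedron avoids casts along equations between colour sets.
  let z : (C : Finset Color) → Λ.Cell C → ZMod 2 := fun C e =>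
    if C = {B, G} then zG (Λ.cell {B, G} (Quotient.out e))
    else if C = {B, Y} then zY (Λ.cell {B, Y} (Quotient.out e)) else 0
  have hzG : ∀ e, z {B, G} e = zG e := fun e =>
    (if_pos rfl).trans (congrArg zG (Quotient.out_eq e))
  have hzY : ∀ e, z {B, Y} e = zY e := fun e =>
    (if_neg (by decide)).trans ((if_pos rfl).trans (congrArg zY (Quotient.out_eq e)))
  have hz0 : ∀ C, C ≠ {B, G} → C ≠ {B, Y} → ∀ e, z C e = 0 := fun C h h' e =>
    (if_neg h).trans (if_neg h')
  have hzz : ∀ (C : Finset Color) (c : Color) (v : Λ.Cell {c}), C ≠ {B, G} → C ≠ {B, Y} →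
      ∑ e : Λ.Cell C with Inc v e, z C e = 0 := fun C c v h h' =>
    sum_eq_zero fun e _ => hz0 C h h' e
  obtain ⟨w, hw⟩ := exists_triangles_of_cycle z (by
    intro c v
    cases c with
    | R =>
      refine sum_eq_zero fun C hC => hzz C R v ?_ ?_
      all_goals
        rintro rfl
        revert hC; decide
    | B =>
      rw [show (univ.filter fun C : Finset Color => C.card = 2 ∧ B ∈ C)
        = {{B, G}, {B, Y}, {R, B}} by decide, sum_insert (by decide), sum_insert (by decide),
        sum_singleton, hzz {R, B} B v (by decide) (by decide), add_zero]
      simp only [hzG, hzY]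
      exact hB v
    | G =>
      rw [show (univ.filter fun C : Finset Color => C.card = 2 ∧ G ∈ C)
        = {{B, G}, {G, Y}, {R, G}} by decide, sum_insert (by decide), sum_insert (by decide),
        sum_singleton, hzz {G, Y} G v (by decide) (by decide),
        hzz {R, G} G v (by decide) (by decide), add_zero, add_zero]
      simp only [hzG]
      exact hG v
    | Y =>
      rw [show (univ.filter fun C : Finset Color => C.card = 2 ∧ Y ∈ C)
        = {{B, Y}, {G, Y}, {R, Y}} by decide, sum_insert (by decide), sum_insert (by decide),
        sum_singleton, hzz {G, Y} Y v (by decide) (by decide),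
        hzz {R, Y} Y v (by decide) (by decide), add_zero, add_zero]
      simp only [hzY]
      exact hY v)
    (by
      intro e he a
      refine hz0 _ ?_ ?_ a
      all_goals
        clear a
        revert e; decide)
  -- No `GY` edge carries `z`, so the two `BGY` triangles at each such edge have equal coefficients
  -- and `w` descends to octahedra.
  have hoct : ∀ t, w (Λ.cell {R}ᶜ t) = w (Λ.cell {R}ᶜ (Λ.s B t)) := by
    intro t
    have h := hw {G, Y} (by decide) (by decide) (Λ.cell {G, Y} t)
    rw [hz0 _ (by decide) (by decide)] at h
    simp only [inc_comm (a := Λ.cell {G, Y} t)] at h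
    rw [sum_inc_octahedron isRB_B Subset.rfl (by decide)] at h
    exact zmod2_eq_of_add_eq_zero h.symm
  let x : Λ.Cell {G, Y} → ZMod 2 := fun q => w (Λ.cell {R}ᶜ (Quotient.out q))
  have hx : ∀ f, x (octahedronOf f) = w f := by
    intro f
    obtain ⟨t, rfl⟩ := cell_surjective f
    have h : Inc (Λ.cell {R}ᶜ (Quotient.out (octahedronOf (Λ.cell {R}ᶜ t)))) (Λ.cell {G, Y} t) := by
      rw [← octahedronOf_cell isRB_B t]
      exact ⟨_, rfl, Quotient.out_eq (octahedronOf (Λ.cell {R}ᶜ t))⟩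
    rcases (inc_octahedron_iff isRB_B Subset.rfl).mp h with h | h
    · exact congrArg w h
    · exact (congrArg w h).trans (hoct t).symm
  refine ⟨x, fun e => ?_, fun e => ?_⟩
  · rw [← hzG, hw {B, G} (by decide) (by decide), sum_octahedra isRB_B (by decide) (by decide)]
    simp only [hx]
  · rw [← hzY, hw {B, Y} (by decide) (by decide), sum_octahedra isRB_B (by decide) (by decide)]
    simp only [hx]

/-- A set of octahedra that meets evenly all the edges of colours `k` and `B` is a sum of edges of
colours `k` and `R`. -/
theorem exists_edges_of_even {k k' : Color} (hk : k = G ∧ k' = Y ∨ k = Y ∧ k' = G)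
    (CB CR : Finset Color) (hCB : CB = {k, B}) (hCR : CR = {R, k}) (u : Λ.Cell {G, Y} → ZMod 2)
    (hu : ∀ e : Λ.Cell CB, ∑ q : Λ.Cell {G, Y} with Inc e q, u q = 0) :
    ∃ γ : Λ.Cell CR → ZMod 2, ∀ t,
      u (Λ.cell {G, Y} t) = γ (Λ.cell CR t) + γ (Λ.cell CR (Λ.s R t)) := by
  subst hCB hCR
  have hkR : k ≠ R := by rcases hk with ⟨rfl, -⟩ | ⟨rfl, -⟩ <;> decide
  let y : ∀ d : Color, Λ.Cell {d}ᶜ → ZMod 2 := fun d f =>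
    if d = R then u (Λ.cell {G, Y} (Quotient.out f)) else 0
  have hyR : ∀ t, y R (Λ.cell {R}ᶜ t) = u (Λ.cell {G, Y} t) := fun t =>
    (if_pos rfl).trans (congrArg u (octahedronOf_cell isRB_B t))
  have hy0 : ∀ d, d ≠ R → ∀ f, y d f = 0 := fun d hd f => if_neg hd
  -- In the links of the `k` vertices, the `BGY` triangles of `u` form a cycle: they are absent from
  -- the `kR` edges, even at the `kB` edges by `hu`, and paired by octahedra at the `GY` edges.
  obtain ⟨T, hT⟩ := exists_of_link_cycle (Λ.manifold k) y (by
    intro e he a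
    by_cases heR : e = R
    · refine sum_eq_zero fun d hd => sum_eq_zero fun f _ => hy0 d ?_ f
      rw [← heR]
      exact (mem_filter.mp hd).2.2
    rw [sum_eq_single_of_mem R (by simp [hkR.symm, Ne.symm heR])
      (fun d _ hd => sum_eq_zero fun f _ => hy0 d hd f)]
    have hyo : ∀ f, y R f = u (octahedronOf f) := fun f => if_pos rfl
    simp only [hyo]
    by_cases heB : e = B
    · subst heB
      rw [← sum_octahedra isRB_B (C := {k, B})
        (by rcases hk with ⟨rfl, -⟩ | ⟨rfl, -⟩ <;> decide) (by simp)]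
      exact hu a
    · have hsub : ({k, e} : Finset Color) ⊆ {G, Y} := by
        clear a
        rcases hk with ⟨rfl, -⟩ | ⟨rfl, -⟩ <;> revert e <;> decide
      rw [← sum_inc_sum_octahedra_eq_zero isRB_B (C' := {R}ᶜ) (hsub.trans (by decide)) hsub
        Subset.rfl (by decide) a u]
      refine sum_congr rfl fun f _ => ?_
      rw [sum_octahedra isRB_B Subset.rfl (by decide)]
      obtain ⟨t, rfl⟩ := cell_surjective f
      rw [show (univ.filter fun f => Inc (Λ.cell {R}ᶜ t) f) = {Λ.cell {R}ᶜ t} from ?_,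
        sum_singleton]
      ext f
      obtain ⟨t', rfl⟩ := cell_surjective f
      rw [mem_filter, inc_cell_iff Subset.rfl]
      simp)
  -- Around a `k` vertex, `T` changes only across `BGY` triangles, so it is a function of the `Rk`
  -- edge of the tetrahedron.
  have hinv : ∀ d, d ∉ ({R, k} : Finset Color) → ∀ t, T (Λ.s d t) = T t := by
    intro d hd t
    simp only [mem_insert, mem_singleton, not_or] at hd
    have := hT d hd.2 t
    rw [hy0 d hd.1] at this
    exact (zmod2_eq_of_add_eq_zero this.symm).symm
  have hγ : ∀ t, T (Quotient.out (Λ.cell {R, k} t)) = T t := fun t =>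
    eq_of_cell_eq hinv (Quotient.out_eq (Λ.cell {R, k} t))
  refine ⟨fun a => T (Quotient.out a), fun t => ?_⟩
  rw [← hyR, hT R hkR.symm]
  exact congrArg₂ (· + ·) (hγ t).symm (hγ (Λ.s R t)).symm

/-! ### The linear maps of the code -/

theorem deltaM_add (x y : Λ.CQ) : deltaM (x + y) = deltaM x + deltaM y := by
  ext m; simp [deltaM, sum_add_distrib]

theorem bdS_add (x y : Λ.CQ) : bdS (x + y) = bdS x + bdS y := by
  ext m; simp [bdS, sum_add_distrib]

theorem deltaS_add (x y : Λ.CM) : deltaS (x + y) = deltaS x + deltaS y := by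
  ext m; simp [deltaS, sum_add_distrib]

theorem deltaR_add (x y : Λ.CM) : deltaR (x + y) = deltaR x + deltaR y := by
  ext m; simp [deltaR, sum_add_distrib]

theorem bdQ_add (x y : Λ.CG) : bdQ (x + y) = bdQ x + bdQ y := by
  ext m; simp [bdQ, sum_add_distrib]

theorem InGauge.add {x y : Λ.CQ} (hx : InGauge x) (hy : InGauge y) : InGauge (x + y) := by
  obtain ⟨γ, rfl⟩ := hx
  obtain ⟨γ', rfl⟩ := hy
  exact ⟨γ + γ', (bdQ_add γ γ').symm⟩

/-- Faces of boundary cells are boundary cells. Thus around an interior cell, sums over interior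
cells and over all cells agree, and the closed-lattice identities apply. -/
theorem Interior.of_inc (h : C ⊆ C') {a : Λ.Cell C} {b : Λ.Cell C'} (ha : ¬ OnBoundary a)
    (hab : Inc a b) : ¬ OnBoundary b := by
  rintro ⟨t, ht, ht'⟩
  subst ht
  rw [inc_cell_iff h] at hab
  exact ha ⟨t, hab, ht'⟩

theorem ne_removed_of_inc {a : Λ.Cell C} (ha : ¬ OnBoundary a) {q : Λ.Cell {G, Y}}
    (hq : Inc a q) : q ≠ Λ.removed := by
  rintro rfl
  exact ha hq

theorem sum_qubits {a : Λ.Cell C} (ha : ¬ OnBoundary a) (x : Λ.Qubit → ZMod 2)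
    (y : Λ.Cell {G, Y} → ZMod 2) (hxy : ∀ q : Λ.Qubit, x q = y q.1) :
    ∑ q : Λ.Qubit with Inc a q.1, x q = ∑ q : Λ.Cell {G, Y} with Inc a q, y q :=
  sum_subtype_filter (fun _ hq => ne_removed_of_inc ha hq) x y hxy

/-- The set of octahedra, not containing the removed one, with the given qubits. -/
noncomputable def extendQ (x : Λ.CQ) : Λ.Cell {G, Y} → ZMod 2 :=
  fun q => if h : q ≠ Λ.removed then x ⟨q, h⟩ else 0

theorem extendQ_coe (x : Λ.CQ) (q : Λ.Qubit) : x q = extendQ x q.1 := by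
  rw [extendQ, dif_pos q.2]

theorem extendQ_removed (x : Λ.CQ) : extendQ x Λ.removed = 0 := by
  rw [extendQ, dif_neg (by simp)]

theorem deltaM_inl (x : Λ.CQ) (e : Λ.Interior {B, G}) :
    deltaM x (.inl e) = ∑ q : Λ.Cell {G, Y} with Inc e.1 q, extendQ x q :=
  sum_qubits e.2 x _ (extendQ_coe x)

theorem deltaM_inr (x : Λ.CQ) (e : Λ.Interior {B, Y}) :
    deltaM x (.inr e) = ∑ q : Λ.Cell {G, Y} with Inc e.1 q, extendQ x q :=
  sum_qubits e.2 x _ (extendQ_coe x)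

theorem bdS_eq (x : Λ.CQ) (v : Λ.Stab) :
    bdS x v = ∑ q : Λ.Cell {G, Y} with Inc v.1 q, extendQ x q :=
  sum_qubits v.2 x _ (extendQ_coe x)

theorem sum_interior (h : C ⊆ C') {v : Λ.Cell C} (hv : ¬ OnBoundary v)
    (f : Λ.Interior C' → ZMod 2) (g : Λ.Cell C' → ZMod 2) (hfg : ∀ e, f e = g e.1) :
    ∑ e : Λ.Interior C' with Inc v e.1, f e = ∑ e : Λ.Cell C' with Inc v e, g e :=
  sum_subtype_filter (P := fun e : Λ.Cell C' => ¬ OnBoundary e) (Q := fun e => Inc v e)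
    (fun _ he => Interior.of_inc h hv he) f g hfg

theorem sum_meas {v : Λ.GaussVertex} (ζ : Λ.CM) :
    ∑ m : Λ.Meas with MeasInc m v, ζ m
      = ∑ e : Λ.Interior {B, G} with MeasInc (.inl e) v, ζ (.inl e)
        + ∑ e : Λ.Interior {B, Y} with MeasInc (.inr e) v, ζ (.inr e) := by
  simp only [sum_filter, Fintype.sum_sum_type]

theorem deltaR_B (ζ : Λ.CM) (v : Λ.Stab) :
    deltaR ζ (.inl v) = ∑ e : Λ.Interior {B, G} with Inc v.1 e.1, ζ (.inl e)
        + ∑ e : Λ.Interior {B, Y} with Inc v.1 e.1, ζ (.inr e) := by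
  rw [deltaR, sum_meas]
  congr 1 <;> exact sum_congr (filter_congr fun e _ => inc_comm) fun _ _ => rfl

theorem deltaR_G (ζ : Λ.CM) (v : Λ.Interior {G}) :
    deltaR ζ (.inr (.inl v)) = ∑ e : Λ.Interior {B, G} with Inc v.1 e.1, ζ (.inl e) := by
  rw [deltaR, sum_meas]
  refine (congrArg₂ (· + ·) (sum_congr (filter_congr fun e _ => inc_comm) fun _ _ => rfl)
    (sum_eq_zero fun e he => ?_)).trans (add_zero _)
  exact ((mem_filter.mp he).2 : False).elim

theorem deltaR_Y (ζ : Λ.CM) (v : Λ.Interior {Y}) :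
    deltaR ζ (.inr (.inr v)) = ∑ e : Λ.Interior {B, Y} with Inc v.1 e.1, ζ (.inr e) := by
  rw [deltaR, sum_meas]
  refine (congrArg₂ (· + ·) (sum_eq_zero fun e he => ?_)
    (sum_congr (filter_congr fun e _ => inc_comm) fun _ _ => rfl)).trans (zero_add _)
  exact ((mem_filter.mp he).2 : False).elim

/-- The stabilizer generators are products of measured gauge generators. -/
theorem deltaS_deltaM (x : Λ.CQ) : deltaS (deltaM x) = bdS x := by
  ext v
  rw [bdS_eq, ← sum_inc_sum_octahedra isRB_B (C' := {B, G}) (by decide) (by decide) (by decide)]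
  exact sum_interior (by decide) v.2 _
      (fun e => ∑ q : Λ.Cell {G, Y} with Inc e q, extendQ x q) (deltaM_inl x)

/-- The Gauss law. -/
theorem deltaR_deltaM (x : Λ.CQ) : deltaR (deltaM x) = 0 := by
  ext v
  rcases v with v | v | v
  · rw [deltaR_B, sum_interior (by decide) v.2 _
      (fun e => ∑ q : Λ.Cell {G, Y} with Inc e q, extendQ x q) (deltaM_inl x),
      sum_interior (by decide) v.2 _
      (fun e => ∑ q : Λ.Cell {G, Y} with Inc e q, extendQ x q) (deltaM_inr x),
      sum_inc_sum_octahedra isRB_B (by decide) (by decide) (by decide),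
      sum_inc_sum_octahedra isRB_B (by decide) (by decide) (by decide), zmod2_add_self]
    rfl
  · rw [deltaR_G, sum_interior (by decide) v.2 _
      (fun e => ∑ q : Λ.Cell {G, Y} with Inc e q, extendQ x q) (deltaM_inl x),
      sum_inc_sum_octahedra_eq_zero isRB_B (by decide) (by decide) (by decide) (by decide)]
    rfl
  · rw [deltaR_Y, sum_interior (by decide) v.2 _
      (fun e => ∑ q : Λ.Cell {G, Y} with Inc e q, extendQ x q) (deltaM_inr x),
      sum_inc_sum_octahedra_eq_zero isRB_B (by decide) (by decide) (by decide) (by decide)]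
    rfl

end STCLattice

/-! ### Exactness on the lattice with one octahedron removed -/

namespace STCLattice

open Finset
open scoped Classical
open ColoredTriangulation Color

variable {Λ : STCLattice} {C C' : Finset Color}

variable (Λ) in
theorem exists_removed_eq : ∃ t₀, Λ.removed = Λ.cell {G, Y} t₀ :=
  (cell_surjective Λ.removed).imp fun _ h => h.symm

theorem onBoundary_iff {a a' : Color} (h : IsRB a a') (hC : C ⊆ {a'}ᶜ) {t₀ : Λ.T}
    (ht₀ : Λ.removed = Λ.cell {G, Y} t₀) {e : Λ.Cell C} :
    OnBoundary e ↔ e = Λ.cell C t₀ ∨ e = Λ.cell C (Λ.s a t₀) := by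
  rw [OnBoundary, ht₀, inc_octahedron_iff h hC]

theorem onBoundary_iff_of_subset (hC : C ⊆ {G, Y}) {t₀ : Λ.T}
    (ht₀ : Λ.removed = Λ.cell {G, Y} t₀) {e : Λ.Cell C} :
    OnBoundary e ↔ e = Λ.cell C t₀ := by
  rw [OnBoundary, ht₀, inc_cell_iff hC, eq_comm]

/-- Sums of functions that vanish on the boundary. -/
theorem sum_interior_of_boundary (P : Λ.Cell C → Prop) (g : Λ.Cell C → ZMod 2)
    (hg : ∀ e, OnBoundary e → g e = 0) :
    ∑ e : Λ.Interior C with P e.1, g e.1 = ∑ e : Λ.Cell C with P e, g e := by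
  have h := sum_subtype_filter (P := fun e : Λ.Cell C => ¬ OnBoundary e)
    (Q := fun e => P e ∧ ¬ OnBoundary e) (fun _ he => he.2) (fun e => g e.1) g fun _ => rfl
  refine Eq.trans (sum_congr ?_ fun _ _ => rfl) (h.trans ?_)
  · ext e
    simp only [mem_filter, mem_univ, true_and]
    exact (and_iff_left e.2).symm
  refine sum_subset (fun e he => ?_) fun e he he' => ?_
  · simp only [mem_filter, mem_univ, true_and] at he ⊢
    exact he.1
  · simp only [mem_filter, mem_univ, true_and, not_and, not_not] at he he'
    exact hg e (he' he)

/-- The vector on all cells, zero on the boundary, with the given values on the interior. -/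
noncomputable def extend (f : Λ.Interior C → ZMod 2) : Λ.Cell C → ZMod 2 :=
  fun e => if h : ¬ OnBoundary e then f ⟨e, h⟩ else 0

theorem extend_coe (f : Λ.Interior C → ZMod 2) (e : Λ.Interior C) : f e = extend f e.1 := by
  rw [extend, dif_pos e.2]

theorem sum_inc_ite (h : C ⊆ C') (v : Λ.Cell C) (t : Λ.T) (α : ZMod 2) :
    ∑ e : Λ.Cell C' with Inc v e, (if e = Λ.cell C' t then α else 0)
      = if v = Λ.cell C t then α else 0 := by
  rw [sum_filter]
  simp only [← ite_and]
  by_cases hv : v = Λ.cell C t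
  · rw [if_pos hv, sum_eq_single (Λ.cell C' t)]
    · rw [if_pos ⟨hv ▸ inc_cell_self t, rfl⟩]
    · intro e _ he
      rw [if_neg fun h => he h.2]
    · simp
  · rw [if_neg hv]
    refine sum_eq_zero fun e _ => if_neg ?_
    rintro ⟨he, rfl⟩
    exact hv ((inc_cell_iff h).mp he).symm

/-- The measurement outcomes that satisfy the Gauss law are the syndromes of Pauli errors. -/
theorem exists_deltaM_of_gauss (ζ : Λ.CM) (hζ : deltaR ζ = 0) : ∃ x : Λ.CQ, ζ = deltaM x := by
  obtain ⟨t₀, ht₀⟩ := Λ.exists_removed_eq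
  -- Extended by zero, the outcome can violate the Gauss law only at the two `B`, one `G` and one
  -- `Y` vertices of the removed octahedron.
  set ζG : Λ.Cell {B, G} → ZMod 2 := extend fun e => ζ (.inl e)
  set ζY : Λ.Cell {B, Y} → ZMod 2 := extend fun e => ζ (.inr e)
  set dB : Λ.Cell {B} → ZMod 2 := fun v => ∑ e : Λ.Cell {B, G} with Inc v e, ζG e
    + ∑ e : Λ.Cell {B, Y} with Inc v e, ζY e with hdB
  set dG : Λ.Cell {G} → ZMod 2 := fun v => ∑ e : Λ.Cell {B, G} with Inc v e, ζG e with hdG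
  set dY : Λ.Cell {Y} → ZMod 2 := fun v => ∑ e : Λ.Cell {B, Y} with Inc v e, ζY e with hdY
  have hB0 : ∀ v, ¬ OnBoundary v → dB v = 0 := by
    intro v hv
    have := congrFun hζ (.inl ⟨v, hv⟩)
    rw [deltaR_B, sum_interior (by decide) hv _ ζG (extend_coe _),
      sum_interior (by decide) hv _ ζY (extend_coe _)] at this
    exact this
  have hG0 : ∀ v, ¬ OnBoundary v → dG v = 0 := by
    intro v hv
    have := congrFun hζ (.inr (.inl ⟨v, hv⟩))
    rw [deltaR_G, sum_interior (by decide) hv _ ζG (extend_coe _)] at this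
    exact this
  have hY0 : ∀ v, ¬ OnBoundary v → dY v = 0 := by
    intro v hv
    have := congrFun hζ (.inr (.inr ⟨v, hv⟩))
    rw [deltaR_Y, sum_interior (by decide) hv _ ζY (extend_coe _)] at this
    exact this
  have hbB : ∀ v : Λ.Cell {B}, OnBoundary v ↔ v = Λ.cell {B} t₀ ∨ v = Λ.cell {B} (Λ.s B t₀) :=
    fun v => onBoundary_iff isRB_B (by decide) ht₀
  have hbG : ∀ v : Λ.Cell {G}, OnBoundary v ↔ v = Λ.cell {G} t₀ :=
    fun v => onBoundary_iff_of_subset (by decide) ht₀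
  have hbY : ∀ v : Λ.Cell {Y}, OnBoundary v ↔ v = Λ.cell {Y} t₀ :=
    fun v => onBoundary_iff_of_subset (by decide) ht₀
  -- Every edge has one `B` end and one end of colour `G` or `Y`, so the violations at the `B`
  -- vertices balance those at `G` and `Y`.
  have hsumB : dB (Λ.cell {B} t₀) + dB (Λ.cell {B} (Λ.s B t₀)) = ∑ e, ζG e + ∑ e, ζY e := by
    rw [← sum_sum_inc (C := {B}) (by decide) ζG, ← sum_sum_inc (C := {B}) (by decide) ζY,
      ← sum_add_distrib, ← sum_pair (Λ.B_ne t₀).symm]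
    refine sum_subset (subset_univ _) fun v _ hv => hB0 v ?_
    rw [hbB]
    simpa using hv
  have hsumG : dG (Λ.cell {G} t₀) = ∑ e, ζG e := by
    rw [← sum_sum_inc (C := {G}) (by decide) ζG]
    exact (sum_eq_single_of_mem _ (mem_univ _) fun v _ hv =>
      hG0 v (by rwa [hbG])).symm
  have hsumY : dY (Λ.cell {Y} t₀) = ∑ e, ζY e := by
    rw [← sum_sum_inc (C := {Y}) (by decide) ζY]
    exact (sum_eq_single_of_mem _ (mem_univ _) fun v _ hv =>
      hY0 v (by rwa [hbY])).symm
  rw [← hsumG, ← hsumY] at hsumB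
  have hs : ∀ c : Color, c ≠ B → Λ.cell {c} (Λ.s B t₀) = Λ.cell {c} t₀ := fun c hc =>
    cell_s (by simpa using hc.symm) t₀
  -- The violations are repaired along the boundary path `Y - B - G - B'`, with coefficients `b₁,
  -- a₁, a₂`. The ends `Y` and `B'` dictate `b₁` and `a₂`, then `G` dictates `a₁`; the equation at
  -- `B` is the balance `hsumB`.
  set a₁ := dG (Λ.cell {G} t₀) + dB (Λ.cell {B} (Λ.s B t₀)) with ha₁
  set a₂ := dB (Λ.cell {B} (Λ.s B t₀)) with ha₂
  set b₁ := dY (Λ.cell {Y} t₀) with hb₁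
  have h2 : ∀ a : ZMod 2, a + a = 0 := zmod2_add_self
  obtain ⟨x, hxG, hxY⟩ := exists_octahedra_of_cycle
    (fun e => ζG e + ((if e = Λ.cell {B, G} t₀ then a₁ else 0)
      + (if e = Λ.cell {B, G} (Λ.s B t₀) then a₂ else 0)))
    (fun e => ζY e + (if e = Λ.cell {B, Y} t₀ then b₁ else 0)) (by
      intro v
      simp only [sum_add_distrib]
      rw [sum_inc_ite (by decide), sum_inc_ite (by decide), sum_inc_ite (by decide)]
      have hd : ∑ e : Λ.Cell {B, G} with Inc v e, ζG e
        + ∑ e : Λ.Cell {B, Y} with Inc v e, ζY e = dB v := rfl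
      by_cases hv : OnBoundary v
      · rcases (hbB v).mp hv with rfl | rfl
        · rw [if_pos rfl, if_neg (Λ.B_ne t₀).symm, if_pos rfl]
          linear_combination hd + hsumB + ha₁ + h2 b₁ + h2 (dG (Λ.cell {G} t₀))
        · rw [if_pos rfl, if_neg (Λ.B_ne t₀), if_neg (Λ.B_ne t₀)]
          linear_combination hd + h2 a₂
      · rw [hbB, not_or] at hv
        rw [if_neg hv.1, if_neg hv.2, if_neg hv.1]
        linear_combination hd + hB0 v (by rw [hbB, not_or]; exact hv)) (by
      intro v
      simp only [sum_add_distrib]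
      rw [sum_inc_ite (by decide), sum_inc_ite (by decide), hs G (by decide)]
      have hd : ∑ e : Λ.Cell {B, G} with Inc v e, ζG e = dG v := rfl
      by_cases hv : v = Λ.cell {G} t₀
      · subst hv
        rw [if_pos rfl, if_pos rfl]
        linear_combination hd + ha₁ + h2 (dG (Λ.cell {G} t₀)) + h2 a₂
      · rw [if_neg hv, if_neg hv]
        linear_combination hd + hG0 v (by rwa [hbG])) (by
      intro v
      simp only [sum_add_distrib]
      rw [sum_inc_ite (by decide)]
      have hd : ∑ e : Λ.Cell {B, Y} with Inc v e, ζY e = dY v := rfl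
      by_cases hv : v = Λ.cell {Y} t₀
      · subst hv
        rw [if_pos rfl]
        linear_combination hd + h2 b₁
      · rw [if_neg hv]
        linear_combination hd + hY0 v (by rwa [hbY]))
  -- The coefficient of the removed octahedron may be dropped, since no interior edge touches it.
  refine ⟨fun q => x q.1, ?_⟩
  ext m
  rcases m with ⟨e, he⟩ | ⟨e, he⟩
  · refine Eq.trans ?_ ((hxG e).trans (sum_qubits he (fun q => x q.1) x fun _ => rfl).symm)
    have h := he
    rw [onBoundary_iff isRB_B (by decide) ht₀, not_or] at h
    rw [if_neg h.1, if_neg h.2, add_zero, add_zero]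
    exact extend_coe (fun e => ζ (.inl e)) ⟨e, he⟩
  · refine Eq.trans ?_ ((hxY e).trans (sum_qubits he (fun q => x q.1) x fun _ => rfl).symm)
    have h := he
    rw [onBoundary_iff isRB_B (by decide) ht₀, not_or] at h
    rw [if_neg h.1, add_zero]
    exact extend_coe (fun e => ζ (.inr e)) ⟨e, he⟩

/-- This makes confinement applicable to the part of an outcome in a cluster, of which only the
Gauss law is known. -/
theorem isFlux_of_gauss (ζ : Λ.CM) (hζ : deltaR ζ = 0) : IsFlux ζ := by
  obtain ⟨x, rfl⟩ := exists_deltaM_of_gauss ζ hζ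
  have h0 : bdQ (0 : Λ.CG) = 0 := by ext q; simp [bdQ]
  have h0' : deltaM (0 : Λ.CQ) = 0 := by ext q; simp [deltaM]
  exact ⟨x, 0, by rw [h0, h0', add_zero]⟩

theorem bdQ_elim (gG : Λ.Cell {R, G} → ZMod 2) (gY : Λ.Cell {R, Y} → ZMod 2)
    (hG : ∀ e, OnBoundary e → gG e = 0) (hY : ∀ e, OnBoundary e → gY e = 0) (t : Λ.T)
    (ht : Λ.cell {G, Y} t ≠ Λ.removed) :
    bdQ (Sum.elim (fun e => gG e.1) fun e => gY e.1) ⟨Λ.cell {G, Y} t, ht⟩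
      = gG (Λ.cell {R, G} t) + gG (Λ.cell {R, G} (Λ.s R t))
        + (gY (Λ.cell {R, Y} t) + gY (Λ.cell {R, Y} (Λ.s R t))) := by
  rw [← sum_inc_octahedron isRB_R (by decide) (by decide) gG,
    ← sum_inc_octahedron isRB_R (by decide) (by decide) gY,
    ← sum_interior_of_boundary _ gG hG, ← sum_interior_of_boundary _ gY hY, bdQ, sum_filter,
    Fintype.sum_sum_type, sum_filter, sum_filter]
  rfl

/-- An error that meets evenly all `B` vertices, including those on the boundary, belongs to the
gauge group. -/
theorem inGauge_of_even (x : Λ.CQ)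
    (hx : ∀ v : Λ.Cell {B}, ∑ q : Λ.Cell {G, Y} with Inc v q, extendQ x q = 0) : InGauge x := by
  obtain ⟨t₀, ht₀⟩ := Λ.exists_removed_eq
  -- The `BG` edges that `x` meets oddly form a cycle by themselves. So some `y` agrees with `x` on
  -- all `BG` edges and is even on all `BY` edges; then `x + y` is a sum of `RG` edges, `y` is a sum
  -- of `RY` edges, and `x` is the sum of both.
  obtain ⟨y, hyG, hyY⟩ := exists_octahedra_of_cycle
    (fun e => ∑ q : Λ.Cell {G, Y} with Inc e q, extendQ x q) 0
    (fun v => by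
      rw [sum_inc_sum_octahedra isRB_B (by decide) (by decide) (by decide), hx]
      simp)
    (fun v => sum_inc_sum_octahedra_eq_zero isRB_B (by decide) (by decide) (by decide)
      (by decide) v _)
    (fun v => by simp)
  obtain ⟨γG, hγG⟩ := exists_edges_of_even (Or.inl ⟨rfl, rfl⟩) {B, G} {R, G} (by decide)
    (by decide) (fun q => extendQ x q + y q) (fun e => by
      rw [sum_add_distrib, hyG, zmod2_add_self])
  obtain ⟨γY, hγY⟩ := exists_edges_of_even (Or.inr ⟨rfl, rfl⟩) {B, Y} {R, Y} (by decide)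
    (by decide) y (fun e => (hyY e).symm)
  have h0 := extendQ_removed x
  set x₀ := γY (Λ.cell {R, Y} t₀) + γY (Λ.cell {R, Y} (Λ.s R t₀)) with hx₀
  set g := γG (Λ.cell {R, G} t₀) with hg
  set g' := γY (Λ.cell {R, Y} t₀) with hg'
  have h2 : ∀ a : ZMod 2, a + a = 0 := zmod2_add_self
  have hx₀' : γG (Λ.cell {R, G} t₀) + γG (Λ.cell {R, G} (Λ.s R t₀)) = x₀ := by
    rw [← hγG t₀, ← ht₀, h0, zero_add, ht₀, hγY t₀]
  set r := Λ.cell {R} (Λ.s R t₀) with hr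
  -- The coefficients are changed so as to vanish on boundary edges, where there are no generators.
  -- Adding a constant on all `RG` edges at a `G` vertex, on all `RY` edges at a `Y` vertex, or on
  -- all `RG` and `RY` edges at an `R` vertex changes no octahedron, each being hit twice.
  let gG : Λ.Cell {R, G} → ZMod 2 := fun e =>
    γG e + (if Inc (Λ.cell {G} t₀) e then g else 0) + if Inc r e then x₀ else 0
  let gY : Λ.Cell {R, Y} → ZMod 2 := fun e =>
    γY e + (if Inc (Λ.cell {Y} t₀) e then g' else 0) + if Inc r e then x₀ else 0
  have hgG : ∀ t, gG (Λ.cell {R, G} t) = γG (Λ.cell {R, G} t)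
      + (if Λ.cell {G} t = Λ.cell {G} t₀ then g else 0)
      + if Λ.cell {R} t = r then x₀ else 0 := by
    intro t
    simp only [gG, inc_cell_iff (C := {G}) (C' := {R, G}) (by decide),
      inc_cell_iff (C := {R}) (C' := {R, G}) (by decide)]
  have hgY : ∀ t, gY (Λ.cell {R, Y} t) = γY (Λ.cell {R, Y} t)
      + (if Λ.cell {Y} t = Λ.cell {Y} t₀ then g' else 0)
      + if Λ.cell {R} t = r then x₀ else 0 := by
    intro t
    simp only [gY, inc_cell_iff (C := {Y}) (C' := {R, Y}) (by decide),
      inc_cell_iff (C := {R}) (C' := {R, Y}) (by decide)]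
  have hsG : ∀ t, Λ.cell {G} (Λ.s R t) = Λ.cell {G} t := cell_s (by decide)
  have hsY : ∀ t, Λ.cell {Y} (Λ.s R t) = Λ.cell {Y} t := cell_s (by decide)
  have hbG : ∀ e, OnBoundary e → gG e = 0 := by
    intro e he
    rcases (onBoundary_iff isRB_R (by decide) ht₀).mp he with rfl | rfl
    · rw [hgG, if_pos rfl, if_neg (Λ.R_ne t₀).symm]
      linear_combination h2 g
    · rw [hgG, hsG, if_pos rfl, if_pos rfl]
      linear_combination hx₀' + h2 x₀
  have hbY : ∀ e, OnBoundary e → gY e = 0 := by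
    intro e he
    rcases (onBoundary_iff isRB_R (by decide) ht₀).mp he with rfl | rfl
    · rw [hgY, if_pos rfl, if_neg (Λ.R_ne t₀).symm]
      linear_combination h2 g'
    · rw [hgY, hsY, if_pos rfl, if_pos rfl]
      linear_combination h2 x₀ - hx₀
  refine ⟨Sum.elim (fun e => gG e.1) fun e => gY e.1, ?_⟩
  ext ⟨q, hq⟩
  obtain ⟨t, rfl⟩ := cell_surjective q
  rw [bdQ_elim gG gY hbG hbY, extendQ_coe x, hgG, hgG, hgY, hgY, hsG, hsY]
  have e1 := hγG t
  have e2 := hγY t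
  linear_combination e1 + e2 - h2 (y (Λ.cell {G, Y} t))
    - h2 (if Λ.cell {G} t = Λ.cell {G} t₀ then g else 0)
    - h2 (if Λ.cell {Y} t = Λ.cell {Y} t₀ then g' else 0)
    - h2 (if Λ.cell {R} t = r then x₀ else 0)
    - h2 (if Λ.cell {R} (Λ.s R t) = r then x₀ else 0)

end STCLattice

/-! ### Hamming weights and minimum-weight solutions -/

section Weights

open Finset
open scoped Classical

theorem weight_eq_card {A : Type} [Fintype A] (x : A → ZMod 2) :
    weight x = (univ.filter fun a => x a ≠ 0).card := by
  unfold weight hammingNorm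
  congr

theorem weight_add_le {A : Type} [Fintype A] (x y : A → ZMod 2) :
    weight (x + y) ≤ weight x + weight y := by
  simp only [weight_eq_card]
  refine (card_le_card fun a ha => ?_).trans (card_union_le _ _)
  simp only [mem_union, mem_filter, mem_univ, true_and, Pi.add_apply] at ha ⊢
  by_contra h
  push Not at h
  exact ha (by rw [h.1, h.2, add_zero])

/-- Half of a cycle lies outside every minimum-weight solution. -/
theorem weight_le_two_mul_card {A : Type} [Fintype A] {x y : A → ZMod 2}
    (h : weight x ≤ weight (x + y)) :
    weight y ≤ 2 * (univ.filter fun a => y a ≠ 0 ∧ x a = 0).card := by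
  simp only [weight_eq_card] at h ⊢
  have h1 : (univ.filter fun a => x a ≠ 0).card
      = (univ.filter fun a => x a ≠ 0 ∧ y a = 0).card
        + (univ.filter fun a => x a ≠ 0 ∧ y a ≠ 0).card := by
    rw [← card_filter_add_card_filter_not (s := univ.filter fun a => x a ≠ 0) fun a => y a = 0,
      filter_filter, filter_filter]
  have h2 : (univ.filter fun a => y a ≠ 0).card
      = (univ.filter fun a => y a ≠ 0 ∧ x a = 0).card
        + (univ.filter fun a => y a ≠ 0 ∧ x a ≠ 0).card := by
    rw [← card_filter_add_card_filter_not (s := univ.filter fun a => y a ≠ 0) fun a => x a = 0,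
      filter_filter, filter_filter]
  have h3 : (univ.filter fun a => (x + y) a ≠ 0).card
      ≤ (univ.filter fun a => x a ≠ 0 ∧ y a = 0).card
        + (univ.filter fun a => y a ≠ 0 ∧ x a = 0).card := by
    refine (card_le_card fun a ha => ?_).trans (card_union_le _ _)
    simp only [mem_union, mem_filter, mem_univ, true_and, Pi.add_apply] at ha ⊢
    rcases zmod2_cases (x a) with hx | hx <;> rcases zmod2_cases (y a) with hy | hy <;>
      rw [hx, hy] at ha ⊢ <;> revert ha <;> decide
  have h4 : (univ.filter fun a => x a ≠ 0 ∧ y a ≠ 0).card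
      = (univ.filter fun a => y a ≠ 0 ∧ x a ≠ 0).card := by
    simp only [and_comm]
  omega

/-- The restriction of a vector to a subset of the basis. -/
noncomputable def restrictTo {A : Type} (P : A → Prop) (x : A → ZMod 2) : A → ZMod 2 :=
  fun a => if P a then x a else 0

theorem weight_add_restrict {A : Type} [Fintype A] (P : A → Prop) (x : A → ZMod 2) :
    weight (x + restrictTo P x) + weight (restrictTo P x) = weight x := by
  rw [weight_eq_card x, ← card_filter_add_card_filter_not (s := univ.filter fun a => x a ≠ 0)
    fun a => ¬ P a, filter_filter, filter_filter, weight_eq_card, weight_eq_card]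
  congr 1 <;> refine congrArg card (Finset.ext fun a => ?_) <;>
    rw [mem_filter, mem_filter] <;>
    by_cases h : P a <;> simp [restrictTo, h, zmod2_add_self]

end Weights

/-! ### Clusters of measurement errors and residual errors -/

namespace STCLattice

open Finset
open scoped Classical
open ColoredTriangulation Color

variable {Λ : STCLattice}

/-! ### The union of the measurement graph and the qubit graph -/

/-- Incidence in the hypergraph obtained from the union of the measurement graph and the qubit
graph by removing the boundary vertices. -/
def ElemInc : Λ.Meas ⊕ Λ.Qubit → Λ.GaussVertex → Prop
  | .inl m, v => MeasInc m v
  | .inr q, .inl b => Inc b.1 q.1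
  | .inr _, .inr _ => False

/-- Adjacency of the hyperedges. -/
def ElemAdj (a b : Λ.Meas ⊕ Λ.Qubit) : Prop := a ≠ b ∧ ∃ v, ElemInc a v ∧ ElemInc b v

theorem card_elemInc (v : Λ.GaussVertex) :
    (univ.filter fun a : Λ.Meas ⊕ Λ.Qubit => ElemInc a v).card = Λ.degL v := by
  rw [card_filter, Fintype.sum_sum_type, ← card_filter, ← card_filter, ← Fintype.card_subtype,
    ← Fintype.card_subtype, ← Nat.card_eq_fintype_card, ← Nat.card_eq_fintype_card]
  rcases v with v | v
  · rfl
  · have : IsEmpty {q : Λ.Qubit // ElemInc (.inr q) (.inr v)} := ⟨fun q => q.2⟩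
    rw [Nat.card_of_isEmpty (α := {q : Λ.Qubit // ElemInc (.inr q) (.inr v)})]
    rfl

/-- Every edge of the two graphs has two endpoints; those on the boundary are lost, whence an
inequality. -/
theorem card_elemInc_le (a : Λ.Meas ⊕ Λ.Qubit) :
    (univ.filter fun v : Λ.GaussVertex => ElemInc a v).card ≤ 2 := by
  let F : Λ.GaussVertex → Λ.Cell {B} ⊕ Λ.Cell {G} ⊕ Λ.Cell {Y} :=
    Sum.map Subtype.val (Sum.map Subtype.val Subtype.val)
  have hF : Function.Injective F :=
    Subtype.val_injective.sumMap (Subtype.val_injective.sumMap Subtype.val_injective)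
  rw [← card_image_of_injective _ hF]
  suffices ∃ x y, ∀ v, ElemInc a v → F v = x ∨ F v = y by
    obtain ⟨x, y, h⟩ := this
    refine (card_le_card fun w hw => ?_).trans (card_le_two (a := x) (b := y))
    obtain ⟨v, hv, rfl⟩ := mem_image.mp hw
    simpa using h v (mem_filter.mp hv).2
  rcases a with (⟨e, he⟩ | ⟨e, he⟩) | ⟨q, hq⟩
  · obtain ⟨t, rfl⟩ := cell_surjective e
    refine ⟨.inl (Λ.cell {B} t), .inr (.inl (Λ.cell {G} t)), ?_⟩
    rintro (⟨b, hb⟩ | ⟨g, hg⟩ | y) h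
    · have h := (inc_cell_iff (by decide)).mp (inc_comm.mp h)
      exact Or.inl (congrArg Sum.inl h.symm)
    · have h := (inc_cell_iff (by decide)).mp (inc_comm.mp h)
      exact Or.inr (congrArg (Sum.inr ∘ Sum.inl) h.symm)
    · exact h.elim
  · obtain ⟨t, rfl⟩ := cell_surjective e
    refine ⟨.inl (Λ.cell {B} t), .inr (.inr (Λ.cell {Y} t)), ?_⟩
    rintro (⟨b, hb⟩ | g | ⟨y, hy⟩) h
    · have h := (inc_cell_iff (by decide)).mp (inc_comm.mp h)
      exact Or.inl (congrArg Sum.inl h.symm)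
    · exact h.elim
    · have h := (inc_cell_iff (by decide)).mp (inc_comm.mp h)
      exact Or.inr (congrArg (Sum.inr ∘ Sum.inr) h.symm)
  · obtain ⟨t, rfl⟩ := cell_surjective q
    refine ⟨.inl (Λ.cell {B} t), .inl (Λ.cell {B} (Λ.s B t)), ?_⟩
    rintro (⟨b, hb⟩ | v) h
    · exact ((inc_octahedron_iff isRB_B (by decide)).mp h).imp (congrArg Sum.inl)
        (congrArg Sum.inl)
    · exact h.elim

/-- At each of its at most two vertices, an element has at most `maxDegL - 1` others. -/
theorem card_elemAdj_le (h : 1 ≤ Λ.maxDegL) (a : Λ.Meas ⊕ Λ.Qubit)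
    (A : Finset (Λ.Meas ⊕ Λ.Qubit)) :
    ((A.filter fun b => ElemAdj a b).card : ℝ) ≤ 2 * ((Λ.maxDegL : ℝ) - 1) := by
  have hsub : (A.filter fun b => ElemAdj a b) ⊆
      (univ.filter fun v : Λ.GaussVertex => ElemInc a v).biUnion fun v =>
        (univ.filter fun b : Λ.Meas ⊕ Λ.Qubit => ElemInc b v).erase a := by
    intro b hb
    obtain ⟨-, hne, v, hv, hv'⟩ := mem_filter.mp hb
    simp only [mem_biUnion, mem_erase, mem_filter, mem_univ, true_and]
    exact ⟨v, hv, hne.symm, hv'⟩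
  have h1 := (card_le_card hsub).trans (card_biUnion_le_card_mul _ _ (Λ.maxDegL - 1) (by
    intro v hv
    rw [card_erase_of_mem (by simpa using hv), card_elemInc]
    exact Nat.sub_le_sub_right (le_sup (f := Λ.degL) (mem_univ v)) 1))
  have h2 := h1.trans (Nat.mul_le_mul_right _ (card_elemInc_le a))
  rw [show (Λ.maxDegL : ℝ) - 1 = ((Λ.maxDegL - 1 : ℕ) : ℝ) by rw [Nat.cast_sub h, Nat.cast_one]]
  exact_mod_cast h2

/-! ### Degrees -/

/-- Crossing the triangle opposite to `G` keeps the `B` and `R` vertices, while inside an octahedron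
every other tetrahedron differs in one of them; so the crossing leads to a second octahedron at `b`.
-/
theorem two_le_degQub (b : Λ.Stab) : 2 ≤ Λ.degQub b.1 := by
  obtain ⟨b, hb⟩ := b
  obtain ⟨t, rfl⟩ := cell_surjective b
  have hsB : Λ.cell {B} (Λ.s G t) = Λ.cell {B} t := cell_s (by decide) t
  have h1 : Inc (Λ.cell {B} t) (Λ.cell {G, Y} t) := inc_cell_self t
  have h2 : Inc (Λ.cell {B} t) (Λ.cell {G, Y} (Λ.s G t)) := hsB ▸ inc_cell_self (Λ.s G t)
  have hne : Λ.cell {G, Y} (Λ.s G t) ≠ Λ.cell {G, Y} t := by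
    intro h
    rcases (cell_GY_eq_iff isRB_B).mp h with h | h | h | h
    · exact Λ.s_ne G t h
    · refine Λ.R_ne t ?_
      rw [← h]
      exact cell_s (by decide) t
    · refine Λ.B_ne t ?_
      rw [← h]
      exact hsB
    · refine Λ.B_ne t ?_
      rw [← hsB, h]
      exact (cell_s (by decide) _).symm
  rw [degQub, Nat.card_eq_fintype_card]
  rw [← Nat.lt_iff_add_one_le, Fintype.one_lt_card_iff]
  exact ⟨⟨⟨_, ne_removed_of_inc hb h1⟩, h1⟩, ⟨⟨_, ne_removed_of_inc hb h2⟩, h2⟩, fun h =>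
    hne (congrArg (fun q => q.1.1) h).symm⟩

theorem two_le_maxDegQub (h : Nonempty Λ.Stab) : 2 ≤ Λ.maxDegQub :=
  h.elim fun b => (two_le_degQub b).trans
    (le_sup (f := fun b : Λ.Stab => Λ.degQub b.1) (mem_univ b))

theorem two_le_maxDegL (h : Nonempty Λ.Stab) : 2 ≤ Λ.maxDegL :=
  h.elim fun b => ((two_le_degQub b).trans (Nat.le_add_left _ _)).trans
    (le_sup (f := Λ.degL) (mem_univ (.inl b)))

/-! ### Clusters -/

/-- The restrictions of a measurement outcome and of an error to some connected components of their
union have the same syndromes as before or no syndromes, at every vertex. -/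
theorem exists_restrict_eq_mul (φ : Λ.CM) (M : Λ.CQ) (U : Finset (Λ.Meas ⊕ Λ.Qubit))
    (hU : ∀ u ∈ U, ∀ w : Λ.Meas ⊕ Λ.Qubit, Sum.elim φ M w ≠ 0 → w ∉ U → ¬ ElemAdj u w)
    (v : Λ.GaussVertex) :
    ∃ ε : ZMod 2, (∀ m, MeasInc m v → restrictTo (fun m => Sum.inl m ∈ U) φ m = ε * φ m) ∧
      ∀ q, ElemInc (.inr q) v → restrictTo (fun q => Sum.inr q ∈ U) M q = ε * M q := by
  by_cases h : ∃ u ∈ U, ElemInc u v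
  · obtain ⟨u, hu, huv⟩ := h
    have key : ∀ w : Λ.Meas ⊕ Λ.Qubit, ElemInc w v → w ∉ U → Sum.elim φ M w = 0 := by
      intro w hw hwU
      by_contra hne
      refine hU u hu w hne hwU ⟨?_, v, huv, hw⟩
      rintro rfl
      exact hwU hu
    refine ⟨1, fun m hm => ?_, fun q hq => ?_⟩
    · rw [restrictTo, one_mul]
      split_ifs with h
      · rfl
      · exact (key (.inl m) hm h).symm
    · rw [restrictTo, one_mul]
      split_ifs with h
      · rfl
      · exact (key (.inr q) hq h).symm
  · push Not at h
    refine ⟨0, fun m hm => ?_, fun q hq => ?_⟩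
    · rw [restrictTo, zero_mul]
      exact if_neg fun hm' => h (.inl m) hm' hm
    · rw [restrictTo, zero_mul]
      exact if_neg fun hq' => h (.inr q) hq' hq

theorem card_union_elems (φ : Λ.CM) (M : Λ.CQ) (U : Finset (Λ.Meas ⊕ Λ.Qubit))
    (hU : ∀ u ∈ U, Sum.elim φ M u ≠ 0) :
    U.card = weight (restrictTo (fun m => Sum.inl m ∈ U) φ)
      + weight (restrictTo (fun q => Sum.inr q ∈ U) M) := by
  rw [weight_eq_card, weight_eq_card, ← card_disjSum]
  congr 1
  ext (m | q)
  · rw [inl_mem_disjSum]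
    simp only [restrictTo, mem_filter, mem_univ, true_and, ne_eq, ite_eq_right_iff, not_forall]
    exact ⟨fun h => ⟨h, hU _ h⟩, fun ⟨h, _⟩ => h⟩
  · rw [inr_mem_disjSum]
    simp only [restrictTo, mem_filter, mem_univ, true_and, ne_eq, ite_eq_right_iff, not_forall]
    exact ⟨fun h => ⟨h, hU _ h⟩, fun ⟨h, _⟩ => h⟩

/-- The residual error of the decoder for the measurement error `μ`, on a code state without
errors. -/
noncomputable def Decoder.residual (D : Λ.Decoder) (μ : Λ.CM) : Λ.CQ :=
  D.recov (deltaS (μ + D.est (deltaR μ)))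

theorem Decoder.deltaR_add_est (D : Λ.Decoder) (μ : Λ.CM) :
    deltaR (μ + D.est (deltaR μ)) = 0 := by
  rw [deltaR_add, D.est_syndrome]
  exact funext fun v => zmod2_add_self _

/-- The decoder's guarantees on `recov` hold for achievable syndromes only; the Gauss law ensures
achievability. -/
theorem Decoder.exists_bdS (D : Λ.Decoder) (μ : Λ.CM) :
    ∃ x, deltaS (μ + D.est (deltaR μ)) = bdS x := by
  obtain ⟨x, hx⟩ := exists_deltaM_of_gauss _ (D.deltaR_add_est μ)
  exact ⟨x, by rw [hx, deltaS_deltaM]⟩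

theorem Decoder.bdS_residual (D : Λ.Decoder) (μ : Λ.CM) :
    bdS (D.residual μ) = deltaS (μ + D.est (deltaR μ)) := by
  obtain ⟨x, hx⟩ := D.exists_bdS μ
  rw [Decoder.residual, hx, D.recov_syndrome]

theorem Decoder.residual_min (D : Λ.Decoder) (μ : Λ.CM) (y : Λ.CQ)
    (hy : bdS y = deltaS (μ + D.est (deltaR μ))) : weight (D.residual μ) ≤ weight y := by
  rw [Decoder.residual, ← hy]
  exact D.recov_min y

/-- A residual error is caused by a cluster with many measurement errors. -/
theorem Decoder.exists_cluster (D : Λ.Decoder) {c : ℝ} (hc : 0 < c) (hconf : Λ.FluxConfinement c)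
    (μ : Λ.CM) (S : Finset Λ.Qubit) (hS : ∀ q ∈ S, D.residual μ q ≠ 0) :
    ∃ U : Finset (Λ.Meas ⊕ Λ.Qubit), S.map .inr ⊆ U ∧
      RootedAt ElemAdj (S.map .inr) (U \ S.map .inr) ∧
      (1 + c⁻¹) * S.card ≤ U.card ∧
      ∃ A : Finset Λ.Meas, A.map .inl ⊆ U ∧ (∀ m ∈ A, μ m ≠ 0) ∧
        (2 + 2 * c)⁻¹ * U.card ≤ A.card := by
  set μ' := D.est (deltaR μ) with hμ'
  set φ := μ + μ' with hφ
  set M := D.residual μ with hM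
  set X : Finset (Λ.Meas ⊕ Λ.Qubit) := univ.filter fun a => Sum.elim φ M a ≠ 0 with hX
  have hSX : S.map .inr ⊆ X := by
    intro a ha
    obtain ⟨q, hq, rfl⟩ := mem_map.mp ha
    simpa [hX] using hS q hq
  obtain ⟨U, hUX, hSU, hroot, hclosed⟩ := exists_rootedAt ElemAdj X (S.map .inr) hSX
  refine ⟨U, hSU, hroot, ?_⟩
  have hUne : ∀ u ∈ U, Sum.elim φ M u ≠ 0 := fun u hu => (mem_filter.mp (hUX hu)).2
  have hrestr := exists_restrict_eq_mul φ M U fun u hu w hw hwU =>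
    hclosed u hu w (by simpa [hX] using hw) hwU
  set φU := restrictTo (fun m => Sum.inl m ∈ U) φ with hφU
  set MU := restrictTo (fun q => Sum.inr q ∈ U) M with hMU
  have hRφ : deltaR φ = 0 := D.deltaR_add_est μ
  have hRU : deltaR φU = 0 := by
    ext v
    obtain ⟨ε, hε, -⟩ := hrestr v
    have h1 : deltaR φU v = ε * deltaR φ v := by
      rw [deltaR, deltaR, mul_sum]
      exact sum_congr rfl fun m hm => hε m (mem_filter.mp hm).2
    rw [h1, hRφ]
    simp
  have hSM : bdS M = deltaS φ := D.bdS_residual μ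
  have hSU' : bdS MU = deltaS φU := by
    ext v
    obtain ⟨ε, hε, hε'⟩ := hrestr (.inl v)
    have h1 : bdS MU v = ε * bdS M v := by
      rw [bdS, bdS, mul_sum]
      exact sum_congr rfl fun q hq => hε' q (mem_filter.mp hq).2
    have h2 : deltaS φU v = ε * deltaS φ v := by
      rw [deltaS, deltaS, mul_sum]
      exact sum_congr rfl fun e he => hε (.inl e) (inc_comm.mp (mem_filter.mp he).2)
    rw [h1, h2, hSM]
  obtain ⟨x, hx, hxc⟩ := hconf φU (isFlux_of_gauss _ hRU)
  -- Exchanging the part of `M` in `U` for `x` preserves the syndrome, so it cannot lower the weight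
  -- of the minimal `M`.
  have hMx : weight MU ≤ weight x := by
    have h1 := D.residual_min μ (M + MU + x) (by
      rw [bdS_add, bdS_add, hSU', hx, hSM]
      ext v
      simp only [Pi.add_apply]
      linear_combination zmod2_add_self (deltaS φU v))
    change weight M ≤ _ at h1
    have h2 := weight_add_le (M + MU) x
    have h3 : weight (M + MU) + weight MU = weight M := weight_add_restrict _ M
    omega
  have hSMU : S.card ≤ weight MU := by
    rw [weight_eq_card]
    refine card_le_card fun q hq => ?_
    have : (.inr q : Λ.Meas ⊕ Λ.Qubit) ∈ U := hSU (mem_map_of_mem _ hq)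
    simp only [mem_filter, mem_univ, true_and, hMU, restrictTo, if_pos this]
    exact hS q hq
  have hcard : (U.card : ℝ) = weight φU + weight MU := by
    exact_mod_cast card_union_elems φ M U hUne
  have hMφ : (weight MU : ℝ) ≤ c * weight φU :=
    (Nat.cast_le.mpr hMx).trans hxc
  have hSMU' : (S.card : ℝ) ≤ weight MU := by exact_mod_cast hSMU
  constructor
  · have h1 : c⁻¹ * weight MU ≤ weight φU := by
      rw [inv_mul_le_iff₀ hc]; exact hMφ
    have h2 : c⁻¹ * S.card ≤ c⁻¹ * weight MU := by gcongr
    rw [hcard]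
    linarith
  -- Where the estimate `μ'` vanishes, `φ` is the true error `μ`. Adding `φU` to `μ'` keeps its
  -- relation syndrome, so minimality leaves at least half of `φU` there; and `|U| ≤ (1 + c) |φU|`.
  · refine ⟨univ.filter fun m => φU m ≠ 0 ∧ μ' m = 0, ?_, ?_, ?_⟩
    · intro a ha
      obtain ⟨m, hm, rfl⟩ := mem_map.mp ha
      have h1 := (mem_filter.mp hm).2.1
      by_contra h2
      exact h1 (if_neg h2)
    · intro m hm
      obtain ⟨-, h1, h2⟩ := mem_filter.mp hm
      intro h3
      have : φ m = 0 := by rw [hφ, Pi.add_apply, h2, h3, add_zero]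
      apply h1
      simp [hφU, restrictTo, this]
    · have h1 := weight_le_two_mul_card (x := μ') (y := φU) (by
        have h2 : deltaR μ = deltaR (μ' + φU) := by
          rw [deltaR_add, hRU, add_zero, hμ', D.est_syndrome]
        conv_lhs => rw [hμ', h2]
        exact D.est_min _)
      have h1' : (weight φU : ℝ) ≤ 2 * (univ.filter fun m => φU m ≠ 0 ∧ μ' m = 0).card := by
        exact_mod_cast h1
      rw [inv_mul_le_iff₀ (by positivity), hcard]
      nlinarith

end STCLattice

/-! ### Boundedness of the residual error -/

namespace STCLattice

open Finset
open scoped Classical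
open ColoredTriangulation Color

variable {Λ : STCLattice}

theorem one_le_maxDegL_sub_one (h : 2 ≤ Λ.maxDegL) : (1 : ℝ) ≤ (Λ.maxDegL : ℝ) - 1 := by
  have : (2 : ℝ) ≤ Λ.maxDegL := by exact_mod_cast h
  linarith

/-- The first smallness condition bounds the activity by `(e - 1) / e`. Having base at most one, for
the activity and for `η`, is what turns lower bounds on cluster sizes and error counts into upper
bounds on powers. -/
theorem SmallEnough.activity_le {c η τ : ℝ} (hc : 0 < c) (hd : 2 ≤ Λ.maxDegL) (hη : 0 ≤ η)
    (h : Λ.SmallEnough c η τ) :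
    η ≤ 1 ∧ 4 * Real.exp 1 * ((Λ.maxDegL : ℝ) - 1) * η ^ (2 + 2 * c)⁻¹ ≤ 1 := by
  have hd1 := one_le_maxDegL_sub_one hd
  set d := (Λ.maxDegL : ℝ) - 1
  set r := (2 + 2 * c)⁻¹ with hr
  have hr0 : 0 < r := by positivity
  have he : 1 < Real.exp 1 := Real.one_lt_exp_iff.mpr one_pos
  have h1 : η < (Real.exp 1 - 1) ^ (1 / r) * (4 * Real.exp 1 ^ 2 * d) ^ (-(1 / r)) := h.1
  have h2 : η ^ r ≤ (Real.exp 1 - 1) / (4 * Real.exp 1 ^ 2 * d) := by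
    calc η ^ r ≤ ((Real.exp 1 - 1) ^ (1 / r) * (4 * Real.exp 1 ^ 2 * d) ^ (-(1 / r))) ^ r :=
          Real.rpow_le_rpow hη h1.le hr0.le
      _ = _ := by
          have he0 : 0 ≤ Real.exp 1 - 1 := by linarith
          rw [Real.mul_rpow (by positivity) (by positivity), ← Real.rpow_mul he0,
            ← Real.rpow_mul (by positivity), neg_mul, one_div, inv_mul_cancel₀ hr0.ne',
            Real.rpow_one, Real.rpow_neg_one, div_eq_mul_inv]
  have h3 : 4 * Real.exp 1 * d * η ^ r ≤ 1 := by
    calc 4 * Real.exp 1 * d * η ^ r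
        ≤ 4 * Real.exp 1 * d * ((Real.exp 1 - 1) / (4 * Real.exp 1 ^ 2 * d)) := by gcongr
      _ = (Real.exp 1 - 1) / Real.exp 1 := by field_simp
      _ ≤ 1 := by
          rw [div_le_one (by positivity)]
          linarith
  refine ⟨?_, h3⟩
  by_contra hlt
  push Not at hlt
  have h4 : 1 < η ^ r := Real.one_lt_rpow hlt hr0
  have h5 : 1 < 4 * Real.exp 1 * d * η ^ r := by
    nlinarith [mul_le_mul he.le hd1 (by norm_num) (by linarith)]
  linarith

theorem tauRes_eq {c η : ℝ} (hd : 2 ≤ Λ.maxDegL) (hη : 0 ≤ η) :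
    Λ.tauRes c η = (4 * Real.exp 1 * ((Λ.maxDegL : ℝ) - 1) * η ^ (2 + 2 * c)⁻¹) ^ (1 + c⁻¹)
      / (2 * ((Λ.maxDegL : ℝ) - 1)) := by
  have hd1 := one_le_maxDegL_sub_one hd
  rw [tauRes]
  set d := (Λ.maxDegL : ℝ) - 1
  set t := 1 + c⁻¹
  set w := η ^ (2 + 2 * c)⁻¹
  have hw : 0 ≤ w := Real.rpow_nonneg hη _
  have h4 : (2 : ℝ) ^ (2 * t - 1) = 4 ^ t / 2 := by
    rw [Real.rpow_sub two_pos, Real.rpow_mul two_pos.le, Real.rpow_one]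
    norm_num
  rw [show 4 * Real.exp 1 * d * w = 4 * (Real.exp 1 * w) * d by ring,
    Real.mul_rpow (x := 4 * (Real.exp 1 * w)) (by positivity) (by positivity),
    Real.mul_rpow (x := 4) (by positivity) (by positivity), h4,
    Real.rpow_sub (by positivity), Real.rpow_one]
  field_simp

theorem tauRes_nonneg {c η : ℝ} (hd : 2 ≤ Λ.maxDegL) (hη : 0 ≤ η) : 0 ≤ Λ.tauRes c η := by
  have hd1 := one_le_maxDegL_sub_one hd
  rw [tauRes_eq hd hη]
  have := Real.rpow_nonneg hη (2 + 2 * c)⁻¹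
  positivity

/-- The total weight of the clusters with at least `t * |S|` elements whose components meet `S`. -/
theorem sum_clusters_le {V : Type} [Fintype V] [DecidableEq V] (adj : V → V → Prop) (S : Finset V)
    {d w t : ℝ} (hd : 1 ≤ d) (hw : 0 ≤ w) (ht : 0 ≤ t) (ha1 : 4 * Real.exp 1 * d * w ≤ 1)
    (hdeg : ∀ s : V, ∀ A : Finset V, ((A.filter fun b => adj s b).card : ℝ) ≤ 2 * d) :
    ∑ U ∈ (univ \ S).powerset.filter (fun U => RootedAt adj S U) with
        t * S.card ≤ (S.card + U.card : ℕ), (2 * w) ^ (S.card + U.card)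
      ≤ ((4 * Real.exp 1 * d * w) ^ t / (2 * d)) ^ S.card := by
  set W := (univ \ S).powerset.filter (fun U => RootedAt adj S U) with hW
  set a := 4 * Real.exp 1 * d * w with ha
  have ha0 : 0 ≤ a := by positivity
  set b := S.card
  -- This is the critical activity of `sum_rootedAt_le` for degree `2 d`. From `2 w = a y`, the
  -- surplus `a ≤ 1` pays for the size of the cluster and `y` for the sum over its shapes.
  set y := (Real.exp 1 * (2 * d))⁻¹ with hy
  have hy0 : 0 ≤ y := by positivity
  have hab := Real.rpow_nonneg ha0 (t * b)
  calc _ ≤ ∑ U ∈ W with t * b ≤ (b + U.card : ℕ), a ^ (t * b) * y ^ b * y ^ U.card := by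
        refine sum_le_sum fun U hU => ?_
        have hn := (mem_filter.mp hU).2
        have h1 : 2 * w = a * y := by
          rw [ha, hy]
          field_simp
          ring
        rw [h1, mul_pow, pow_add y, ← mul_assoc]
        gcongr
        rw [← Real.rpow_natCast a]
        exact Real.rpow_le_rpow_of_exponent_ge' ha0 ha1 (by positivity) hn
    _ ≤ ∑ U ∈ W, a ^ (t * b) * y ^ b * y ^ U.card :=
        sum_le_sum_of_subset_of_nonneg (filter_subset _ _) fun _ _ _ => by positivity
    _ ≤ a ^ (t * b) * y ^ b * Real.exp 1 ^ b := by
        rw [← mul_sum]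
        refine mul_le_mul_of_nonneg_left ?_ (by positivity)
        refine sum_rootedAt_le adj (z := 2 * d) hy0 ?_ (fun s A _ => hdeg s A) S _ disjoint_sdiff
        rw [hy]
        apply le_of_eq
        field_simp
    _ = (a ^ t / (2 * d)) ^ b := by
        rw [mul_assoc, ← mul_pow, Real.rpow_mul_natCast ha0, ← mul_pow]
        congr 1
        rw [hy]
        field_simp

/-- The union bound over the clusters `S ∪ U` and the measurement errors `A` in them. -/
theorem sum_sum_pow_le {M Q : Type} [Fintype M] [Fintype Q] [DecidableEq M] [DecidableEq Q]
    (S : Finset (M ⊕ Q)) (W : Finset (Finset (M ⊕ Q))) (hW : ∀ U ∈ W, U ⊆ univ \ S)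
    {η r : ℝ} (hr : 0 ≤ r) (hη : 0 ≤ η) (hη1 : η ≤ 1) :
    ∑ i ∈ W.sigma fun U => (univ.filter fun A : Finset M => A.map .inl ⊆ S ∪ U ∧
        r * (S.card + U.card : ℕ) ≤ A.card), η ^ i.2.card
      ≤ ∑ U ∈ W, (2 * η ^ r) ^ (S.card + U.card) := by
  have hηr : 0 ≤ η ^ r := Real.rpow_nonneg hη r
  have hcount : ∀ U ∈ W, (univ.filter fun A : Finset M => A.map .inl ⊆ S ∪ U ∧
      r * (S.card + U.card : ℕ) ≤ A.card).card ≤ 2 ^ (S.card + U.card) := by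
    intro U hU
    have hdisj : Disjoint S U :=
      (disjoint_sdiff (s := S) (t := univ)).mono_right (hW U hU)
    rw [← card_union_of_disjoint hdisj, ← card_powerset]
    refine card_le_card_of_injOn (fun A => A.map .inl) ?_ ?_
    · intro A hA
      exact mem_powerset.mpr (mem_filter.mp hA).2.1
    · intro A _ A' _ h
      exact map_injective _ h
  rw [sum_sigma]
  refine sum_le_sum fun U hU => ?_
  calc _ ≤ ∑ A ∈ univ.filter fun A : Finset M => A.map .inl ⊆ S ∪ U ∧
        r * (S.card + U.card : ℕ) ≤ A.card, (η ^ r) ^ (S.card + U.card) := by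
        refine sum_le_sum fun A hA => ?_
        rw [← Real.rpow_natCast η, ← Real.rpow_mul_natCast hη]
        exact Real.rpow_le_rpow_of_exponent_ge' hη hη1 (by positivity) (mem_filter.mp hA).2.2
    _ ≤ (2 * η ^ r) ^ (S.card + U.card) := by
        rw [sum_const, nsmul_eq_mul, mul_pow]
        gcongr
        exact_mod_cast hcount U hU

/-- The residual errors caused by bounded measurement errors are bounded. -/
theorem Decoder.isBounded_law_residual (D : Λ.Decoder) {c η τ : ℝ} (hc : 0 < c)
    (hconf : Λ.FluxConfinement c) (hd : 2 ≤ Λ.maxDegL) (hη : 0 ≤ η) (hs : Λ.SmallEnough c η τ)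
    {p : Λ.CM → ℝ} (hp : IsDist p) (hpη : IsBounded η p) :
    IsBounded (Λ.tauRes c η) (law p D.residual) := by
  rw [isBounded_iff]
  intro S₀
  obtain ⟨hη1, ha1⟩ := hs.activity_le hc hd hη
  rw [sum_law, tauRes_eq hd hη]
  set S : Finset (Λ.Meas ⊕ Λ.Qubit) := S₀.map .inr with hS
  have hSb : S.card = S₀.card := card_map _
  rw [← hSb]
  refine le_trans ?_ (sum_clusters_le ElemAdj S (one_le_maxDegL_sub_one hd)
    (Real.rpow_nonneg hη _) (by positivity) ha1 (card_elemAdj_le (by omega)))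
  refine le_trans ?_ (sum_sum_pow_le S _ (fun U hU =>
    mem_powerset.mp (mem_filter.mp (mem_filter.mp hU).1).1)
    (by positivity) hη hη1)
  refine hpη.sum_filter_le hp _
    (fun i : (_ : Finset (Λ.Meas ⊕ Λ.Qubit)) × Finset Λ.Meas => i.2) fun μ hμ => ?_
  obtain ⟨U, hSU, hroot, hcard, A, hAU, hAμ, hA⟩ := D.exists_cluster hc hconf μ S₀ hμ
  have hUc : S.card + (U \ S).card = U.card := by
    rw [add_comm, card_sdiff_add_card_eq_card hSU]
  rw [← hSb] at hcard
  refine ⟨⟨U \ S, A⟩, ?_, hAμ⟩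
  rw [mem_sigma, mem_filter, mem_filter, mem_filter, mem_powerset]
  simp only [hUc]
  exact ⟨⟨⟨sdiff_subset_sdiff (subset_univ _) Subset.rfl, hroot⟩, hcard⟩, mem_univ _,
    fun a ha => by by_cases h : a ∈ S <;> simp [h, hAU ha], hA⟩

end STCLattice

/-! ### Non-backtracking walks in multigraphs -/

section Paths

open Finset
open scoped Classical

variable {V E : Type}

/-- Every edge of a multigraph has two different endpoints. -/
def IsMultigraph (inc : V → E → Prop) : Prop :=
  ∀ e, ∃ a b, a ≠ b ∧ ∀ v, inc v e ↔ v = a ∨ v = b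

/-- The incidence hypothesis sits inside the existential so that `other` becomes a total function.
-/
theorem IsMultigraph.exists_other {inc : V → E → Prop} (h : IsMultigraph inc) (v : V) (e : E) :
    ∃ v', inc v e → (inc v' e ∧ ∀ u, inc u e → u ≠ v → u = v') := by
  obtain ⟨a, b, hab, hv⟩ := h e
  by_cases hva : v = a
  · refine ⟨b, fun _ => ⟨(hv b).mpr (Or.inr rfl), fun u hu huv => ?_⟩⟩
    rcases (hv u).mp hu with rfl | rfl
    · exact absurd hva.symm huv
    · rfl
  · refine ⟨a, fun hve => ⟨(hv a).mpr (Or.inl rfl), fun u hu huv => ?_⟩⟩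
    rcases (hv u).mp hu with rfl | rfl
    · rfl
    · rcases (hv v).mp hve with rfl | rfl
      · exact absurd rfl hva
      · exact absurd rfl huv

/-- The endpoint of `e` other than `v`. -/
noncomputable def IsMultigraph.other {inc : V → E → Prop} (h : IsMultigraph inc) (v : V) (e : E) :
    V := (h.exists_other v e).choose

theorem IsMultigraph.inc_other {inc : V → E → Prop} (h : IsMultigraph inc) {v : V} {e : E}
    (hv : inc v e) : inc (h.other v e) e := ((h.exists_other v e).choose_spec hv).1

theorem IsMultigraph.eq_other {inc : V → E → Prop} (h : IsMultigraph inc) {v u : V} {e : E}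
    (hv : inc v e) (hu : inc u e) (huv : u ≠ v) : h.other v e = u :=
  (((h.exists_other v e).choose_spec hv).2 u hu huv).symm

variable [Fintype E]

/-- The edge sets of the non-backtracking walks with `n` edges that start at `v` with an edge other
than `e` and leave only vertices in `I`. -/
noncomputable def IsMultigraph.walks {inc : V → E → Prop} (h : IsMultigraph inc) (I : V → Prop) :
    ℕ → V → E → Finset (Finset E)
  | 0, _, _ => {∅}
  | n + 1, v, e => if I v then
      ((univ.filter fun e' => inc v e').erase e).biUnion fun e' =>
        (h.walks I n (h.other v e') e').image (insert e')
    else ∅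

/-- At each vertex the edge of arrival is excluded, which leaves at most `Δ - 1` choices. -/
theorem IsMultigraph.card_walks_le {inc : V → E → Prop} (h : IsMultigraph inc) {I : V → Prop}
    {Δ : ℕ} (hI : ∀ v, I v → (univ.filter fun e => inc v e).card ≤ Δ) (n : ℕ) (v : V) (e : E)
    (hv : inc v e) : (h.walks I n v e).card ≤ (Δ - 1) ^ n := by
  induction n generalizing v e with
  | zero => simp [walks]
  | succ n ih =>
    rw [walks]
    split_ifs with hvI
    · rw [pow_succ']
      refine (card_biUnion_le_card_mul _ _ ((Δ - 1) ^ n) fun e' he' => ?_).trans ?_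
      · refine card_image_le.trans (ih _ _ (h.inc_other ?_))
        exact (mem_filter.mp (mem_of_mem_erase he')).2
      · refine Nat.mul_le_mul_right _ ?_
        rw [card_erase_of_mem (by simpa using hv)]
        exact Nat.sub_le_sub_right (hI v hvI) 1
    · simp

/-- The edge sets of the non-backtracking walks with `n + 1` edges that start at `b`. -/
noncomputable def IsMultigraph.walksFrom {inc : V → E → Prop} (h : IsMultigraph inc) (I : V → Prop)
    (b : V) (n : ℕ) : Finset (Finset E) :=
  (univ.filter fun e => inc b e).biUnion fun e => (h.walks I n (h.other b e) e).image (insert e)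

theorem IsMultigraph.card_walksFrom_le {inc : V → E → Prop} (h : IsMultigraph inc) {I : V → Prop}
    {Δ : ℕ} (hI : ∀ v, I v → (univ.filter fun e => inc v e).card ≤ Δ) (b : V) (n : ℕ) :
    (h.walksFrom I b n).card ≤ (univ.filter fun e => inc b e).card * (Δ - 1) ^ n :=
  card_biUnion_le_card_mul _ _ _ fun _ he => card_image_le.trans
    (h.card_walks_le hI n _ _ (h.inc_other (mem_filter.mp he).2))

/-- The graph formed by the edges in `w`. -/
def supportGraph (inc : V → E → Prop) (w : E → ZMod 2) : SimpleGraph V where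
  Adj v v' := v ≠ v' ∧ ∃ e, w e ≠ 0 ∧ inc v e ∧ inc v' e
  symm := ⟨fun _ _ h => ⟨h.1.symm, h.2.imp fun _ he => ⟨he.1, he.2.2, he.2.1⟩⟩⟩
  loopless := ⟨fun _ h => h.1 rfl⟩

/-- A set of edges with exactly two odd vertices connects them. -/
theorem IsMultigraph.reachable [Fintype V] {inc : V → E → Prop} (h : IsMultigraph inc) {w : E → ZMod 2}
    {b b' : V} (hb : ∑ e with inc b e, w e ≠ 0)
    (hw : ∀ v, v ≠ b → v ≠ b' → ∑ e with inc v e, w e = 0) :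
    (supportGraph inc w).Reachable b b' := by
  by_contra hcon
  -- Handshake argument: if `b'` is not in the component of `b`, then `b` is its only odd vertex,
  -- but every edge of `w` has both or neither of its ends there.
  have h1 : ∑ v with (supportGraph inc w).Reachable b v, ∑ e with inc v e, w e
      = ∑ e with inc b e, w e := by
    refine sum_eq_single_of_mem b (by simp) fun v hv hvb => hw v hvb ?_
    rintro rfl
    exact hcon (mem_filter.mp hv).2
  rw [← h1] at hb
  apply hb
  simp only [sum_filter (fun e => inc _ e)]
  rw [sum_comm]
  refine sum_eq_zero fun e _ => ?_
  obtain ⟨a, a', haa, ha⟩ := h e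
  by_cases hwe : w e = 0
  · simp [hwe]
  have hiff : (supportGraph inc w).Reachable b a ↔ (supportGraph inc w).Reachable b a' := by
    have hadj : (supportGraph inc w).Adj a a' :=
      ⟨haa, e, hwe, (ha a).mpr (Or.inl rfl), (ha a').mpr (Or.inr rfl)⟩
    exact ⟨fun h => h.trans hadj.reachable, fun h => h.trans hadj.symm.reachable⟩
  rw [← sum_filter, filter_filter]
  by_cases hr : (supportGraph inc w).Reachable b a
  · rw [show (univ.filter fun v => (supportGraph inc w).Reachable b v ∧ inc v e) = {a, a'} from ?_,
      sum_pair haa, zmod2_add_self]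
    ext v
    simp only [mem_filter, mem_univ, true_and, ha, mem_insert, mem_singleton]
    refine ⟨fun h => h.2, ?_⟩
    rintro (rfl | rfl)
    · exact ⟨hr, Or.inl rfl⟩
    · exact ⟨hiff.mp hr, Or.inr rfl⟩
  · refine sum_eq_zero fun v hv => ?_
    obtain ⟨-, hv1, hv2⟩ := mem_filter.mp hv
    rcases (ha v).mp hv2 with rfl | rfl
    · exact absurd hv1 hr
    · exact absurd (hiff.mpr hv1) hr

/-- The number modulo 2 of edges of `P` at `x`. -/
theorem IsMultigraph.sum_insert {inc : V → E → Prop} (h : IsMultigraph inc) {P : Finset E}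
    {v v' b : V} {e : E} (he : e ∉ P) (hv : inc v e) (hv' : inc v' e) (hvv : v ≠ v') (x : V)
    (hP : ∑ e with inc x e, (if e ∈ P then (1 : ZMod 2) else 0)
      = (if x = v' then 1 else 0) + if x = b then 1 else 0) :
    ∑ e' with inc x e', (if e' ∈ insert e P then (1 : ZMod 2) else 0)
      = (if x = v then 1 else 0) + if x = b then 1 else 0 := by
  have h1 : ∀ e', (if e' ∈ insert e P then (1 : ZMod 2) else 0)
      = (if e' = e then 1 else 0) + if e' ∈ P then 1 else 0 := by
    intro e'
    by_cases h : e' = e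
    · subst h; simp [he]
    · simp [h]
  simp only [h1, sum_add_distrib, hP]
  have h2 : ∑ e' with inc x e', (if e' = e then (1 : ZMod 2) else 0)
      = (if x = v then 1 else 0) + if x = v' then 1 else 0 := by
    rw [sum_ite_eq']
    obtain ⟨a, a', haa, ha⟩ := h e
    simp only [mem_filter, mem_univ, true_and]
    by_cases hxv : x = v
    · subst hxv; simp [hv, hvv]
    · by_cases hxv' : x = v'
      · subst hxv'; simp [hv', hxv]
      · have : ¬ inc x e := by
          intro hx
          have := h.eq_other hv hx hxv
          exact hxv' (this ▸ (h.eq_other hv hv' hvv.symm).symm ▸ rfl)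
        simp [hxv, hxv', this]
  rw [h2]
  linear_combination zmod2_add_self (if x = v' then (1 : ZMod 2) else 0)

/-- The hypothesis on `e` forbids that the path starts with `e`. It is inherited by the tail, as the
starting point of a path does not recur. -/
theorem IsMultigraph.exists_mem_walks {inc : V → E → Prop} (h : IsMultigraph inc) {w : E → ZMod 2}
    {I : V → Prop} {v b : V} (p : (supportGraph inc w).Walk v b) (hp : p.IsPath)
    (hI : ∀ u ∈ p.support, u ≠ b → I u) (e : E) (he : ∃ u, inc u e ∧ u ∉ p.support) :
    ∃ P ∈ h.walks I p.length v e, (∀ e ∈ P, w e ≠ 0 ∧ ∀ u, inc u e → u ∈ p.support) ∧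
      P.card = p.length ∧ ∀ x, ∑ e with inc x e, (if e ∈ P then (1 : ZMod 2) else 0)
        = (if x = v then 1 else 0) + if x = b then 1 else 0 := by
  induction p generalizing e with
  | nil => exact ⟨∅, by simp [walks], by simp, by simp, fun x => by simp [zmod2_add_self]⟩
  | @cons v v' b hadj p ih =>
    rw [SimpleGraph.Walk.cons_isPath_iff] at hp
    have hadj' := hadj
    obtain ⟨hvv, e', hwe', hve', hve''⟩ := hadj'
    obtain ⟨P, hP, hPw, hPc, hPb⟩ := ih hp.1
      (fun u hu => hI u (by simp [hu])) e' ⟨v, hve', hp.2⟩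
    have hsupp : ∀ u, inc u e' → u = v ∨ u = v' := by
      intro u hu
      by_cases huv : u = v
      · exact Or.inl huv
      · exact Or.inr ((h.eq_other hve' hu huv).symm.trans (h.eq_other hve' hve'' hvv.symm))
    have he'P : e' ∉ P := fun h => hp.2 ((hPw e' h).2 v hve')
    have hvb : v ≠ b := by
      rintro rfl
      exact hp.2 p.end_mem_support
    refine ⟨insert e' P, ?_, ?_, ?_, fun x => h.sum_insert he'P hve' hve'' hvv x (hPb x)⟩
    · rw [SimpleGraph.Walk.length_cons, walks, if_pos (hI v (by simp) hvb)]
      rw [mem_biUnion]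
      refine ⟨e', ?_, mem_image_of_mem _ ?_⟩
      · rw [mem_erase]
        refine ⟨?_, by simpa using hve'⟩
        rintro rfl
        obtain ⟨u, hu, hup⟩ := he
        rcases hsupp u hu with rfl | rfl
        · simp at hup
        · simp at hup
      · rw [h.eq_other hve' hve'' hvv.symm]
        exact hP
    · intro e₁ he₁
      rcases mem_insert.mp he₁ with rfl | he₁
      · refine ⟨hwe', fun u hu => ?_⟩
        rcases hsupp u hu with rfl | rfl
        · simp
        · simp
      · refine ⟨(hPw e₁ he₁).1, fun u hu => ?_⟩
        simp [(hPw e₁ he₁).2 u hu]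
    · rw [card_insert_of_notMem he'P, hPc, SimpleGraph.Walk.length_cons]

/-- A set of edges with exactly two odd vertices contains a path between them. -/
theorem IsMultigraph.exists_path [Fintype V] {inc : V → E → Prop} (h : IsMultigraph inc) {w : E → ZMod 2}
    {b b' : V} (hbb : b ≠ b') (hb : ∑ e with inc b e, w e ≠ 0)
    (hw : ∀ v, v ≠ b → v ≠ b' → ∑ e with inc v e, w e = 0) :
    ∃ n < Fintype.card V, ∃ P ∈ h.walksFrom (fun v => v ≠ b ∧ v ≠ b') b n,
      (∀ e ∈ P, w e ≠ 0) ∧ P.card = n + 1 ∧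
      (∃ p : (supportGraph inc w).Walk b b', p.length = n + 1) ∧
      ∀ x, x ≠ b → x ≠ b' → ∑ e with inc x e, (if e ∈ P then (1 : ZMod 2) else 0) = 0 := by
  obtain ⟨p, hp⟩ := (h.reachable hb hw).exists_isPath
  cases p with
  | nil => exact absurd rfl hbb
  | @cons _ v' _ hadj p =>
    have hlen := hp.length_lt
    have hp' := (SimpleGraph.Walk.cons_isPath_iff _ _).mp hp
    have hadj' := hadj
    obtain ⟨hvv, e', hwe', hve', hve''⟩ := hadj'
    obtain ⟨P, hP, hPw, hPc, hPb⟩ := h.exists_mem_walks (I := fun v => v ≠ b ∧ v ≠ b') p hp'.1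
      (fun u hu hub => ⟨fun hub' => hp'.2 (hub' ▸ hu), hub⟩) e' ⟨b, hve', hp'.2⟩
    have he'P : e' ∉ P := fun h => hp'.2 ((hPw e' h).2 b hve')
    rw [SimpleGraph.Walk.length_cons] at hlen
    refine ⟨p.length, by omega, insert e' P, ?_, ?_, ?_, ⟨.cons hadj p, by simp⟩, ?_⟩
    · rw [walksFrom, mem_biUnion]
      refine ⟨e', by simpa using hve', mem_image_of_mem _ ?_⟩
      rw [h.eq_other hve' hve'' hvv.symm]
      exact hP
    · intro e₁ he₁
      rcases mem_insert.mp he₁ with rfl | he₁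
      · exact hwe'
      · exact (hPw e₁ he₁).1
    · rw [card_insert_of_notMem he'P, hPc]
    · intro x hx hx'
      rw [h.sum_insert he'P hve' hve'' hvv x (hPb x), if_neg hx, if_neg hx', add_zero]

end Paths

/-! ### Failure probability of the ideal decoder -/

namespace STCLattice

open Finset
open scoped Classical
open ColoredTriangulation Color

variable {Λ : STCLattice}

variable (Λ) in
/-- The incidence of vertices and edges of the qubit graph. -/
def QubInc (v : Λ.Cell {B}) (q : Λ.Qubit) : Prop := Inc v q.1

variable (Λ) in
theorem isMultigraph_qubInc : IsMultigraph Λ.QubInc := by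
  rintro ⟨q, hq⟩
  obtain ⟨t, rfl⟩ := cell_surjective q
  exact ⟨_, _, (Λ.B_ne t).symm, fun v => inc_octahedron_iff isRB_B (by decide)⟩

theorem card_qubInc (v : Λ.Cell {B}) :
    (univ.filter fun q => Λ.QubInc v q).card = Λ.degQub v := by
  rw [← Fintype.card_subtype, ← Nat.card_eq_fintype_card]
  rfl

theorem sum_qubInc (x : Λ.CQ) (v : Λ.Cell {B}) :
    ∑ q with Λ.QubInc v q, x q = ∑ q : Λ.Cell {G, Y} with Inc v q, extendQ x q := by
  have h := sum_subtype_filter (P := fun q : Λ.Cell {G, Y} => q ≠ Λ.removed)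
    (Q := fun q => Inc v q ∧ q ≠ Λ.removed) (fun _ hq => hq.2) x (extendQ x) (extendQ_coe x)
  refine Eq.trans (sum_congr ?_ fun _ _ => rfl) (h.trans ?_)
  · ext q
    simp only [mem_filter, mem_univ, true_and]
    exact (and_iff_left q.2).symm
  · refine sum_subset (fun q hq => ?_) fun q hq hq' => ?_
    · simp only [mem_filter, mem_univ, true_and] at hq ⊢
      exact hq.1
    · simp only [mem_filter, mem_univ, true_and, not_and, not_not] at hq hq'
      rw [hq' hq, extendQ_removed]

/-- The boundary of the qubit graph consists of two vertices. -/
theorem sum_onBoundary {M : Type} [AddCommMonoid M] {t₀ : Λ.T}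
    (ht₀ : Λ.removed = Λ.cell {G, Y} t₀) (f : Λ.Cell {B} → M) :
    ∑ b : Λ.Cell {B} with OnBoundary b, f b
      = f (Λ.cell {B} t₀) + f (Λ.cell {B} (Λ.s B t₀)) := by
  rw [← sum_pair (Λ.B_ne t₀).symm]
  refine sum_congr ?_ fun _ _ => rfl
  ext v
  simp [onBoundary_iff isRB_B (C := {B}) (by decide) ht₀]

/-- An error without syndrome that is not in the gauge group connects the two boundary vertices. -/
theorem sum_qubInc_ne_zero {t₀ : Λ.T} (ht₀ : Λ.removed = Λ.cell {G, Y} t₀) {w : Λ.CQ}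
    (hw : bdS w = 0) (hg : ¬ InGauge w) (b : Λ.Cell {B}) (hb : OnBoundary b) :
    ∑ q with Λ.QubInc b q, w q ≠ 0 := by
  intro h0
  have hint : ∀ v : Λ.Cell {B}, ¬ OnBoundary v → ∑ q with Λ.QubInc v q, w q = 0 :=
    fun v hv => congrFun hw ⟨v, hv⟩
  -- By the handshake identity the two boundary vertices have equal parities; if one is even, then
  -- so are all vertices.
  have htot : ∑ v, ∑ q with Λ.QubInc v q, w q = 0 := by
    simp only [sum_filter]
    rw [sum_comm]
    refine sum_eq_zero fun q _ => ?_
    obtain ⟨a, a', haa, ha⟩ := Λ.isMultigraph_qubInc q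
    rw [← sum_filter, show (univ.filter fun v => Λ.QubInc v q) = {a, a'} by ext v; simp [ha],
      sum_pair haa, zmod2_add_self]
  have hbd : ∑ v : Λ.Cell {B} with OnBoundary v, ∑ q with Λ.QubInc v q, w q = 0 := by
    rw [← htot]
    refine sum_subset (subset_univ _) fun v _ hv => hint v (by simpa using hv)
  rw [sum_onBoundary ht₀] at hbd
  have hall : ∀ v, OnBoundary v → ∑ q with Λ.QubInc v q, w q = 0 := by
    have hiff := fun v : Λ.Cell {B} => onBoundary_iff (e := v) isRB_B (by decide) ht₀
    intro v hv
    rcases (hiff b).mp hb with rfl | rfl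
    · rw [h0, zero_add] at hbd
      rcases (hiff v).mp hv with rfl | rfl <;> assumption
    · rw [h0, add_zero] at hbd
      rcases (hiff v).mp hv with rfl | rfl <;> assumption
  refine hg (inGauge_of_even w fun v => ?_)
  rw [← sum_qubInc]
  by_cases hv : OnBoundary v
  · exact hall v hv
  · exact hint v hv

/-- The indicator vector of a set of qubits. -/
noncomputable def indicator (P : Finset Λ.Qubit) : Λ.CQ := fun q => if q ∈ P then 1 else 0

/-- A failure of the decoder is caused by errors on half of the edges of a path that connects the
two boundary vertices. -/
theorem Decoder.exists_path_of_fail (D : Λ.Decoder) {L : ℕ} (hL : Λ.BoundaryDistGE L)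
    {b b' : Λ.Cell {B}} (hb : OnBoundary b) (hb' : OnBoundary b') (hbb : b ≠ b')
    (hbd : ∀ v : Λ.Cell {B}, OnBoundary v → v = b ∨ v = b') (y : Λ.CQ)
    (hy : ¬ InGauge (D.recov (bdS y) + y)) :
    ∃ n < Fintype.card (Λ.Cell {B}), L ≤ n + 1 ∧
      ∃ P ∈ Λ.isMultigraph_qubInc.walksFrom (fun v => v ≠ b ∧ v ≠ b') b n,
        P.card = n + 1 ∧ ∃ A ⊆ P, n + 1 ≤ 2 * A.card ∧ ∀ q ∈ A, y q ≠ 0 := by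
  obtain ⟨t₀, ht₀⟩ := Λ.exists_removed_eq
  set x := D.recov (bdS y) with hx
  have hw0 : bdS (x + y) = 0 := by
    rw [bdS_add, hx, D.recov_syndrome]
    exact funext fun v => zmod2_add_self _
  have hint : ∀ v : Λ.Cell {B}, v ≠ b → v ≠ b' → ¬ OnBoundary v := fun v h h' hv =>
    (hbd v hv).elim h h'
  obtain ⟨n, hn, P, hP, hPw, hPc, ⟨p, hp⟩, hPb⟩ := Λ.isMultigraph_qubInc.exists_path hbb
    (sum_qubInc_ne_zero ht₀ hw0 hy b hb) fun v h h' => congrFun hw0 ⟨v, hint v h h'⟩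
  have hle : supportGraph Λ.QubInc (x + y) ≤ Λ.qubGraph := fun v v' h =>
    ⟨h.1, h.2.imp fun _ hq => hq.2⟩
  have hlen : L ≤ n + 1 := by
    have h1 := (hL b b' hb hb' hbb).trans ((p.mapLe hle).edist_le)
    rw [SimpleGraph.Walk.length_mapLe, hp] at h1
    exact_mod_cast h1
  have hind : bdS (indicator P) = 0 := by
    ext v
    refine (sum_congr rfl fun q _ => ?_).trans (hPb v.1 (fun h => v.2 (h ▸ hb)) (fun h => v.2 (h ▸ hb')))
    by_cases hq : q ∈ P <;> simp [indicator, hq]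
  -- The path is even at all interior vertices, so `x + P` is a competing recovery. Hence half of
  -- `P` avoids `x`, and lies in `y` because `P` lies in the support of `x + y`.
  have hmin : weight x ≤ weight (x + indicator P) := by
    have h1 : bdS (x + indicator P) = bdS y := by
      rw [bdS_add, hind, add_zero, hx, D.recov_syndrome]
    conv_lhs => rw [hx, ← h1]
    exact D.recov_min _
  have hcard := weight_le_two_mul_card hmin
  have hmem : ∀ q, indicator P q ≠ 0 ↔ q ∈ P := fun q => by simp [indicator]
  have hwP : weight (indicator P) = n + 1 := by
    rw [weight_eq_card, ← hPc]
    congr 1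
    ext q
    simp [hmem]
  refine ⟨n, hn, hlen, P, hP, hPc, univ.filter fun q => indicator P q ≠ 0 ∧ x q = 0, ?_, ?_, ?_⟩
  · intro q hq
    exact (hmem q).mp (mem_filter.mp hq).2.1
  · rw [← hwP]
    exact hcard
  · intro q hq
    obtain ⟨-, h1, h2⟩ := mem_filter.mp hq
    have h3 := hPw q ((hmem q).mp h1)
    rwa [Pi.add_apply, h2, zero_add] at h3

/-- The failure probability, estimated by a geometric series over the lengths of the paths. -/
theorem Decoder.fail_le_sum (D : Λ.Decoder) {L : ℕ} (hL : Λ.BoundaryDistGE L) {τ : ℝ}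
    (hτ : 0 ≤ τ) (hτ1 : τ ≤ 1) {p : Λ.CQ → ℝ} (hp : IsDist p) (hpτ : IsBounded τ p)
    {b b' : Λ.Cell {B}} (hb : OnBoundary b) (hb' : OnBoundary b') (hbb : b ≠ b')
    (hbd : ∀ v : Λ.Cell {B}, OnBoundary v → v = b ∨ v = b') :
    D.fail p ≤ ∑ n ∈ (range (Fintype.card (Λ.Cell {B}))).filter fun n => L ≤ n + 1,
      (Λ.degQub b * (Λ.maxDegQub - 1) ^ n : ℕ) * (2 * √τ) ^ (n + 1) := by
  set N := Fintype.card (Λ.Cell {B})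
  have hdeg : ∀ v : Λ.Cell {B}, v ≠ b ∧ v ≠ b' →
      (univ.filter fun q => Λ.QubInc v q).card ≤ Λ.maxDegQub := by
    intro v hv
    rw [card_qubInc]
    exact le_sup (f := fun v : Λ.Stab => Λ.degQub v.1)
      (mem_univ ⟨v, fun h => (hbd v h).elim hv.1 hv.2⟩)
  let J := ((range N).filter fun n => L ≤ n + 1).sigma fun n =>
    ((Λ.isMultigraph_qubInc.walksFrom (fun v => v ≠ b ∧ v ≠ b') b n).filter
      fun P => P.card = n + 1).sigma fun P => P.powerset.filter fun A => n + 1 ≤ 2 * A.card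
  have h1 : D.fail p ≤ ∑ i ∈ J, τ ^ i.2.2.card := by
    refine hpτ.sum_filter_le hp J
      (fun i : (_ : ℕ) × (_ : Finset Λ.Qubit) × Finset Λ.Qubit => i.2.2) fun y hy => ?_
    obtain ⟨n, hn, hLn, P, hP, hPc, A, hAP, hA, hAy⟩ :=
      D.exists_path_of_fail hL hb hb' hbb hbd y hy
    refine ⟨⟨n, P, A⟩, ?_, hAy⟩
    simp only [J, mem_sigma, mem_filter, mem_range, mem_powerset]
    exact ⟨⟨hn, hLn⟩, ⟨hP, hPc⟩, hAP, hA⟩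
  refine h1.trans ?_
  rw [sum_sigma]
  refine sum_le_sum fun n _ => ?_
  rw [sum_sigma]
  have hs1 : √τ ≤ 1 := Real.sqrt_le_one.mpr hτ1
  have h2 : ∀ P ∈ (Λ.isMultigraph_qubInc.walksFrom (fun v => v ≠ b ∧ v ≠ b') b n).filter
      (fun P => P.card = n + 1), ∑ A ∈ P.powerset.filter (fun A => n + 1 ≤ 2 * A.card), τ ^ A.card
        ≤ (2 * √τ) ^ (n + 1) := by
    intro P hP
    calc _ ≤ ∑ A ∈ P.powerset.filter (fun A => n + 1 ≤ 2 * A.card), √τ ^ (n + 1) := by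
          refine sum_le_sum fun A hA => ?_
          have h3 : τ ^ A.card = √τ ^ (2 * A.card) := by
            rw [pow_mul, Real.sq_sqrt hτ]
          rw [h3]
          exact pow_le_pow_of_le_one (Real.sqrt_nonneg τ) hs1 (mem_filter.mp hA).2
      _ ≤ ∑ A ∈ P.powerset, √τ ^ (n + 1) :=
          sum_le_sum_of_subset_of_nonneg (filter_subset _ _) fun _ _ _ => by positivity
      _ = (2 * √τ) ^ (n + 1) := by
          rw [sum_const, card_powerset, (mem_filter.mp hP).2, nsmul_eq_mul, mul_pow]
          push_cast
          rfl
  refine (sum_le_card_nsmul _ _ _ h2).trans ?_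
  rw [nsmul_eq_mul]
  refine mul_le_mul_of_nonneg_right ?_ (by positivity)
  have h3 := (card_filter_le _ (fun P => P.card = n + 1)).trans
    (Λ.isMultigraph_qubInc.card_walksFrom_le hdeg b n)
  rw [card_qubInc] at h3
  exact_mod_cast h3

theorem sqrt_tauStar (h : 2 ≤ Λ.maxDegQub) :
    √Λ.tauStar = (2 * ((Λ.maxDegQub : ℝ) - 1))⁻¹ := by
  have : (2 : ℝ) ≤ Λ.maxDegQub := by exact_mod_cast h
  rw [tauStar, ← inv_pow, Real.sqrt_sq]
  exact inv_nonneg.mpr (by linarith)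

theorem tauStar_pos (h : 2 ≤ Λ.maxDegQub) : 0 < Λ.tauStar := by
  have : (2 : ℝ) ≤ Λ.maxDegQub := by exact_mod_cast h
  rw [tauStar]
  have : 0 < (Λ.maxDegQub : ℝ) - 1 := by linarith
  positivity

/-- The failure probability of the ideal decoder for bounded errors. -/
theorem Decoder.fail_le_failBound (D : Λ.Decoder) {L : ℕ} (hL : Λ.BoundaryDistGE L) (hL1 : 1 ≤ L)
    (hΔ : 2 ≤ Λ.maxDegQub) {τ : ℝ} (hτ : 0 ≤ τ) (hττ : τ < Λ.tauStar) {p : Λ.CQ → ℝ}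
    (hp : IsDist p) (hpτ : IsBounded τ p) : D.fail p ≤ Λ.failBound L τ := by
  obtain ⟨t₀, ht₀⟩ := Λ.exists_removed_eq
  have hiff := fun v : Λ.Cell {B} => onBoundary_iff (e := v) isRB_B (by decide) ht₀
  -- Walks are started at the boundary vertex of smaller degree, at most half of `bdDegSum`; this
  -- absorbs the factor 2 in the terms below.
  obtain ⟨b, b', hbb, hb, hb', hbd, hdeg⟩ : ∃ b b' : Λ.Cell {B}, b ≠ b' ∧ OnBoundary b ∧
      OnBoundary b' ∧ (∀ v, OnBoundary v → v = b ∨ v = b') ∧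
      2 * Λ.degQub b ≤ Λ.bdDegSum := by
    have hsum : Λ.bdDegSum = _ := sum_onBoundary ht₀ Λ.degQub
    rcases le_total (Λ.degQub (Λ.cell {B} t₀)) (Λ.degQub (Λ.cell {B} (Λ.s B t₀))) with h | h
    · exact ⟨_, _, (Λ.B_ne t₀).symm, (hiff _).mpr (Or.inl rfl), (hiff _).mpr (Or.inr rfl),
        fun v => (hiff v).mp, by omega⟩
    · exact ⟨_, _, Λ.B_ne t₀, (hiff _).mpr (Or.inr rfl), (hiff _).mpr (Or.inl rfl),
        fun v hv => ((hiff v).mp hv).symm, by omega⟩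
  have hΔ' : (2 : ℝ) ≤ Λ.maxDegQub := by exact_mod_cast hΔ
  have hs := sqrt_tauStar hΔ
  have hpos := tauStar_pos hΔ
  set d := (Λ.maxDegQub : ℝ) - 1 with hd
  have hd1 : 1 ≤ d := by linarith
  set s := √Λ.tauStar with hsdef
  have hs0 : 0 < s := Real.sqrt_pos.mpr hpos
  have hss : Λ.tauStar = s ^ 2 := (Real.sq_sqrt hpos.le).symm
  have hlt : √τ < s := Real.sqrt_lt_sqrt hτ hττ
  have hτ1 : τ ≤ 1 := by
    refine hττ.le.trans ?_
    rw [tauStar, ← hd]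
    exact inv_le_one_of_one_le₀ (by nlinarith)
  set x := √τ / s with hx
  have hx0 : 0 ≤ x := by positivity
  have hx1 : x < 1 := (div_lt_one hs0).mpr hlt
  -- Here `x = 2 (maxDegQub - 1) √τ`. The first edge is counted by the degree of `b`, so one factor
  -- `maxDegQub - 1` is missing, which gives `2 s`.
  have hterm : ∀ n : ℕ, ((Λ.degQub b * (Λ.maxDegQub - 1) ^ n : ℕ) : ℝ) * (2 * √τ) ^ (n + 1)
      = Λ.degQub b * (2 * s) * x ^ (n + 1) := by
    intro n
    push_cast [Nat.cast_sub (show 1 ≤ Λ.maxDegQub by omega)]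
    rw [← hd, hx, hs, div_inv_eq_mul]
    rw [show √τ * (2 * d) = d * (2 * √τ) by ring, mul_pow d, pow_succ d]
    field_simp
  have hgeom : ∑ n ∈ (range (Fintype.card (Λ.Cell {B}))).filter (fun n => L ≤ n + 1), x ^ (n + 1)
      ≤ x ^ L * (1 - x)⁻¹ := by
    set N := Fintype.card (Λ.Cell {B})
    calc _ ≤ ∑ m ∈ Ico L (L + N), x ^ m := by
          rw [← sum_image (f := fun m => x ^ m) (g := fun n => n + 1)
            (fun a _ a' _ h => Nat.succ_injective h)]
          refine sum_le_sum_of_subset_of_nonneg ?_ fun _ _ _ => by positivity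
          intro m hm
          obtain ⟨n, hn, rfl⟩ := mem_image.mp hm
          obtain ⟨hn1, hn2⟩ := mem_filter.mp hn
          rw [mem_range] at hn1
          rw [mem_Ico]
          omega
      _ = x ^ L * ∑ m ∈ range N, x ^ m := by
          rw [sum_Ico_eq_sum_range, mul_sum]
          simp only [pow_add, Nat.add_sub_cancel_left]
      _ ≤ x ^ L * (1 - x)⁻¹ := by
          gcongr
          rw [← tsum_geometric_of_lt_one hx0 hx1]
          exact (summable_geometric_of_lt_one hx0 hx1).sum_le_tsum _ fun _ _ => by positivity
  have hxL : (τ / Λ.tauStar) ^ ((L : ℝ) / 2) = x ^ L := by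
    rw [hx, hsdef, ← Real.sqrt_div hτ, Real.sqrt_eq_rpow, ← Real.rpow_mul_natCast (by positivity)]
    congr 1
    ring
  refine (D.fail_le_sum hL hτ hτ1 hp hpτ hb hb' hbb hbd).trans ?_
  simp only [hterm]
  rw [← mul_sum, failBound, hxL, ← hsdef]
  have hdeg' : 2 * (Λ.degQub b : ℝ) ≤ Λ.bdDegSum := by exact_mod_cast hdeg
  calc _ ≤ Λ.degQub b * (2 * s) * (x ^ L * (1 - x)⁻¹) := by gcongr
    _ = 2 * Λ.degQub b * Λ.tauStar / (s - √τ) * x ^ L := by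
        have h1 : 1 - x = (s - √τ) / s := by rw [hx]; field_simp
        have h2 : s - √τ ≠ 0 := (sub_pos.mpr hlt).ne'
        rw [h1, hss]
        field_simp
    _ ≤ _ := by
        have := sub_pos.mpr hlt
        gcongr

end STCLattice

/-! ### Composition of channels and the residual noise -/

namespace STCLattice

open Finset
open scoped Classical
open ColoredTriangulation Color

variable {Λ : STCLattice}

/-! ### Distributions -/

theorem sum_filter_le_add {X : Type} [Fintype X] {p : X → ℝ} (hp : ∀ x, 0 ≤ p x)
    {E F G : X → Prop} [DecidablePred E] [DecidablePred F] [DecidablePred G]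
    (h : ∀ x, E x → F x ∨ G x) :
    ∑ x with E x, p x ≤ ∑ x with F x, p x + ∑ x with G x, p x := by
  simp only [sum_filter]
  rw [← sum_add_distrib]
  refine sum_le_sum fun x _ => ?_
  have := hp x
  have := h x
  split_ifs <;> first | linarith | tauto

theorem law_prodMap {X Y Z W : Type} [Fintype X] [Fintype Y] (p : X → ℝ) (q : Y → ℝ) (f : X → Z)
    (g : Y → W) :
    law (fun y : X × Y => p y.1 * q y.2) (Prod.map f g)
      = fun y : Z × W => law p f y.1 * law q g y.2 := by
  funext y
  unfold law
  rw [sum_mul_sum, ← sum_product']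
  refine sum_congr ?_ fun _ _ => rfl
  ext x
  simp [Prod.ext_iff]

theorem law_id {X : Type} [Fintype X] (p : X → ℝ) : law p id = p := by
  funext x
  simp only [law, id, sum_filter]
  exact (sum_congr rfl fun a _ => by congr).trans (Fintype.sum_ite_eq' x p)

theorem law_fst {X Y Z : Type} [Fintype X] [Fintype Y] (p : X → ℝ) {q : Y → ℝ}
    (hq : IsDist q) (f : X → Z) :
    law (fun y : X × Y => p y.1 * q y.2) (fun y => f y.1) = law p f := by
  funext z
  exact hq.sum_prod_fst p fun x => f x = z

/-! ### Composition of channels -/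

theorem krausMap_sqrt_smul {n ι : Type} [Fintype n] [Fintype ι] {p : ι → ℝ} (hp : ∀ i, 0 ≤ p i)
    (A : ι → Matrix n n ℂ) (ρ : Matrix n n ℂ) :
    krausMap (fun i => (Real.sqrt (p i) : ℂ) • A i) ρ
      = ∑ i, p i • (A i * ρ * (A i).conjTranspose) := by
  unfold krausMap
  refine sum_congr rfl fun i _ => ?_
  rw [Matrix.conjTranspose_smul, Matrix.smul_mul, Matrix.smul_mul, Matrix.mul_smul, smul_smul]
  have : (Real.sqrt (p i) : ℂ) * star (Real.sqrt (p i) : ℂ) = ((p i : ℝ) : ℂ) := by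
    rw [Complex.star_def, Complex.conj_ofReal, ← Complex.ofReal_mul, Real.mul_self_sqrt (hp i)]
  rw [this]
  ext a b
  simp

theorem krausMap_weighted {n ι κ : Type} [Fintype n] [Fintype ι] [Fintype κ]
    {p : ι → ℝ} (hp : ∀ i, 0 ≤ p i) (A : ι → Matrix n n ℂ) (B : κ → Matrix n n ℂ)
    (ρ : Matrix n n ℂ) :
    krausMap (fun i => (Real.sqrt (p i) : ℂ) • A i) (krausMap B ρ)
      = ∑ i, p i • ∑ j, (A i * B j) * ρ * (A i * B j).conjTranspose := by
  rw [krausMap_sqrt_smul hp]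
  refine sum_congr rfl fun i _ => congrArg _ ?_
  unfold krausMap
  rw [Matrix.mul_sum, Matrix.sum_mul]
  refine sum_congr rfl fun j _ => ?_
  simp only [Matrix.conjTranspose_mul, Matrix.mul_assoc]

theorem krausMap_weighted_comp {n ι κ l : Type} [Fintype n] [Fintype ι] [Fintype κ] [Fintype l]
    {p : ι → ℝ} (hp : ∀ i, 0 ≤ p i) {q : κ → ℝ} (hq : ∀ i, 0 ≤ q i)
    (A : ι → Matrix n n ℂ) (B : κ → Matrix n n ℂ) (C : l → Matrix n n ℂ) (ρ : Matrix n n ℂ) :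
    krausMap (fun i => (Real.sqrt (p i) : ℂ) • A i)
        (krausMap (fun i => (Real.sqrt (q i) : ℂ) • B i) (krausMap C ρ))
      = ∑ i, ∑ j, (p i * q j) • ∑ k, (A i * (B j * C k)) * ρ *
          (A i * (B j * C k)).conjTranspose := by
  rw [krausMap_sqrt_smul hp, krausMap_weighted hq]
  refine sum_congr rfl fun i _ => ?_
  rw [Matrix.mul_sum, Matrix.sum_mul, smul_sum]
  refine sum_congr rfl fun j _ => ?_
  rw [Matrix.mul_smul, Matrix.smul_mul, smul_smul, Matrix.mul_sum, Matrix.sum_mul]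
  refine congrArg _ (sum_congr rfl fun k _ => ?_)
  simp only [Matrix.conjTranspose_mul, Matrix.mul_assoc]

theorem cochain_add_self {A : Type} (x : A → ZMod 2) : x + x = 0 := funext fun _ => zmod2_add_self _

theorem cochain_eq_of_add_eq_zero {A : Type} {x y : A → ZMod 2} (h : x + y = 0) : x = y :=
  funext fun a => zmod2_eq_of_add_eq_zero (congrFun h a)

theorem eq_add_iff {A : Type} {a b x : A → ZMod 2} : a = b + x ↔ b = a + x := by
  constructor <;> rintro rfl <;> rw [add_assoc, cochain_add_self, add_zero]

theorem pauliX_mul_apply (x : Λ.CQ) (M : Λ.Op) (a b : Λ.CQ) :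
    (pauliX x * M) a b = M (a + x) b := by
  simp only [Matrix.mul_apply, pauliX, Matrix.of_apply, eq_add_iff (a := a), ite_mul, one_mul,
    zero_mul, sum_ite_eq', mem_univ, if_true]

theorem pauliX_mul_pauliX_mul (x y : Λ.CQ) (M : Λ.Op) :
    pauliX x * (pauliX y * M) = pauliX (x + y) * M := by
  ext a b
  simp only [pauliX_mul_apply, add_assoc]

/-- The Pauli operator carries the code space into the subspace of syndrome `bdS x`. -/
theorem projS_mul_pauliX_mul_projS (σ : Λ.CS) (x : Λ.CQ) :
    projS σ * (pauliX x * projS 0) = if bdS x = σ then pauliX x * projS 0 else 0 := by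
  ext a b
  rw [projS, Matrix.diagonal_mul, pauliX_mul_apply]
  by_cases hab : a + x = b
  · subst hab
    by_cases ha : bdS (a + x) = 0
    · have : bdS a = bdS x := by
        rw [bdS_add] at ha
        exact cochain_eq_of_add_eq_zero ha
      by_cases hx : bdS x = σ
      · rw [if_pos (this.trans hx), if_pos hx, pauliX_mul_apply, one_mul]
      · rw [if_neg (this ▸ hx), if_neg hx, zero_mul, Matrix.zero_apply]
    · have h0 : (projS (0 : Λ.CS) : Λ.Op) (a + x) (a + x) = 0 := by
        rw [projS, Matrix.diagonal_apply_eq, if_neg ha]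
      rw [h0, mul_zero]
      split_ifs
      · rw [pauliX_mul_apply, h0]
      · rfl
  · have h0 : (projS (0 : Λ.CS) : Λ.Op) (a + x) b = 0 := by
      rw [projS, Matrix.diagonal_apply_ne _ hab]
    rw [h0, mul_zero]
    split_ifs
    · rw [pauliX_mul_apply, h0]
    · rfl

theorem projG_mul_pauliX_mul (φ : Λ.CM) (x : Λ.CQ) (M : Λ.Op) :
    projG φ * (pauliX x * M) = pauliX x * (projG (φ + deltaM x) * M) := by
  ext a b
  rw [pauliX_mul_apply, projG, projG, Matrix.diagonal_mul, Matrix.diagonal_mul, pauliX_mul_apply]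
  simp only [deltaM_add, add_left_inj]

theorem projG_mul_projS_eq_zero {φ : Λ.CM} (h : ∀ a : Λ.CQ, bdS a = 0 → deltaM a ≠ φ) :
    projG φ * projS 0 = (0 : Λ.Op) := by
  rw [projG, projS, Matrix.diagonal_mul_diagonal, ← Matrix.diagonal_zero]
  congr 1
  ext a
  by_cases ha : bdS a = 0
  · rw [if_neg (h a ha), zero_mul]
  · rw [if_neg ha, mul_zero]

namespace Decoder

variable (D : Λ.Decoder)

theorem bar_eq_law (p : Λ.CQ → ℝ) : D.bar p = law p fun x => D.recov (bdS x) := by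
  funext x'
  unfold bar law
  refine sum_congr ?_ fun _ _ => rfl
  ext x
  simp only [mem_filter, mem_univ, true_and]

/-- The total error after decoding when the measurement error is `y.1` and the qubit error is
`y.2`. -/
noncomputable def total (y : Λ.CM × Λ.CQ) : Λ.CQ :=
  D.recov (bdS y.2 + deltaS (y.1 + D.est (deltaR y.1))) + y.2

/-- On a code state with error `x` only the syndrome `bdS x` survives, and the correction composes
with the error to a Pauli operator. -/
theorem channel_comp {p : Λ.CM → ℝ} (hp : ∀ μ, 0 ≤ p μ) {p' : Λ.CQ → ℝ} (hp' : ∀ x, 0 ≤ p' x) :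
    D.channel p ∘ pauliChannel p' ∘ Λ.codeProj
      = pauliChannel (law (fun y : Λ.CM × Λ.CQ => p y.1 * p' y.2) D.total) ∘ Λ.codeProj := by
  funext ρ
  have hlaw : ∀ x, 0 ≤ law (fun y : Λ.CM × Λ.CQ => p y.1 * p' y.2) D.total x :=
    fun x => sum_nonneg fun y _ => mul_nonneg (hp _) (hp' _)
  have hl := krausMap_weighted_comp (p := fun y : Λ.CM × Λ.CS => p y.1) (fun y => hp y.1) hp'
    (fun y : Λ.CM × Λ.CS =>
      pauliX (D.recov (y.2 + deltaS (y.1 + D.est (deltaR y.1)))) * projS y.2)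
    pauliX (fun _ : Unit => projS 0) ρ
  have hr := krausMap_weighted hlaw pauliX (fun _ : Unit => projS 0) ρ
  refine hl.trans (Eq.trans ?_ hr.symm)
  rw [sum_law_mul, Fintype.sum_prod_type, Fintype.sum_prod_type]
  refine sum_congr rfl fun μ _ => ?_
  rw [sum_comm]
  refine sum_congr rfl fun x _ => ?_
  rw [sum_eq_single (bdS x)]
  · rw [Fintype.sum_unique, Fintype.sum_unique]
    dsimp only
    rw [Matrix.mul_assoc (pauliX _) (projS _) (pauliX x * projS 0), projS_mul_pauliX_mul_projS,
      if_pos rfl, pauliX_mul_pauliX_mul]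
    rfl
  · intro σ _ hσ
    rw [Fintype.sum_unique]
    dsimp only
    rw [Matrix.mul_assoc (pauliX _) (projS _) (pauliX x * projS 0), projS_mul_pauliX_mul_projS,
      if_neg hσ.symm, Matrix.mul_zero, Matrix.zero_mul, Matrix.zero_mul, smul_zero]
  · simp

theorem gaugeChannel_comp {p : Λ.CM → ℝ} (hp : ∀ μ, 0 ≤ p μ) {p' : Λ.CQ → ℝ}
    (hp' : ∀ x, 0 ≤ p' x) :
    D.gaugeChannel p ∘ pauliChannel p' ∘ Λ.codeProj
      = pauliChannel (law (fun y : Λ.CM × Λ.CQ => p y.1 * p' y.2) D.total) ∘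
        Λ.gaugeDephasing ∘ Λ.codeProj := by
  funext ρ
  have hlaw : ∀ x, 0 ≤ law (fun y : Λ.CM × Λ.CQ => p y.1 * p' y.2) D.total x :=
    fun x => sum_nonneg fun y _ => mul_nonneg (hp _) (hp' _)
  have hl := krausMap_weighted_comp (p := fun y : Λ.CM × Λ.CM => p y.1) (fun y => hp y.1) hp'
    (fun y : Λ.CM × Λ.CM =>
      pauliX (D.recov (deltaS (y.2 + y.1 + D.est (deltaR (y.2 + y.1))))) * projG y.2)
    pauliX (fun _ : Unit => projS 0) ρ
  have hr := krausMap_weighted hlaw pauliX (fun φ : Λ.CM => projG φ * projS 0) ρ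
  have hdeph : Λ.gaugeDephasing (Λ.codeProj ρ) = krausMap (fun φ : Λ.CM => projG φ * projS 0) ρ := by
    unfold gaugeDephasing codeProj krausMap
    refine sum_congr rfl fun φ _ => ?_
    rw [Fintype.sum_unique]
    simp only [Matrix.conjTranspose_mul, Matrix.mul_assoc]
  refine hl.trans (Eq.trans ?_ (Eq.trans hr.symm (congrArg _ hdeph.symm)))
  rw [sum_law_mul, Fintype.sum_prod_type, Fintype.sum_prod_type]
  refine sum_congr rfl fun μ _ => ?_
  rw [sum_comm]
  refine sum_congr rfl fun x _ => ?_
  rw [smul_sum]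
  -- Moving the projection past the error shifts the flux by `deltaM x`. The shifted flux must occur
  -- in the code space or its term vanishes; if it does, the correction depends on `φ` only through
  -- `bdS x`.
  refine Fintype.sum_equiv (Equiv.addRight (deltaM x)) _ _ fun φ => ?_
  rw [Fintype.sum_unique]
  refine congrArg _ ?_
  dsimp only [Equiv.coe_addRight]
  rw [Matrix.mul_assoc (pauliX _) (projG _), projG_mul_pauliX_mul, pauliX_mul_pauliX_mul]
  by_cases h : ∃ a : Λ.CQ, bdS a = 0 ∧ deltaM a = φ + deltaM x
  · obtain ⟨a, ha, hφ⟩ := h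
    have hφ' : φ = deltaM (a + x) := by
      rw [deltaM_add, hφ, add_assoc, cochain_add_self, add_zero]
    have hR : deltaR φ = 0 := by rw [hφ', deltaR_deltaM]
    have hS : deltaS φ = bdS x := by rw [hφ', deltaS_deltaM, bdS_add, ha, zero_add]
    have htotal : D.recov (deltaS (φ + μ + D.est (deltaR (φ + μ)))) + x = D.total (μ, x) := by
      rw [total, deltaR_add, hR, zero_add, add_assoc, deltaS_add φ, hS]
    rw [htotal]
  · push Not at h
    rw [projG_mul_projS_eq_zero h]
    simp only [Matrix.mul_zero, Matrix.zero_mul]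

/-- The recovery removes the syndrome of the incoming error together with the shift, so only the
shift remains. This is the reason why noise does not accumulate over rounds. -/
theorem bdS_total (y : Λ.CM × Λ.CQ) : bdS (D.total y) = bdS (D.residual y.1) := by
  obtain ⟨w, hw⟩ := D.exists_bdS y.1
  rw [total, bdS_add, hw, ← bdS_add y.2, D.recov_syndrome, bdS_residual, hw, bdS_add, add_right_comm,
    cochain_add_self, zero_add]

theorem recov_bdS_residual (μ : Λ.CM) : D.recov (bdS (D.residual μ)) = D.residual μ := by
  rw [bdS_residual, residual]

/-- Unless ideal decoding of `x` fails, `x` may be replaced by its ideal recovery `b x` modulo the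
gauge group. The law of `b x` is the same for `p'` and `q`, so one passes from `x` to `b x` under
`p'` and back under `q`, paying one failure probability each way; what remains is the failure for `M
+ x`. -/
theorem fail_law_total_le {p : Λ.CM → ℝ} (hp : IsDist p) {p' q : Λ.CQ → ℝ} (hp' : IsDist p')
    (hq : IsDist q) (hbar : D.bar q = D.bar p') :
    D.fail (law (fun y : Λ.CM × Λ.CQ => p y.1 * p' y.2) D.total) ≤ D.fail p' + D.fail q +
      D.fail (law (fun y : Λ.CQ × Λ.CQ => law p D.residual y.1 * q y.2) fun y => y.1 + y.2) := by
  have hres : IsDist (law p D.residual) := hp.law _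
  set E : Λ.CQ × Λ.CQ → Prop :=
    fun y => ¬ InGauge (D.recov (bdS y.1 + bdS y.2) + (y.1 + y.2)) with hE
  set b : Λ.CQ → Λ.CQ := fun x => D.recov (bdS x) with hb
  have hbS : ∀ x, bdS (b x) = bdS x := D.recov_syndrome
  have hsplit : ∀ M x, InGauge (b x + x) → InGauge (D.recov (bdS M + bdS (b x)) + (M + b x)) →
      InGauge (D.recov (bdS M + bdS x) + (M + x)) := by
    intro M x h1 h2
    rw [hbS] at h2
    have h := h2.add h1
    have h3 : D.recov (bdS M + bdS x) + (M + b x) + (b x + x)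
        = D.recov (bdS M + bdS x) + (M + x) + (b x + b x) := by abel
    rwa [h3, cochain_add_self, add_zero] at h
  have hsplit' : ∀ M x, InGauge (b x + x) → InGauge (D.recov (bdS M + bdS x) + (M + x)) →
      InGauge (D.recov (bdS M + bdS (b x)) + (M + b x)) := by
    intro M x h1 h2
    have h := h2.add h1
    have h3 : D.recov (bdS M + bdS x) + (M + x) + (b x + x)
        = D.recov (bdS M + bdS x) + (M + b x) + (x + x) := by abel
    rw [hbS]
    rwa [h3, cochain_add_self, add_zero] at h
  have hbar' : law q b = law p' b := by rw [← D.bar_eq_law, ← D.bar_eq_law, hbar]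
  have step1 : D.fail (law (fun y : Λ.CM × Λ.CQ => p y.1 * p' y.2) D.total)
      ≤ D.fail p' + ∑ y : Λ.CM × Λ.CQ with E (D.residual y.1, b y.2), p y.1 * p' y.2 := by
    unfold fail
    rw [sum_law, ← IsDist.sum_prod_snd p' hp]
    refine sum_filter_le_add (fun y => mul_nonneg (hp.1 _) (hp'.1 _)) fun y hy => ?_
    by_contra hcon
    rw [not_or, not_not, hE] at hcon
    obtain ⟨h1, h2⟩ := hcon
    rw [not_not] at h2
    refine hy ?_
    have h := hsplit _ _ h1 h2
    rw [bdS_total, recov_bdS_residual, total, ← bdS_residual]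
    rwa [add_comm (bdS y.2), add_comm (D.residual y.1), add_assoc, add_comm y.2]
  have step2 : ∑ y : Λ.CM × Λ.CQ with E (D.residual y.1, b y.2), p y.1 * p' y.2
      = ∑ y : Λ.CQ × Λ.CQ with E (y.1, b y.2), law p D.residual y.1 * q y.2 := by
    have e1 := sum_law (fun y : Λ.CM × Λ.CQ => p y.1 * p' y.2) (Prod.map D.residual b) E
    have e2 := sum_law (fun y : Λ.CQ × Λ.CQ => law p D.residual y.1 * q y.2) (Prod.map id b) E
    rw [law_prodMap] at e1 e2
    rw [law_id, hbar'] at e2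
    exact e1.symm.trans e2
  have step3 : ∑ y : Λ.CQ × Λ.CQ with E (y.1, b y.2), law p D.residual y.1 * q y.2
      ≤ D.fail q +
      D.fail (law (fun y : Λ.CQ × Λ.CQ => law p D.residual y.1 * q y.2) fun y => y.1 + y.2) := by
    unfold fail
    rw [sum_law, ← IsDist.sum_prod_snd q hres]
    refine sum_filter_le_add (fun y => mul_nonneg (hres.1 _) (hq.1 _)) fun y hy => ?_
    by_contra hcon
    rw [not_or, not_not, not_not] at hcon
    obtain ⟨h1, h2⟩ := hcon
    rw [bdS_add] at h2
    exact hy (hsplit' _ _ h1 h2)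
  linarith

/-- The residual noise. -/
theorem law_total_mem_noise {c η τ ε : ℝ} {L : ℕ} (hc : 0 < c) (hne : Nonempty Λ.Stab)
    (hL1 : 1 ≤ L) (hL : Λ.BoundaryDistGE L) (hconf : Λ.FluxConfinement c) (hη : 0 ≤ η)
    (hτ : 0 ≤ τ) (hs : Λ.SmallEnough c η τ) {p : Λ.CM → ℝ} (hp : IsDist p) (hpη : IsBounded η p)
    {p' : Λ.CQ → ℝ} (hp' : IsDist p') (hfail : D.fail p' ≤ ε) {q : Λ.CQ → ℝ} (hq : IsDist q)
    (hqτ : IsBounded τ q) (hbar : D.bar q = D.bar p') :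
    pauliChannel (law (fun y : Λ.CM × Λ.CQ => p y.1 * p' y.2) D.total)
      ∈ D.noise (Λ.tauRes c η) (Λ.epsRes L c η τ ε) := by
  have hdist := IsDist.prod hp hp'
  have hdR := two_le_maxDegL hne
  have hdQ := two_le_maxDegQub hne
  have hτ' := tauRes_nonneg (c := c) hdR hη
  have hs2 : τ + Λ.tauRes c η < Λ.tauStar := hs.2
  have hres : IsDist (law p D.residual) := hp.law _
  have hresτ := D.isBounded_law_residual hc hconf hdR hη hs hp hpη
  have hM := IsBounded.add hres hq hresτ hqτ hτ'
  have hMdist := (hres.prod hq).law fun y : Λ.CQ × Λ.CQ => y.1 + y.2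
  refine ⟨_, hdist.law _, rfl, ?_, law p D.residual, hp.law _,
    hresτ, ?_⟩
  · have h1 := D.fail_le_failBound hL hL1 hdQ hτ (by linarith) hq hqτ
    have h2 := D.fail_le_failBound hL hL1 hdQ (add_nonneg hτ' hτ) (by linarith)
      hMdist hM
    refine (D.fail_law_total_le hp hp' hq hbar).trans ?_
    rw [epsRes, add_comm τ]
    gcongr
  · rw [bar_eq_law, bar_eq_law, law_law, law_law, ← law_fst p hp']
    congr 1
    funext y
    exact congrArg D.recov (D.bdS_total y).symm

end Decoder

end STCLattice

/-! ### Uniformity of the constants along a family -/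

namespace STCLattice

open Finset Filter Topology
open scoped Classical
open ColoredTriangulation Color

variable {Λ : STCLattice}

/-! ### The constants -/

theorem inv_le_tauStar {d : ℕ} (h : 2 ≤ Λ.maxDegQub) (hd : Λ.maxDegQub ≤ d) :
    ((2 * ((d : ℝ) - 1)) ^ 2)⁻¹ ≤ Λ.tauStar := by
  have h' : (2 : ℝ) ≤ Λ.maxDegQub := by exact_mod_cast h
  have hd' : (Λ.maxDegQub : ℝ) ≤ d := by exact_mod_cast hd
  have h0 : 0 < (Λ.maxDegQub : ℝ) - 1 := by linarith
  unfold tauStar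
  gcongr

theorem tauStar_le_one (h : 2 ≤ Λ.maxDegQub) : Λ.tauStar ≤ 1 := by
  have h' : (2 : ℝ) ≤ Λ.maxDegQub := by exact_mod_cast h
  exact inv_le_one_of_one_le₀ (by nlinarith)

/-- The parameter of the residual noise for the degree `d`. -/
noncomputable def tauResAt (d c η : ℝ) : ℝ :=
  2 ^ (2 * (1 + c⁻¹) - 1) * (Real.exp 1 * η ^ (2 + 2 * c)⁻¹) ^ (1 + c⁻¹) * (d - 1) ^ (1 + c⁻¹ - 1)

theorem tauRes_le_tauResAt {c η d : ℝ} (hc : 0 < c) (hη : 0 ≤ η) (h : 2 ≤ Λ.maxDegL)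
    (hd : Λ.maxDegL ≤ d) : Λ.tauRes c η ≤ tauResAt d c η := by
  have h1 := one_le_maxDegL_sub_one h
  have hr := Real.rpow_nonneg hη (2 + 2 * c)⁻¹
  have ht : 0 ≤ 1 + c⁻¹ - 1 := by rw [add_sub_cancel_left]; positivity
  exact mul_le_mul_of_nonneg_left (Real.rpow_le_rpow (by linarith) (by linarith) ht) (by positivity)

theorem continuous_tauResAt {d c : ℝ} (hc : 0 < c) : Continuous (tauResAt d c) := by
  unfold tauResAt
  refine (continuous_const.mul ((continuous_const.mul ?_).rpow_const ?_)).mul continuous_const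
  · exact continuous_id.rpow_const fun _ => Or.inr (by positivity)
  · exact fun _ => Or.inr (by positivity)

theorem tauResAt_zero {d c : ℝ} (hc : 0 < c) : tauResAt d c 0 = 0 := by
  rw [tauResAt, Real.zero_rpow (by positivity), mul_zero, Real.zero_rpow (by positivity), mul_zero,
    zero_mul]

theorem failBound_nonneg (h : 2 ≤ Λ.maxDegQub) (L : ℕ) {v : ℝ} (hv : 0 ≤ v) (hv' : v ≤ Λ.tauStar) :
    0 ≤ Λ.failBound L v := by
  have hts := tauStar_pos h
  have := sub_nonneg.mpr (Real.sqrt_le_sqrt hv')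
  unfold failBound
  positivity

/-- Apart from `bdDegSum`, the bound depends on the lattice only through the ratio `ρ`; it decays
exponentially in `L`. -/
theorem failBound_le (h : 2 ≤ Λ.maxDegQub) (L : ℕ) {v ρ : ℝ} (hv : 0 ≤ v) (hρ : ρ < 1)
    (hvρ : v / Λ.tauStar ≤ ρ) :
    Λ.failBound L v ≤ Λ.bdDegSum * ((1 - √ρ)⁻¹ * √ρ ^ L) := by
  have hts := tauStar_pos h
  have hρ0 : 0 ≤ ρ := le_trans (by positivity) hvρ
  have hs : 0 < √Λ.tauStar := Real.sqrt_pos.mpr hts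
  have hs1 : √Λ.tauStar ≤ 1 := Real.sqrt_le_one.mpr (tauStar_le_one h)
  have hρ1 : 0 < 1 - √ρ := by
    rw [sub_pos, Real.sqrt_lt' one_pos, one_pow]
    exact hρ
  have hsv : √v ≤ √ρ * √Λ.tauStar := by
    rw [← Real.sqrt_mul hρ0]
    exact Real.sqrt_le_sqrt ((div_le_iff₀ hts).mp hvρ)
  have h1 : Λ.tauStar / (√Λ.tauStar - √v) ≤ (1 - √ρ)⁻¹ := by
    calc Λ.tauStar / (√Λ.tauStar - √v) ≤ Λ.tauStar / (√Λ.tauStar * (1 - √ρ)) := by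
          gcongr
          linarith
      _ = √Λ.tauStar * (1 - √ρ)⁻¹ := by
          nth_rewrite 1 [← Real.mul_self_sqrt hts.le]
          field_simp
      _ ≤ (1 - √ρ)⁻¹ := mul_le_of_le_one_left (by positivity) hs1
  have h2 : (v / Λ.tauStar) ^ ((L : ℝ) / 2) ≤ √ρ ^ L := by
    calc _ ≤ ρ ^ ((L : ℝ) / 2) := Real.rpow_le_rpow (by positivity) hvρ (by positivity)
      _ = √ρ ^ L := by
          rw [Real.sqrt_eq_rpow, ← Real.rpow_mul_natCast hρ0]
          congr 1
          ring
  rw [failBound, mul_div_assoc, mul_assoc]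
  gcongr

/-- The smallness conditions hold uniformly for bounded degrees. -/
theorem exists_smallEnough {c : ℝ} (hc : 0 < c) {dL dQ : ℕ} (hdL : 2 ≤ dL) (hdQ : 2 ≤ dQ) :
    ∃ η₀ > 0, ∃ τ₀ > 0, ∀ η τ : ℝ, 0 ≤ η → η < η₀ → 0 ≤ τ → τ < τ₀ → ∀ Λ : STCLattice,
      2 ≤ Λ.maxDegL → Λ.maxDegL ≤ dL → 2 ≤ Λ.maxDegQub → Λ.maxDegQub ≤ dQ →
        Λ.SmallEnough c η τ := by
  have hdL' : (2 : ℝ) ≤ dL := by exact_mod_cast hdL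
  have hdQ' : (2 : ℝ) ≤ dQ := by exact_mod_cast hdQ
  have hL1 : 0 < (dL : ℝ) - 1 := by linarith
  have hQ1 : 0 < (dQ : ℝ) - 1 := by linarith
  have he : 0 < Real.exp 1 - 1 := sub_pos.mpr (Real.one_lt_exp_iff.mpr one_pos)
  set r := (2 + 2 * c)⁻¹ with hr
  have hr0 : 0 < r := by positivity
  set s := ((2 * ((dQ : ℝ) - 1)) ^ 2)⁻¹ with hs
  have hs0 : 0 < s := by positivity
  obtain ⟨δ, hδ, hδs⟩ := Metric.continuousAt_iff.mp
    ((continuous_tauResAt (d := dL) hc).continuousAt (x := 0)) (s / 2) (half_pos hs0)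
  refine ⟨min δ ((Real.exp 1 - 1) ^ (1 / r) * (4 * Real.exp 1 ^ 2 * ((dL : ℝ) - 1)) ^ (-(1 / r))),
    by positivity, s / 2, half_pos hs0, fun η τ hη hη' hτ hτ' Λ h1 h2 h3 h4 => ⟨?_, ?_⟩⟩
  · have h1' := one_le_maxDegL_sub_one h1
    have h2' : (Λ.maxDegL : ℝ) ≤ dL := by exact_mod_cast h2
    refine (hη'.trans_le (min_le_right _ _)).trans_le ?_
    refine mul_le_mul_of_nonneg_left ?_ (by positivity)
    refine Real.rpow_le_rpow_of_nonpos (by positivity) (by gcongr) ?_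
    rw [neg_nonpos]
    positivity
  · have h5 := tauRes_le_tauResAt (d := dL) hc hη h1 (by exact_mod_cast h2)
    have h6 := hδs (x := η) (by
      rw [dist_zero_right, Real.norm_of_nonneg hη]
      exact hη'.trans_le (min_le_left _ _))
    rw [tauResAt_zero hc, dist_zero_right] at h6
    have h7 := inv_le_tauStar h3 h4
    have h8 := (le_abs_self _).trans_lt h6
    linarith

theorem tendstoUniformlyOn_tauRes {c : ℝ} (hc : 0 < c) {Λ : ℕ → STCLattice} {dL : ℕ} {S : Set ℕ}
    (h : ∀ L ∈ S, 2 ≤ (Λ L).maxDegL ∧ (Λ L).maxDegL ≤ dL) :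
    TendstoUniformlyOn (fun (η : ℝ) (L : ℕ) => (Λ L).tauRes c η) (fun _ => 0) (𝓝[≥] 0) S := by
  rw [Metric.tendstoUniformlyOn_iff]
  intro ε hε
  have h0 : Tendsto (tauResAt dL c) (𝓝[≥] 0) (𝓝 0) := by
    have := (continuous_tauResAt (d := dL) hc).tendsto 0
    rw [tauResAt_zero hc] at this
    exact this.mono_left nhdsWithin_le_nhds
  filter_upwards [h0.eventually_lt_const hε, self_mem_nhdsWithin] with η hη hη0 L hL
  obtain ⟨h1, h2⟩ := h L hL
  rw [dist_zero_left, Real.norm_of_nonneg (tauRes_nonneg h1 hη0)]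
  exact (tauRes_le_tauResAt hc hη0 h1 (by exact_mod_cast h2)).trans_lt hη

/-- Finitely many numbers less than one are uniformly less than one. -/
theorem exists_lt_one_forall_le {I : Type} (s : Finset I) (f : I → ℝ) :
    ∃ ρ < 1, ∀ i ∈ s, f i < 1 → f i ≤ ρ := by
  induction s using Finset.induction_on with
  | empty => exact ⟨0, one_pos, by simp⟩
  | insert a s _ ih =>
    obtain ⟨ρ, hρ, h⟩ := ih
    by_cases ha : f a < 1
    · refine ⟨max ρ (f a), max_lt hρ ha, fun i hi hfi => ?_⟩
      rcases mem_insert.mp hi with rfl | hi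
      · exact le_max_right _ _
      · exact (h i hi hfi).trans (le_max_left _ _)
    · refine ⟨ρ, hρ, fun i hi hfi => ?_⟩
      rcases mem_insert.mp hi with rfl | hi
      · exact absurd hfi ha
      · exact h i hi hfi

theorem tendsto_epsRes {c : ℝ} {Λ : ℕ → STCLattice} {dL dQ k : ℕ} {C : ℝ}
    (hdL : ∀ L, 1 ≤ L → 2 ≤ (Λ L).maxDegL ∧ (Λ L).maxDegL ≤ dL)
    (hdQ : ∀ L, 1 ≤ L → 2 ≤ (Λ L).maxDegQub ∧ (Λ L).maxDegQub ≤ dQ)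
    (hC : ∀ L, 1 ≤ L → ((Λ L).bdDegSum : ℝ) ≤ C * (L : ℝ) ^ k) {η τ ε : ℝ} (hη : 0 ≤ η)
    (hτ : 0 ≤ τ) (hs : ∀ᶠ L in atTop, (Λ L).SmallEnough c η τ) :
    Tendsto (fun L => (Λ L).epsRes L c η τ ε) atTop (𝓝 ε) := by
  -- Smallness gives a ratio below one for each lattice, but no uniform gap. As the ratio depends
  -- only on two bounded integer degrees, it takes finitely many values, so a common bound `ρ < 1`
  -- exists.
  obtain ⟨ρ, hρ, hle⟩ := exists_lt_one_forall_le (range (dL + 1) ×ˢ range (dQ + 1))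
    fun i => (τ + tauResAt i.1 c η) / ((2 * ((i.2 : ℝ) - 1)) ^ 2)⁻¹
  have hρ' : ∀ᶠ L in atTop, 1 ≤ L ∧ (τ + (Λ L).tauRes c η) / (Λ L).tauStar ≤ ρ ∧
      (Λ L).SmallEnough c η τ := by
    filter_upwards [hs, eventually_ge_atTop 1] with L hL hL1
    refine ⟨hL1, hle (⟨(Λ L).maxDegL, (Λ L).maxDegQub⟩ : ℕ × ℕ) ?_ ?_, hL⟩
    · have := hdL L hL1
      have := hdQ L hL1
      simp only [mem_product, mem_range]
      omega
    · exact (div_lt_one (tauStar_pos (hdQ L hL1).1)).mpr hL.2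
  have hzero : Tendsto (fun L : ℕ => C * (1 - √ρ)⁻¹ * ((L : ℝ) ^ k * √ρ ^ L)) atTop (𝓝 0) := by
    have : |√ρ| < 1 := by
      rw [abs_of_nonneg (Real.sqrt_nonneg _), Real.sqrt_lt' one_pos, one_pow]
      exact hρ
    simpa using (tendsto_pow_const_mul_const_pow_of_abs_lt_one k this).const_mul (C * (1 - √ρ)⁻¹)
  have key : ∀ v : ℕ → ℝ, (∀ L, 1 ≤ L → 0 ≤ v L ∧ v L ≤ τ + (Λ L).tauRes c η) →
      Tendsto (fun L => (Λ L).failBound L (v L)) atTop (𝓝 0) := by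
    intro v hv
    refine squeeze_zero' ?_ ?_ hzero
    · filter_upwards [hρ'] with L hL
      obtain ⟨hL1, -, hL⟩ := hL
      exact failBound_nonneg (hdQ L hL1).1 L (hv L hL1).1 ((hv L hL1).2.trans hL.2.le)
    · filter_upwards [hρ'] with L hL
      obtain ⟨hL1, hL, -⟩ := hL
      have hts := tauStar_pos (hdQ L hL1).1
      have hvρ : v L / (Λ L).tauStar ≤ ρ :=
        (div_le_div_of_nonneg_right (hv L hL1).2 hts.le).trans hL
      refine (failBound_le (hdQ L hL1).1 L (hv L hL1).1 hρ hvρ).trans ?_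
      have : 0 ≤ (1 - √ρ)⁻¹ * √ρ ^ L := by
        have : √ρ ≤ 1 := Real.sqrt_le_one.mpr hρ.le
        have := sub_nonneg.mpr this
        positivity
      refine (mul_le_mul_of_nonneg_right (hC L hL1) this).trans_eq ?_
      ring
  have h0 := fun L hL => tauRes_nonneg (c := c) (hdL L hL).1 hη
  have h1 := key (fun _ => τ) fun L hL => ⟨hτ, by linarith [h0 L hL]⟩
  have h2 := key (fun L => τ + (Λ L).tauRes c η) fun L hL => ⟨by linarith [h0 L hL], le_rfl⟩
  simpa [epsRes] using (h1.const_add ε).add h2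

end STCLattice

/-! ### The theorem -/

open Filter Topology in
theorem theorem1 (c : ℝ) (hc : 0 < c) :
    -- one round of error correction on a single lattice
    (∀ (Λ : STCLattice) (L : ℕ), 1 ≤ L → Nonempty Λ.Stab → Λ.BoundaryDistGE L →
      Λ.FluxConfinement c →
      ∀ (D : Λ.Decoder) (η τ ε : ℝ), 0 ≤ η → 0 ≤ τ → Λ.SmallEnough c η τ →
        compClass (compClass (D.channels η) (D.noise τ ε)) {Λ.codeProj} ⊆
            compClass (D.noise (Λ.tauRes c η) (Λ.epsRes L c η τ ε)) {Λ.codeProj} ∧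
          compClass (compClass (D.gaugeChannels η) (D.noise τ ε)) {Λ.codeProj} ⊆
            compClass (compClass (D.noise (Λ.tauRes c η) (Λ.epsRes L c η τ ε))
              {Λ.gaugeDephasing}) {Λ.codeProj}) ∧
    -- the constants along a family of lattices
    (∀ (Λ : ℕ → STCLattice) (dL dQub k : ℕ) (C : ℝ),
      (∀ L, 1 ≤ L → Nonempty (Λ L).Stab ∧ (Λ L).maxDegL ≤ dL ∧ (Λ L).maxDegQub ≤ dQub ∧
        ((Λ L).bdDegSum : ℝ) ≤ C * (L : ℝ) ^ k) →
      (∃ η₀ > 0, ∃ τ₀ > 0, ∀ η τ : ℝ, 0 ≤ η → η < η₀ → 0 ≤ τ → τ < τ₀ →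
        ∀ L, 1 ≤ L → (Λ L).SmallEnough c η τ) ∧
      TendstoUniformlyOn (fun (η : ℝ) (L : ℕ) => (Λ L).tauRes c η) (fun _ => 0) (𝓝[≥] 0)
        {L | 1 ≤ L} ∧
      ∀ η τ ε : ℝ, 0 ≤ η → 0 ≤ τ → (∀ᶠ L in atTop, (Λ L).SmallEnough c η τ) →
        Tendsto (fun L => (Λ L).epsRes L c η τ ε) atTop (𝓝 ε)) := by
  refine ⟨fun Λ L hL1 hne hL hconf D η τ ε hη hτ hs => ⟨?_, ?_⟩,
    fun Λ dL dQub k C h => ?_⟩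
  · rintro _ ⟨_, ⟨_, ⟨p, hp, hpη, rfl⟩, _, ⟨p', hp', rfl, hfail, q, hq, hqτ, hbar⟩, rfl⟩, _, rfl, rfl⟩
    exact ⟨_, D.law_total_mem_noise hc hne hL1 hL hconf hη hτ hs hp hpη hp' hfail hq hqτ hbar,
      _, rfl, (D.channel_comp hp.1 hp'.1).symm⟩
  · rintro _ ⟨_, ⟨_, ⟨p, hp, hpη, rfl⟩, _, ⟨p', hp', rfl, hfail, q, hq, hqτ, hbar⟩, rfl⟩, _, rfl, rfl⟩
    exact ⟨_, ⟨_, D.law_total_mem_noise hc hne hL1 hL hconf hη hτ hs hp hpη hp' hfail hq hqτ hbar,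
      _, rfl, rfl⟩, _, rfl, (D.gaugeChannel_comp hp.1 hp'.1).symm⟩
  · have hdL := fun L hL =>
      And.intro (STCLattice.two_le_maxDegL (h L hL).1) (h L hL).2.1
    have hdQ := fun L hL =>
      And.intro (STCLattice.two_le_maxDegQub (h L hL).1) (h L hL).2.2.1
    refine ⟨?_, STCLattice.tendstoUniformlyOn_tauRes hc hdL, fun η τ ε hη hτ hs =>
      STCLattice.tendsto_epsRes hdL hdQ (fun L hL => (h L hL).2.2.2) hη hτ hs⟩
    -- That the degree bounds are at least 2 is read off from the lattice with `L = 1`.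
    obtain ⟨η₀, hη₀, τ₀, hτ₀, hsm⟩ := STCLattice.exists_smallEnough hc
      ((hdL 1 le_rfl).1.trans (hdL 1 le_rfl).2) ((hdQ 1 le_rfl).1.trans (hdQ 1 le_rfl).2)
    exact ⟨η₀, hη₀, τ₀, hτ₀, fun η τ h1 h2 h3 h4 L hL => hsm η τ h1 h2 h3 h4 (Λ L)
      (hdL L hL).1 (hdL L hL).2 (hdQ L hL).1 (hdQ L hL).2⟩
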